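/- Let $d\ge 1$, let $\tilde I\subset\mathbb R$ be a compact interval, let $c>0$, and let $1\le p<\frac{d^2+d+2}{d^2+d}$, $\frac1p+\frac1{p'}=1$, $q=\frac{2p'}{d^2+d}$ (so $p'=q=\infty$ and $1/p'=0$ if $p=1$). Then there is a constant $C_p>0$, depending only on $d,\tilde I,c,p$, with the following property. Let $\gamma\in C^d(\tilde I;\mathbb R^d)$, let $I=[a,b]\subseteq\tilde I$ be a compact interval and let $k\in\mathbb Z$. For $m\ge 1$ and $h\in\mathbb R^m$ with $0\le h_1\le\dots\le h_m$, put $I_h=[a-h_1,\,b-h_m]$ (empty if $b-h_m<a-h_1$) and let $\gamma_h(t)=\frac1m\sum_{j=1}^m\gamma(t+h_j)$, $t\in I_h$, be the corresponding offspring curve. For a curve $\zeta$ in $\mathbb R^d$ write $\Phi_\zeta(t_1,\dots,t_d)=\zeta(t_1)+\dots+\zeta(t_d)$ and $J_{\Phi_\zeta}(t_1,\dots,t_d)=\det[\zeta'(t_1),\dots,\zeta'(t_d)]$, with one-sided derivatives at endpoints, and let $v(t_1,\dots,t_d)=\prod_{1\le i<j\le d}(t_j-t_i)$. Suppose that for every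 such $m$ and $h$: 1. $\Phi_{\gamma_h}$ is injective on $\{(t_1,\dots,t_d)\in I_h^d : t_1<\dots<t_d\}$; 2. if $I_h$ has more than one point, then $|J_{\Phi_{\gamma_h}}(t_1,\dots,t_d)|\ge c\,2^{-k}\,|v(t_1,\dots,t_d)|$ for all $(t_1,\dots,t_d)\in I_h^d$. Then for every such $m$ and $h$ and every $f\in L^p(\mathbb R^d)$, $$\|\hat f\circ\gamma_h\|_{L^q(I_h)}\le 2^{k/p'}\,C_p\,\|f\|_{L^p(\mathbb R^d)}.$$ Here $\hat f(\xi)=\int_{\mathbb R^d} e^{-ix\cdot\xi}f(x)\,dx$ for $f\in L^1(\mathbb R^d)$; for general $f\in L^p(\mathbb R^d)$, $\hat f\circ\gamma_h$ denotes the value at $f$ of the unique bounded linear extension $L^p(\mathbb R^d)\to L^q(I_h)$ of the map $f\mapsto\hat f\circ\gamma_h$ on $L^1\cap L^p$, whose existence is part of the assertion. -/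

import Mathlib

open MeasureTheory
open scoped ENNReal

/-- The parameters of an offspring curve: `0 ≤ h₁ ≤ ⋯ ≤ hₘ` with `m ≥ 1`
(written with `m + 1` entries `h 0, …, h (Fin.last m)`). -/
def IsOffspringParameter {m : ℕ} (h : Fin (m + 1) → ℝ) : Prop :=
  0 ≤ h 0 ∧ Monotone h

/-- The offspring curve `γ_h(t)`, the average of the translates `γ(t + h_j)`. -/
noncomputable def offspringCurve {d m : ℕ} (γ : ℝ → EuclideanSpace ℝ (Fin d))
    (h : Fin (m + 1) → ℝ) (t : ℝ) : EuclideanSpace ℝ (Fin d) :=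
  ((m : ℝ) + 1)⁻¹ • ∑ j, γ (t + h j)

/-- For `I = [a, b]`, the interval `I_h = [a - h₁, b - hₘ]` (empty if `b - hₘ < a - h₁`). -/
def offspringInterval {m : ℕ} (a b : ℝ) (h : Fin (m + 1) → ℝ) : Set ℝ :=
  Set.Icc (a - h 0) (b - h (Fin.last m))

/-- `Φ_ζ(t₁, …, t_d) = ζ(t₁) + ⋯ + ζ(t_d)`. -/
noncomputable def curveSum {d : ℕ} (ζ : ℝ → EuclideanSpace ℝ (Fin d)) (t : Fin d → ℝ) :
    EuclideanSpace ℝ (Fin d) :=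
  ∑ j, ζ (t j)

/-- The Jacobian `J_{Φ_ζ}(t₁, …, t_d) = det[ζ'(t₁), …, ζ'(t_d)]` of `Φ_ζ` for a curve `ζ` on the
interval `J`; the derivatives are one-sided at the endpoints of `J`. -/
noncomputable def curveSumJacobian {d : ℕ} (ζ : ℝ → EuclideanSpace ℝ (Fin d)) (J : Set ℝ)
    (t : Fin d → ℝ) : ℝ :=
  (Matrix.of fun i j : Fin d => derivWithin ζ J (t j) i).det

/-- The Vandermonde determinant, the product of `t_j - t_i` over `i < j`. -/
def vandermondeProduct {d : ℕ} (t : Fin d → ℝ) : ℝ :=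
  ∏ i, ∏ j ∈ Finset.Ioi i, (t j - t i)

/-- The Fourier transform `f̂(ξ) = ∫ e^{-i x·ξ} f(x) dx` of an integrable function. -/
noncomputable def fourierHat {d : ℕ} (f : EuclideanSpace ℝ (Fin d) → ℂ)
    (ξ : EuclideanSpace ℝ (Fin d)) : ℂ :=
  ∫ x, Complex.exp (-(Complex.I * ((inner ℝ x ξ : ℝ) : ℂ))) * f x

/-- The inequality `‖f̂ ∘ ζ‖_{L^q(J)} ≤ B ‖f‖_{L^p(ℝᵈ)}` for all `f ∈ L^p(ℝᵈ)`. Since `f̂` is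
defined pointwise only for integrable `f`, the function `f̂ ∘ ζ` for a general `f ∈ L^p` is the value
at `f` of the (by density unique) bounded linear extension of `f ↦ f̂ ∘ ζ` from `L¹ ∩ L^p`. -/
def FourierRestrictionBound {d : ℕ} (p q : ℝ≥0∞) (ζ : ℝ → EuclideanSpace ℝ (Fin d)) (J : Set ℝ)
    (B : ℝ) : Prop :=
  ∃ R : Lp ℂ p (volume : Measure (EuclideanSpace ℝ (Fin d))) →ₗ[ℂ]
      Lp ℂ q ((volume : Measure ℝ).restrict J),
    (∀ f : Lp ℂ p (volume : Measure (EuclideanSpace ℝ (Fin d))), Integrable f volume →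
      R f =ᵐ[(volume : Measure ℝ).restrict J] fun t => fourierHat f (ζ t)) ∧
    ∀ f, ‖R f‖ ≤ B * ‖f‖

/-! Write `u = 1/p'` and `D = d (d + 1) / 2`, so that `1/p = 1 - u` and `1/q = D u`, and let
`T g = (g dt)^` be the extension operator along a curve `ζ`, which is dual to `f ↦ f̂ ∘ ζ`. By
Drury's method, restricted estimates for `T` improve themselves. The power `(T g)^d` is the
Fourier transform of the push-forward of `g ⊗ ⋯ ⊗ g` under `Φ_ζ`, and one splits the ordered
tuples according to the size of `v`. Where `v` is large, the change of variables `Φ_ζ` and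
Plancherel's theorem give an `L²` bound. Where `v` is small, one freezes the differences
`κ_j = t_{j+1} - t_1` and applies the estimate already known to the curve
`s ↦ ζ(s) + ζ(s + κ_1) + ⋯ + ζ(s + κ_{d-1})`, which is again an offspring curve up to a factor.
Starting from the trivial exponent `u = 0`, the balanced sum of the two bounds gives an iteration
whose fixed point can be brought arbitrarily close to the endpoint `u = 1 / (D + 1)`. Duality and
Marcinkiewicz interpolation with `L¹ → L^∞` then give the strong type estimate, with the
dependence `δ^{-u}` on the constant `δ` of the geometric inequality. -/

section FourierExtension

variable {X V : Type*} [MeasurableSpace X] {μ : Measure X}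
  [NormedAddCommGroup V] [InnerProductSpace ℝ V]

/-- The character `v ↦ e^{-i x·v}`, in the normalisation of `fourierHat`. -/
noncomputable def planeWave (x v : V) : ℂ :=
  Complex.exp (-(Complex.I * ((inner ℝ x v : ℝ) : ℂ)))

/-- The integral `∫ e^{-i x·Φ(t)} F(t) dμ(t)`, i.e. the Fourier transform of the push-forward of
`F μ` under `Φ`. For a curve `Φ = ζ` it is the extension operator, dual to `f ↦ f̂ ∘ ζ`; for
`Φ = id` it is the Fourier transform itself. -/
noncomputable def fourierExtension (μ : Measure X) (Φ : X → V) (F : X → ℂ) (x : V) : ℂ :=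
  ∫ t, planeWave x (Φ t) * F t ∂μ

theorem norm_planeWave (x v : V) : ‖planeWave x v‖ = 1 := by
  rw [planeWave, Complex.norm_exp]
  simp

theorem planeWave_comm (x v : V) : planeWave x v = planeWave v x := by
  rw [planeWave, planeWave, real_inner_comm]

theorem planeWave_sum {ι : Type*} (s : Finset ι) (x : V) (v : ι → V) :
    planeWave x (∑ j ∈ s, v j) = ∏ j ∈ s, planeWave x (v j) := by
  simp only [planeWave, ← Complex.exp_sum, inner_sum, Complex.ofReal_sum, Finset.mul_sum,
    Finset.sum_neg_distrib]

theorem enorm_fourierExtension_le (Φ : X → V) (F : X → ℂ) (x : V) :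
    ‖fourierExtension μ Φ F x‖ₑ ≤ ∫⁻ t, ‖F t‖ₑ ∂μ := by
  refine (enorm_integral_le_lintegral_enorm _).trans_eq (lintegral_congr fun t => ?_)
  rw [enorm_mul, ← ofReal_norm (planeWave _ _), norm_planeWave, ENNReal.ofReal_one, one_mul]

variable [MeasurableSpace V] [BorelSpace V] [SecondCountableTopology V]

theorem measurable_planeWave {u v : X → V} (hu : Measurable u) (hv : Measurable v) :
    Measurable fun t => planeWave (u t) (v t) := by
  unfold planeWave
  fun_prop

theorem integrable_planeWave_mul {F : X → ℂ} (hF : Integrable F μ) {u v : X → V}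
    (hu : Measurable u) (hv : Measurable v) :
    Integrable (fun t => planeWave (u t) (v t) * F t) μ :=
  hF.bdd_mul (measurable_planeWave hu hv).aestronglyMeasurable
    (.of_forall fun t => (norm_planeWave (u t) (v t)).le)

theorem measurable_fourierExtension [SFinite μ] {Φ : X → V} (hΦ : Measurable Φ) {F : X → ℂ}
    (hF : Measurable F) : Measurable (fourierExtension μ Φ F) := by
  have h : StronglyMeasurable (Function.uncurry fun (x : V) t => planeWave x (Φ t) * F t) :=
    ((measurable_planeWave measurable_fst (hΦ.comp measurable_snd)).mul
      (hF.comp measurable_snd)).stronglyMeasurable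
  exact h.integral_prod_right.measurable

end FourierExtension

/-! ### Plancherel and change of variables -/

section Plancherel

open scoped FourierTransform SchwartzMap

variable {V : Type*} [NormedAddCommGroup V] [InnerProductSpace ℝ V] [FiniteDimensional ℝ V]
  [MeasurableSpace V] [BorelSpace V] {φ : V → ℂ}

theorem fourier_toLp_ae_eq (h1 : Integrable φ) (h2 : MemLp φ 2) :
    ⇑(𝓕 (h2.toLp φ) : Lp ℂ 2 (volume : Measure V)) =ᵐ[volume] 𝓕 φ := by
  set T : Lp ℂ 2 (volume : Measure V) := 𝓕 (h2.toLp φ)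
  have hcont : Continuous (𝓕 φ) :=
    VectorFourier.fourierIntegral_continuous Real.continuous_fourierChar continuous_inner h1
  have hloc : LocallyIntegrable T volume :=
    (Lp.memLp _).locallyIntegrable (by norm_num)
  refine ae_eq_of_integral_contDiff_smul_eq hloc hcont.locallyIntegrable fun g hg hgs => ?_
  set ψ : 𝓢(V, ℂ) := (hgs.comp_left (g := fun r : ℝ => (r : ℂ)) (by simp)).toSchwartzMap
    (Complex.ofRealCLM.contDiff.comp hg)
  have hψg (x : V) : ψ x = (g x : ℂ) := rfl
  have hdist : ∫ x, ψ x • T x = ∫ x, 𝓕 ψ x • (h2.toLp φ) x := by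
    have h := congrArg (fun T => T ψ) (Lp.fourier_toTemperedDistribution_eq (h2.toLp φ))
    simpa only [TemperedDistribution.fourier_apply, Lp.toTemperedDistribution_apply] using h.symm
  have hflip : ∫ x, 𝓕 ψ x • φ x = ∫ x, ψ x • 𝓕 φ x := by
    rw [SchwartzMap.fourier_coe]
    have h := VectorFourier.integral_fourierIntegral_smul_eq_flip (L := innerₗ V)
      (μ := volume) (ν := volume) Real.continuous_fourierChar continuous_inner ψ.integrable h1
    rwa [flip_innerₗ] at h
  calc ∫ x, g x • T x = ∫ x, ψ x • T x := by
        simp only [hψg, Complex.real_smul, smul_eq_mul]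
    _ = ∫ x, 𝓕 ψ x • φ x := by
        rw [hdist]
        refine integral_congr_ae ?_
        filter_upwards [h2.coeFn_toLp] with x hx
        rw [hx]
    _ = ∫ x, g x • 𝓕 φ x := by
        rw [hflip]
        simp only [hψg, Complex.real_smul, smul_eq_mul]

theorem lintegral_enorm_fourier_sq (h1 : Integrable φ) (h2 : MemLp φ 2) :
    ∫⁻ ξ, ‖𝓕 φ ξ‖ₑ ^ 2 = ∫⁻ x, ‖φ x‖ₑ ^ 2 := by
  have h : ‖𝓕 (h2.toLp φ)‖ₑ = ‖h2.toLp φ‖ₑ := by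
    rw [← ofReal_norm, ← ofReal_norm, Lp.norm_fourier_eq]
  rw [Lp.enorm_def, Lp.enorm_def, eLpNorm_congr_ae (fourier_toLp_ae_eq h1 h2),
    eLpNorm_congr_ae h2.coeFn_toLp, eLpNorm_eq_lintegral_rpow_enorm_toReal (by norm_num) (by simp),
    eLpNorm_eq_lintegral_rpow_enorm_toReal (by norm_num) (by simp)] at h
  simpa using ENNReal.rpow_left_injective (by norm_num) h

theorem fourierExtension_id_two_pi_smul (φ : V → ℂ) (ξ : V) :
    fourierExtension volume id φ ((2 * Real.pi) • ξ) = 𝓕 φ ξ := by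
  rw [fourierExtension, Real.fourier_eq']
  refine integral_congr_ae (.of_forall fun x => ?_)
  simp only [planeWave, smul_eq_mul, id, inner_smul_left, real_inner_comm]
  congr 2
  simp only [conj_trivial]
  push_cast
  ring

theorem lintegral_enorm_fourierExtension_id_sq (h1 : Integrable φ) (h2 : MemLp φ 2) :
    ∫⁻ x, ‖fourierExtension volume id φ x‖ₑ ^ 2 =
      ENNReal.ofReal ((2 * Real.pi) ^ Module.finrank ℝ V) * ∫⁻ x, ‖φ x‖ₑ ^ 2 := by
  have hpi : (2 * Real.pi) ≠ 0 := by positivity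
  have hmap := lintegral_map_equiv (μ := volume) (fun x => ‖fourierExtension volume id φ x‖ₑ ^ 2)
      (Homeomorph.smulOfNeZero (2 * Real.pi) hpi).toMeasurableEquiv
  have hscale := Measure.map_addHaar_smul (volume : Measure V) hpi
  rw [← lintegral_enorm_fourier_sq h1 h2]
  simp_rw [← fourierExtension_id_two_pi_smul]
  change ∫⁻ x, _ ∂(Measure.map (fun x => (2 * Real.pi) • x) volume) = _ at hmap
  refine Eq.trans ?_ (congrArg _ hmap)
  rw [hscale, lintegral_smul_measure, smul_eq_mul, ← mul_assoc,
    ← ENNReal.ofReal_mul (by positivity), abs_of_nonneg (by positivity),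
    mul_inv_cancel₀ (by positivity), ENNReal.ofReal_one, one_mul]

end Plancherel

/-- The density of the push-forward of `F` on `Ω` under the injective map `Φ`, whose derivative is
`Φ'`. -/
noncomputable def pushforwardDensity {V : Type*} [NormedAddCommGroup V] [NormedSpace ℝ V]
    (Φ : V → V) (Φ' : V → V →L[ℝ] V) (Ω : Set V) (F : V → ℂ) : V → ℂ :=
  (Φ '' Ω).indicator fun y =>
    F (Function.invFunOn Φ Ω y) / (|(Φ' (Function.invFunOn Φ Ω y)).det| : ℝ)

section PushforwardDensity

variable {V : Type*} [NormedAddCommGroup V] [NormedSpace ℝ V] {Φ : V → V} {Φ' : V → V →L[ℝ] V}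
  {Ω : Set V} {F : V → ℂ}

theorem pushforwardDensity_apply (hinj : Set.InjOn Φ Ω) {t : V} (ht : t ∈ Ω) :
    pushforwardDensity Φ Φ' Ω F (Φ t) = F t / (|(Φ' t).det| : ℝ) := by
  rw [pushforwardDensity, Set.indicator_of_mem (Set.mem_image_of_mem Φ ht),
    hinj.leftInvOn_invFunOn ht]

theorem abs_det_smul_pushforwardDensity (hinj : Set.InjOn Φ Ω) {t : V} (ht : t ∈ Ω)
    (hdet : (Φ' t).det ≠ 0) : |(Φ' t).det| • pushforwardDensity Φ Φ' Ω F (Φ t) = F t := by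
  rw [pushforwardDensity_apply hinj ht, Complex.real_smul, mul_div_cancel₀]
  simpa using hdet

variable [FiniteDimensional ℝ V] [MeasurableSpace V] [BorelSpace V] {μ : Measure V}
  [μ.IsAddHaarMeasure]

theorem integrable_pushforwardDensity (hΩ : MeasurableSet Ω)
    (hΦ : ∀ t ∈ Ω, HasFDerivWithinAt Φ (Φ' t) Ω t) (hinj : Set.InjOn Φ Ω)
    (hdet : ∀ t ∈ Ω, (Φ' t).det ≠ 0) (hF : IntegrableOn F Ω μ) :
    Integrable (pushforwardDensity Φ Φ' Ω F) μ := by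
  have himage : IntegrableOn (pushforwardDensity Φ Φ' Ω F) (Φ '' Ω) μ := by
    rw [integrableOn_image_iff_integrableOn_abs_det_fderiv_smul _ hΩ hΦ hinj]
    exact hF.congr_fun (fun t ht => (abs_det_smul_pushforwardDensity hinj ht (hdet t ht)).symm) hΩ
  exact himage.integrable_of_forall_notMem_eq_zero fun y hy => Set.indicator_of_notMem hy _

theorem lintegral_enorm_pushforwardDensity_sq (hΩ : MeasurableSet Ω)
    (hΦ : ∀ t ∈ Ω, HasFDerivWithinAt Φ (Φ' t) Ω t) (hinj : Set.InjOn Φ Ω)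
    (hdet : ∀ t ∈ Ω, (Φ' t).det ≠ 0) :
    ∫⁻ y, ‖pushforwardDensity Φ Φ' Ω F y‖ₑ ^ 2 ∂μ =
      ∫⁻ t in Ω, ENNReal.ofReal (‖F t‖ ^ 2 / |(Φ' t).det|) ∂μ := by
  have hsupp : Function.support (fun y => ‖pushforwardDensity Φ Φ' Ω F y‖ₑ ^ 2) ⊆ Φ '' Ω := by
    refine Function.support_subset_iff'.2 fun y hy => ?_
    simp [pushforwardDensity, Set.indicator_of_notMem hy]
  rw [← setLIntegral_eq_of_support_subset hsupp,
    lintegral_image_eq_lintegral_abs_det_fderiv_mul _ hΩ hΦ hinj]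
  refine setLIntegral_congr_fun hΩ fun t ht => ?_
  have hpos : 0 < |(Φ' t).det| := abs_pos.2 (hdet t ht)
  simp only [pushforwardDensity_apply hinj ht]
  rw [← ofReal_norm, ← ENNReal.ofReal_pow (norm_nonneg _), ← ENNReal.ofReal_mul hpos.le, norm_div,
    Complex.norm_real, Real.norm_eq_abs, abs_abs]
  congr 1
  field_simp

end PushforwardDensity

section ChangeOfVariables

variable {V : Type*} [NormedAddCommGroup V] [InnerProductSpace ℝ V] [FiniteDimensional ℝ V]
  [MeasurableSpace V] [BorelSpace V] {Φ : V → V} {Φ' : V → V →L[ℝ] V} {Ω : Set V} {F : V → ℂ}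

theorem fourierExtension_id_pushforwardDensity (hΩ : MeasurableSet Ω)
    (hΦ : ∀ t ∈ Ω, HasFDerivWithinAt Φ (Φ' t) Ω t) (hinj : Set.InjOn Φ Ω)
    (hdet : ∀ t ∈ Ω, (Φ' t).det ≠ 0) (x : V) :
    fourierExtension volume id (pushforwardDensity Φ Φ' Ω F) x =
      fourierExtension (volume.restrict Ω) Φ F x := by
  have hsupp (y : V) (hy : y ∉ Φ '' Ω) :
      planeWave x (id y) * pushforwardDensity Φ Φ' Ω F y = 0 := by
    rw [pushforwardDensity, Set.indicator_of_notMem hy, mul_zero]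
  rw [fourierExtension, ← setIntegral_eq_integral_of_forall_compl_eq_zero hsupp,
    integral_image_eq_integral_abs_det_fderiv_smul _ hΩ hΦ hinj]
  refine setIntegral_congr_fun hΩ fun t ht => ?_
  simp only [id, ← mul_smul_comm, abs_det_smul_pushforwardDensity hinj ht (hdet t ht)]

theorem lintegral_enorm_fourierExtension_sq_le (hΩ : MeasurableSet Ω)
    (hΦ : ∀ t ∈ Ω, HasFDerivWithinAt Φ (Φ' t) Ω t) (hinj : Set.InjOn Φ Ω)
    (hdet : ∀ t ∈ Ω, (Φ' t).det ≠ 0) (hF : IntegrableOn F Ω) :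
    ∫⁻ x, ‖fourierExtension (volume.restrict Ω) Φ F x‖ₑ ^ 2 ≤
      ENNReal.ofReal ((2 * Real.pi) ^ Module.finrank ℝ V) *
        ∫⁻ t in Ω, ENNReal.ofReal (‖F t‖ ^ 2 / |(Φ' t).det|) := by
  rcases eq_or_ne (∫⁻ t in Ω, ENNReal.ofReal (‖F t‖ ^ 2 / |(Φ' t).det|)) ∞ with htop | hfin
  · rw [htop, ENNReal.mul_top (ENNReal.ofReal_pos.2 (by positivity)).ne']
    exact le_top
  have hintegrable := integrable_pushforwardDensity (μ := volume) hΩ hΦ hinj hdet hF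
  have hsq := lintegral_enorm_pushforwardDensity_sq (μ := volume) (F := F) hΩ hΦ hinj hdet
  have hL2 : MemLp (pushforwardDensity Φ Φ' Ω F) 2 := by
    refine ⟨hintegrable.1, ?_⟩
    rw [eLpNorm_lt_top_iff_lintegral_rpow_enorm_lt_top (by norm_num) (by norm_num)]
    simpa [hsq] using hfin.lt_top
  simp_rw [← fourierExtension_id_pushforwardDensity hΩ hΦ hinj hdet]
  rw [lintegral_enorm_fourierExtension_id_sq hintegrable hL2, hsq]

end ChangeOfVariables

section CurveSum

variable {d : ℕ} {ζ : ℝ → EuclideanSpace ℝ (Fin d)} {J : Set ℝ} {Ω : Set (Fin d → ℝ)}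

theorem vandermondeProduct_pos {t : Fin d → ℝ} (ht : StrictMono t) : 0 < vandermondeProduct t :=
  Finset.prod_pos fun _ _ => Finset.prod_pos fun _ hj => sub_pos.2 (ht (Finset.mem_Ioi.1 hj))

theorem hasFDerivWithinAt_curveSum (hζ : DifferentiableOn ℝ ζ J)
    {Ω : Set (EuclideanSpace ℝ (Fin d))} (hΩ : ∀ t ∈ Ω, ∀ j, t j ∈ J)
    {t : EuclideanSpace ℝ (Fin d)} (ht : t ∈ Ω) :
    HasFDerivWithinAt (fun s : EuclideanSpace ℝ (Fin d) => curveSum ζ s)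
      (Matrix.toEuclideanCLM (𝕜 := ℝ) (Matrix.of fun i j => derivWithin ζ J (t j) i)) Ω t := by
  have hcomp (j : Fin d) : HasFDerivWithinAt (fun s : EuclideanSpace ℝ (Fin d) => ζ (s j))
      ((ContinuousLinearMap.toSpanSingleton ℝ (derivWithin ζ J (t j))).comp
        (EuclideanSpace.proj (𝕜 := ℝ) j)) Ω t :=
    HasFDerivWithinAt.comp (g := ζ) (f := fun s : EuclideanSpace ℝ (Fin d) => s j) t
      (hζ (t j) (hΩ t ht j)).hasDerivWithinAt.hasFDerivWithinAt
      (EuclideanSpace.proj (𝕜 := ℝ) j).hasFDerivWithinAt fun s hs => hΩ s hs j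
  refine (HasFDerivWithinAt.fun_sum fun j _ => hcomp j).congr_fderiv ?_
  ext x i
  simp [Matrix.mulVec, dotProduct, mul_comm]

theorem det_toEuclideanCLM_eq_curveSumJacobian (t : Fin d → ℝ) :
    (Matrix.toEuclideanCLM (𝕜 := ℝ) (Matrix.of fun i j => derivWithin ζ J (t j) i)).det =
      curveSumJacobian ζ J t :=
  LinearMap.det_toLpLin 2 _

theorem lintegral_enorm_fourierExtension_curveSum_sq_le (hζ : DifferentiableOn ℝ ζ J)
    (hΩm : MeasurableSet Ω) (hΩJ : ∀ t ∈ Ω, ∀ j, t j ∈ J) (hΩs : ∀ t ∈ Ω, StrictMono t)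
    (hinj : Set.InjOn (curveSum ζ) Ω) {δ : ℝ} (hδ : 0 < δ)
    (hjac : ∀ t ∈ Ω, δ * |vandermondeProduct t| ≤ |curveSumJacobian ζ J t|)
    {F : (Fin d → ℝ) → ℂ} (hF : IntegrableOn F Ω) (hF1 : ∀ t, ‖F t‖ ≤ 1) :
    ∫⁻ x, ‖fourierExtension (volume.restrict Ω) (curveSum ζ) F x‖ₑ ^ 2 ≤
      ENNReal.ofReal ((2 * Real.pi) ^ d / δ) *
        ∫⁻ t in Ω, ENNReal.ofReal ((vandermondeProduct t)⁻¹) := by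
  have hvol := PiLp.volume_preserving_ofLp (Fin d)
  have hemb : MeasurableEmbedding (@WithLp.ofLp 2 (Fin d → ℝ)) :=
    (MeasurableEquiv.toLp 2 (Fin d → ℝ)).symm.measurableEmbedding
  have hlower (t) (ht : t ∈ Ω) : δ * vandermondeProduct t ≤ |curveSumJacobian ζ J t| :=
    (mul_le_mul_of_nonneg_left (le_abs_self _) hδ.le).trans (hjac t ht)
  have hpos (t) (ht : t ∈ Ω) : 0 < δ * vandermondeProduct t :=
    mul_pos hδ (vandermondeProduct_pos (hΩs t ht))
  set Ω' : Set (EuclideanSpace ℝ (Fin d)) := WithLp.ofLp ⁻¹' Ω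
  have htransfer (x) : fourierExtension (volume.restrict Ω) (curveSum ζ) F x =
      fourierExtension (volume.restrict Ω') (fun t => curveSum ζ t.ofLp) (fun t => F t.ofLp) x :=
    (hvol.setIntegral_preimage_emb hemb _ Ω).symm
  simp_rw [htransfer]
  refine (lintegral_enorm_fourierExtension_sq_le (hvol.measurable hΩm)
    (fun t ht => hasFDerivWithinAt_curveSum hζ (fun s hs => hΩJ s.ofLp hs) ht)
    (hinj.comp (WithLp.ofLp_injective 2).injOn fun _ ht => ht) (fun t ht => ?_)
    (F := fun t : EuclideanSpace ℝ (Fin d) => F t.ofLp)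
    ((hvol.integrableOn_comp_preimage hemb).2 hF)).trans ?_
  · rw [det_toEuclideanCLM_eq_curveSumJacobian]
    exact abs_pos.1 ((hpos _ ht).trans_le (hlower _ ht))
  simp_rw [det_toEuclideanCLM_eq_curveSumJacobian, finrank_euclideanSpace_fin]
  rw [hvol.setLIntegral_comp_preimage_emb hemb
      (fun t => ENNReal.ofReal (‖F t‖ ^ 2 / |curveSumJacobian ζ J t|)) Ω,
    div_eq_mul_inv, ENNReal.ofReal_mul (by positivity), mul_assoc]
  refine mul_le_mul_right ?_ _
  rw [← lintegral_const_mul' _ _ ENNReal.ofReal_ne_top]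
  refine setLIntegral_mono' hΩm fun t ht => ?_
  rw [← ENNReal.ofReal_mul (by positivity), ← mul_inv, ← one_div]
  gcongr ENNReal.ofReal (?_ / ?_)
  · exact hpos t ht
  · exact pow_le_one₀ (norm_nonneg _) (hF1 t)
  · exact hlower t ht

end CurveSum

/-! ### Ordered tuples -/

section PiMeasure

variable {X : Type*} [MeasurableSpace X] (μ : Measure X) [SigmaFinite μ] {n : ℕ}

theorem lintegral_prod_eq_prod_lintegral {g : Fin n → X → ℝ≥0∞} (hg : ∀ j, Measurable (g j)) :
    ∫⁻ y, ∏ j, g j (y j) ∂Measure.pi (fun _ => μ) = ∏ j, ∫⁻ s, g j s ∂μ := by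
  induction n with
  | zero => simp
  | succ n ih =>
    rw [← (measurePreserving_piFinSuccAbove (fun _ : Fin (n + 1) => μ) 0).symm.lintegral_comp_emb
      (MeasurableEquiv.measurableEmbedding _), Fin.prod_univ_succ, ← ih fun j => hg j.succ]
    simp only [MeasurableEquiv.piFinSuccAbove_symm_apply, Fin.insertNthEquiv_apply,
      Fin.prod_univ_succ, Fin.insertNth_zero', Fin.cons_zero, Fin.cons_succ]
    rw [lintegral_prod_mul (g := fun y : Fin n → X => ∏ j : Fin n, g j.succ (y j))
        (hg 0).aemeasurable (Finset.measurable_prod _ fun j _ =>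
          (hg j.succ).comp (measurable_pi_apply j)).aemeasurable]

theorem lintegral_mul_prod_succAbove (i : Fin (n + 1)) {F : X → ℝ≥0∞} {G : X → X → ℝ≥0∞}
    (hF : Measurable F) (hG : Measurable (Function.uncurry G)) :
    ∫⁻ t, F (t i) * ∏ j, G (t i) (t (i.succAbove j)) ∂Measure.pi (fun _ => μ) =
      ∫⁻ s, F s * (∫⁻ y, G s y ∂μ) ^ n ∂μ := by
  rw [← (measurePreserving_piFinSuccAbove (fun _ : Fin (n + 1) => μ) i).symm.lintegral_comp_emb
    (MeasurableEquiv.measurableEmbedding _)]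
  simp only [MeasurableEquiv.piFinSuccAbove_symm_apply, Fin.insertNthEquiv_apply,
    Fin.insertNth_apply_same, Fin.insertNth_apply_succAbove]
  have hmeas : Measurable fun z : X × (Fin n → X) => F z.1 * ∏ j, G z.1 (z.2 j) := by
    refine (hF.comp measurable_fst).mul (Finset.measurable_prod _ fun j _ => ?_)
    exact hG.comp (measurable_fst.prodMk ((measurable_pi_apply j).comp measurable_snd))
  rw [lintegral_prod _ hmeas.aemeasurable]
  refine lintegral_congr fun s => ?_
  have hGs : Measurable (G s) := hG.comp measurable_prodMk_left
  dsimp only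
  rw [lintegral_const_mul _ (by fun_prop), lintegral_prod_eq_prod_lintegral μ fun _ => hGs,
    Finset.prod_const, Finset.card_univ, Fintype.card_fin]

end PiMeasure

section Tuples

variable {d : ℕ}

theorem measurePreserving_comp_perm (σ : Equiv.Perm (Fin d)) :
    MeasurePreserving fun t : Fin d → ℝ => t ∘ σ := by
  have heq : (fun t : Fin d → ℝ => t ∘ σ) =
      MeasurableEquiv.piCongrLeft (fun _ : Fin d => ℝ) σ.symm := by
    ext t j
    rw [MeasurableEquiv.coe_piCongrLeft, Equiv.piCongrLeft_apply, eq_rec_constant]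
    rfl
  exact heq ▸ volume_measurePreserving_piCongrLeft (fun _ : Fin d => ℝ) σ.symm

theorem measurableSet_strictMono (d : ℕ) : MeasurableSet {t : Fin d → ℝ | StrictMono t} := by
  simp only [StrictMono, Set.ofPred_forall]
  exact .iInter fun i => .iInter fun j => .iInter fun _ =>
    measurableSet_lt (measurable_pi_apply i) (measurable_pi_apply j)

theorem ae_apply_ne_apply {i j : Fin d} (hij : i ≠ j) : ∀ᵐ t : Fin d → ℝ, t i ≠ t j := by
  set L : (Fin d → ℝ) →ₗ[ℝ] ℝ := LinearMap.proj (R := ℝ) (φ := fun _ => ℝ) i -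
    LinearMap.proj (R := ℝ) (φ := fun _ => ℝ) j
  have hL : LinearMap.ker L ≠ ⊤ := by
    intro h
    have hmem : (Pi.single i 1 : Fin d → ℝ) ∈ LinearMap.ker L := h ▸ Submodule.mem_top
    simp [L, hij.symm] at hmem
  refine measure_mono_null (fun t ht => ?_) (Measure.addHaar_submodule volume _ hL)
  exact sub_eq_zero.2 (not_not.1 ht)

theorem ae_injective (d : ℕ) : ∀ᵐ t : Fin d → ℝ, Function.Injective t := by
  have hne : ∀ᵐ t : Fin d → ℝ, ∀ i j : Fin d, i ≠ j → t i ≠ t j :=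
    ae_all_iff.2 fun _ => ae_all_iff.2 fun _ => ae_all_iff.2 ae_apply_ne_apply
  filter_upwards [hne] with t ht i j
  exact not_imp_not.1 (ht i j)

theorem strictMono_comp_perm_iff {t : Fin d → ℝ} (ht : Function.Injective t)
    (σ : Equiv.Perm (Fin d)) : StrictMono (t ∘ σ) ↔ σ = Tuple.sort t := by
  have hsort : StrictMono (t ∘ Tuple.sort t) :=
    (Tuple.monotone_sort t).strictMono_of_injective (ht.comp (Tuple.sort t).injective)
  refine ⟨fun hσ => ?_, fun h => h ▸ hsort⟩
  have heq : t ∘ σ = t ∘ Tuple.sort t :=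
    Tuple.unique_monotone hσ.monotone (Tuple.monotone_sort t)
  exact Equiv.ext fun j => ht (congrFun heq j)

theorem sum_perm_indicator_strictMono {f : (Fin d → ℝ) → ℂ}
    (hsymm : ∀ (σ : Equiv.Perm (Fin d)) (t : Fin d → ℝ), f (t ∘ σ) = f t) {t : Fin d → ℝ}
    (ht : Function.Injective t) :
    ∑ σ : Equiv.Perm (Fin d), {s | StrictMono s}.indicator f (t ∘ σ) = f t := by
  rw [Finset.sum_eq_single (Tuple.sort t)]
  · rw [Set.indicator_of_mem ((strictMono_comp_perm_iff ht _).2 rfl), hsymm]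
  · exact fun σ _ hσ =>
      Set.indicator_of_notMem (fun h => hσ ((strictMono_comp_perm_iff ht σ).1 h)) _
  · simp

theorem integral_eq_factorial_mul_setIntegral_strictMono {f : (Fin d → ℝ) → ℂ}
    (hf : Integrable f) (hsymm : ∀ (σ : Equiv.Perm (Fin d)) (t : Fin d → ℝ), f (t ∘ σ) = f t) :
    ∫ t, f t = (d.factorial : ℂ) * ∫ t in {t | StrictMono t}, f t := by
  have hind : Integrable ({t : Fin d → ℝ | StrictMono t}.indicator f) :=
    hf.indicator (measurableSet_strictMono d)
  have hperm (σ : Equiv.Perm (Fin d)) :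
      ∫ t, {t : Fin d → ℝ | StrictMono t}.indicator f (t ∘ σ) = ∫ t in {t | StrictMono t}, f t := by
    have mp := measurePreserving_comp_perm σ
    rw [← integral_indicator (measurableSet_strictMono d)]
    conv_rhs => rw [← mp.map_eq]
    rw [integral_map mp.aemeasurable (by rw [mp.map_eq]; exact hind.1)]
  calc ∫ t, f t = ∫ t, ∑ σ : Equiv.Perm (Fin d), {s | StrictMono s}.indicator f (t ∘ σ) := by
        refine integral_congr_ae ?_
        filter_upwards [ae_injective d] with t ht
        exact (sum_perm_indicator_strictMono hsymm ht).symm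
    _ = (d.factorial : ℂ) * ∫ t in {t | StrictMono t}, f t := by
        rw [integral_finsetSum]
        · simp [hperm, Fintype.card_perm]
        · exact fun σ _ => (measurePreserving_comp_perm σ).integrable_comp_of_integrable hind

end Tuples

section BaseTuple

variable {n : ℕ}

/-- The tuple `(s, s + κ₁, …, s + κₙ)`. -/
def baseTuple (s : ℝ) (κ : Fin n → ℝ) : Fin (n + 1) → ℝ :=
  fun j => s + (Fin.cons 0 κ : Fin (n + 1) → ℝ) j

theorem measurePreserving_baseTuple (n : ℕ) :
    MeasurePreserving fun z : (Fin n → ℝ) × ℝ => baseTuple z.2 z.1 := by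
  have hshear : MeasurePreserving fun z : ℝ × (Fin n → ℝ) => (z.1, (fun _ => z.1) + z.2) := by
    rw [Measure.volume_eq_prod]
    exact MeasurePreserving.skew_product (g := fun s κ => (fun _ => s) + κ)
      (MeasurePreserving.id _) (by fun_prop) (.of_forall fun s => map_add_left_eq_self _ _)
  have hswap : MeasurePreserving (Prod.swap : (Fin n → ℝ) × ℝ → ℝ × (Fin n → ℝ)) :=
    Measure.measurePreserving_swap
  convert ((volume_preserving_piFinSuccAbove (fun _ : Fin (n + 1) => ℝ) 0).symm.comp hshear).comp
    hswap using 1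
  ext z j
  cases j using Fin.cases <;> simp [baseTuple, MeasurableEquiv.piFinSuccAbove, Fin.insertNthEquiv]

theorem lintegral_baseTuple {f : (Fin (n + 1) → ℝ) → ℝ≥0∞} (hf : Measurable f) :
    ∫⁻ κ : Fin n → ℝ, ∫⁻ s, f (baseTuple s κ) = ∫⁻ t, f t := by
  have mp := measurePreserving_baseTuple n
  rw [← mp.lintegral_comp hf, Measure.volume_eq_prod, lintegral_prod]
  exact (hf.comp mp.measurable).aemeasurable

theorem integral_baseTuple {f : (Fin (n + 1) → ℝ) → ℂ} (hf : Integrable f) :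
    ∫ κ : Fin n → ℝ, ∫ s, f (baseTuple s κ) = ∫ t, f t := by
  have mp := measurePreserving_baseTuple n
  conv_rhs => rw [← mp.map_eq]
  rw [integral_map mp.aemeasurable (by rw [mp.map_eq]; exact hf.1), Measure.volume_eq_prod,
    integral_prod]
  exact mp.integrable_comp_of_integrable hf

end BaseTuple

/-! ### Sublevel estimates for power kernels -/

section PowerKernels

variable {α b e : ℝ}

theorem lintegral_Ioc_rpow_neg (hα : 0 < α) (hb : b < 1) :
    ∫⁻ y in Set.Ioc 0 α, ENNReal.ofReal (y ^ (-b)) = ENNReal.ofReal (α ^ (1 - b) / (1 - b)) := by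
  have hi : IntervalIntegrable (fun y : ℝ => y ^ (-b)) volume 0 α :=
    intervalIntegral.intervalIntegrable_rpow' (by linarith)
  rw [← ofReal_integral_eq_lintegral_ofReal]
  · rw [← intervalIntegral.integral_of_le hα.le, integral_rpow (.inl (by linarith)),
      Real.zero_rpow (by linarith), sub_zero, neg_add_eq_sub]
  · exact (intervalIntegrable_iff_integrableOn_Ioc_of_le hα.le).1 hi
  · filter_upwards [ae_restrict_mem measurableSet_Ioc] with y hy
    exact Real.rpow_nonneg hy.1.le _

theorem lintegral_Ioi_rpow_neg (hα : 0 < α) (he : 1 < e) :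
    ∫⁻ y in Set.Ioi α, ENNReal.ofReal (y ^ (-e)) = ENNReal.ofReal (α ^ (1 - e) / (e - 1)) := by
  rw [← ofReal_integral_eq_lintegral_ofReal]
  · rw [integral_Ioi_rpow_of_lt (by linarith) hα, neg_add_eq_sub, ← neg_sub e 1, neg_div_neg_eq]
  · exact integrableOn_Ioi_rpow_of_lt (by linarith) hα
  · filter_upwards [ae_restrict_mem measurableSet_Ioi] with y hy
    exact Real.rpow_nonneg (hα.trans hy).le _

theorem lintegral_comp_abs_eq (f : ℝ → ℝ≥0∞) :
    ∫⁻ y, f |y| = 2 * ∫⁻ y in Set.Ioi 0, f y := by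
  have hpos : ∫⁻ y in Set.Ioi 0, f |y| = ∫⁻ y in Set.Ioi 0, f y :=
    setLIntegral_congr_fun measurableSet_Ioi fun y hy => by rw [abs_of_pos hy]
  have hneg : ∫⁻ y in Set.Iic 0, f |y| = ∫⁻ y in Set.Ioi 0, f y := by
    have h := (Measure.measurePreserving_neg (volume : Measure ℝ)).setLIntegral_comp_preimage_emb
      (MeasurableEquiv.neg ℝ).measurableEmbedding (fun y => f |y|) (Set.Ici 0)
    simp only [abs_neg, Set.neg_preimage, Set.neg_Ici, neg_zero] at h
    rw [h, ← hpos]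
    exact setLIntegral_congr Ioi_ae_eq_Ici.symm
  rw [← lintegral_add_compl _ (measurableSet_Ioi (a := (0 : ℝ))), Set.compl_Ioi, hpos, hneg,
    two_mul]

theorem lintegral_ite_abs_le (hα : 0 ≤ α) (f g : ℝ → ℝ≥0∞) :
    ∫⁻ y, (if |y| ≤ α then f |y| else g |y|) =
      2 * ((∫⁻ y in Set.Ioc 0 α, f y) + ∫⁻ y in Set.Ioi α, g y) := by
  rw [lintegral_comp_abs_eq fun y => if y ≤ α then f y else g y,
    ← Set.Ioc_union_Ioi_eq_Ioi hα, lintegral_union measurableSet_Ioi (Set.Ioc_disjoint_Ioi le_rfl)]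
  congr 2
  · exact setLIntegral_congr_fun measurableSet_Ioc fun y hy => if_pos hy.2
  · exact setLIntegral_congr_fun measurableSet_Ioi fun y hy => if_neg (not_le.2 hy)

/-- `|y|^{-b}`, truncated to the constant `α^{-b}` for `|y| > α`. Its integral over sets of measure
at most `α` is controlled. -/
noncomputable def nearKernel (b α y : ℝ) : ℝ≥0∞ :=
  ENNReal.ofReal (if |y| ≤ α then |y| ^ (-b) else α ^ (-b))

/-- `|y|^{-b}` for `|y| ≤ α`, continued with the faster decay `|y|^{-e}` for `|y| > α`, which makes
it integrable on the whole line. -/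
noncomputable def farKernel (b e α y : ℝ) : ℝ≥0∞ :=
  ENNReal.ofReal (if |y| ≤ α then |y| ^ (-b) else α ^ (e - b) * |y| ^ (-e))

theorem measurable_nearKernel (b α : ℝ) : Measurable (nearKernel b α) :=
  (Measurable.ite (measurableSet_le (by fun_prop) measurable_const) (by fun_prop)
    (by fun_prop)).ennreal_ofReal

theorem measurable_farKernel (b e α : ℝ) : Measurable (farKernel b e α) :=
  (Measurable.ite (measurableSet_le (by fun_prop) measurable_const) (by fun_prop)
    (by fun_prop)).ennreal_ofReal

theorem rpow_neg_le_rpow_mul_rpow {w y : ℝ} (hα : 0 < α) (hαy : α ≤ y) (hew : e * w ≤ b) :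
    y ^ (-b) ≤ (α ^ (-b)) ^ (1 - w) * (α ^ (e - b) * y ^ (-e)) ^ w := by
  have hy : 0 < y := hα.trans_le hαy
  have heq : (α ^ (-b)) ^ (1 - w) * (α ^ (e - b) * y ^ (-e)) ^ w =
      y ^ (-b) * (y / α) ^ (b - e * w) := by
    rw [Real.mul_rpow (by positivity) (by positivity), Real.div_rpow hy.le hα.le,
      ← Real.rpow_mul hα.le, ← Real.rpow_mul hα.le, ← Real.rpow_mul hy.le, ← mul_assoc,
      ← Real.rpow_add hα, div_eq_mul_inv, ← Real.rpow_neg hα.le, ← mul_assoc,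
      ← Real.rpow_add hy, mul_comm]
    congr 2 <;> ring
  rw [heq]
  exact le_mul_of_one_le_right (by positivity)
    (Real.one_le_rpow ((one_le_div hα).2 hαy) (by linarith))

theorem rpow_neg_le_nearKernel_mul_farKernel {w : ℝ} (hα : 0 < α) (hw0 : 0 ≤ w) (hw1 : w ≤ 1)
    (hew : e * w ≤ b) (y : ℝ) :
    ENNReal.ofReal (|y| ^ (-b)) ≤ nearKernel b α y ^ (1 - w) * farKernel b e α y ^ w := by
  unfold nearKernel farKernel
  split_ifs with h
  · rw [← ENNReal.rpow_add_of_nonneg _ _ (by linarith) hw0, sub_add_cancel, ENNReal.rpow_one]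
  · rw [ENNReal.ofReal_rpow_of_nonneg (by positivity) (by linarith),
      ENNReal.ofReal_rpow_of_nonneg (by positivity) hw0, ← ENNReal.ofReal_mul (by positivity)]
    exact ENNReal.ofReal_le_ofReal (rpow_neg_le_rpow_mul_rpow hα (not_le.1 h).le hew)

theorem lintegral_farKernel (hα : 0 < α) (hb : b < 1) (he : 1 < e) :
    ∫⁻ y, farKernel b e α y = ENNReal.ofReal ((2 / (1 - b) + 2 / (e - 1)) * α ^ (1 - b)) := by
  have := sub_pos.2 hb
  have := sub_pos.2 he
  have htail : ∫⁻ y in Set.Ioi α, ENNReal.ofReal (α ^ (e - b) * y ^ (-e)) =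
      ENNReal.ofReal (α ^ (1 - b) / (e - 1)) := by
    simp_rw [ENNReal.ofReal_mul (Real.rpow_nonneg hα.le (e - b))]
    rw [lintegral_const_mul _ (by fun_prop), lintegral_Ioi_rpow_neg hα he,
      ← ENNReal.ofReal_mul (by positivity), ← mul_div_assoc, ← Real.rpow_add hα]
    congr 3
    ring
  simp_rw [farKernel, apply_ite ENNReal.ofReal]
  rw [lintegral_ite_abs_le hα.le (fun y => ENNReal.ofReal (y ^ (-b)))
    (fun y => ENNReal.ofReal (α ^ (e - b) * y ^ (-e))), lintegral_Ioc_rpow_neg hα hb, htail,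
    ← ENNReal.ofReal_add (by positivity) (by positivity), ← ENNReal.ofReal_ofNat,
    ← ENNReal.ofReal_mul (by norm_num)]
  congr 1
  ring

theorem lintegral_ite_abs_le_rpow_neg (hα : 0 < α) (hb : b < 1) :
    ∫⁻ y, (if |y| ≤ α then ENNReal.ofReal (|y| ^ (-b)) else 0) =
      ENNReal.ofReal (2 / (1 - b) * α ^ (1 - b)) := by
  rw [lintegral_ite_abs_le hα.le (fun y => ENNReal.ofReal (y ^ (-b))) (fun _ => 0),
    lintegral_zero, add_zero, lintegral_Ioc_rpow_neg hα hb, ← ENNReal.ofReal_ofNat,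
    ← ENNReal.ofReal_mul (by norm_num)]
  congr 1
  ring

theorem setLIntegral_nearKernel_sub_le (hα : 0 < α) (hb : b < 1) {E : Set ℝ}
    (hEα : volume E ≤ ENNReal.ofReal α) (s : ℝ) :
    ∫⁻ y in E, nearKernel b α (y - s) ≤ ENNReal.ofReal ((2 / (1 - b) + 1) * α ^ (1 - b)) := by
  have := sub_pos.2 hb
  set k : ℝ → ℝ≥0∞ := fun y => if |y| ≤ α then ENNReal.ofReal (|y| ^ (-b)) else 0
  have hnear (y) : nearKernel b α y ≤ k y + ENNReal.ofReal (α ^ (-b)) := by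
    simp only [nearKernel, k]
    split_ifs
    · exact le_self_add
    · rw [zero_add]
  calc ∫⁻ y in E, nearKernel b α (y - s)
      ≤ ∫⁻ y in E, (k (y - s) + ENNReal.ofReal (α ^ (-b))) := lintegral_mono fun y => hnear _
    _ = (∫⁻ y in E, k (y - s)) + ENNReal.ofReal (α ^ (-b)) * volume E := by
        rw [lintegral_add_right _ measurable_const, setLIntegral_const]
    _ ≤ (∫⁻ y, k (y - s)) + ENNReal.ofReal (α ^ (-b)) * ENNReal.ofReal α :=
        add_le_add (setLIntegral_le_lintegral _ _) (by gcongr)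
    _ = (∫⁻ y, k y) + ENNReal.ofReal (α ^ (1 - b)) := by
        rw [lintegral_sub_right_eq_self k, ← ENNReal.ofReal_mul (by positivity),
          ← Real.rpow_add_one hα.ne', neg_add_eq_sub]
    _ = ENNReal.ofReal ((2 / (1 - b) + 1) * α ^ (1 - b)) := by
        rw [lintegral_ite_abs_le_rpow_neg hα hb,
          ← ENNReal.ofReal_add (by positivity) (by positivity), add_one_mul]

end PowerKernels

section StarSum

variable {n : ℕ}

theorem prod_prod_succAbove_abs_sub (t : Fin (n + 1) → ℝ) :
    ∏ i, ∏ j : Fin n, |t (i.succAbove j) - t i| = |vandermondeProduct t| ^ 2 := by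
  have hupper : ∏ i, ∏ j, (if i < j then |t j - t i| else 1) = |vandermondeProduct t| := by
    simp only [vandermondeProduct, Finset.abs_prod, ← Finset.prod_filter,
      Finset.filter_lt_eq_Ioi]
  have hlower : ∏ i, ∏ j, (if j < i then |t j - t i| else 1) = |vandermondeProduct t| := by
    rw [Finset.prod_comm, ← hupper]
    simp_rw [abs_sub_comm]
  rw [sq]
  nth_rw 1 [← hupper]
  rw [← hlower, ← Finset.prod_mul_distrib]
  refine Finset.prod_congr rfl fun i _ => ?_
  rw [← Finset.prod_mul_distrib, Fin.prod_univ_succAbove _ i]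
  simp only [lt_irrefl, if_false, one_mul]
  refine Finset.prod_congr rfl fun j _ => ?_
  rcases lt_or_gt_of_ne (Fin.succAbove_ne i j) with h | h <;> simp [h, h.not_gt]

theorem prod_rpow_inv_card_le_sum {ι : Type*} [Fintype ι] [Nonempty ι] {a : ι → ℝ}
    (ha : ∀ i, 0 ≤ a i) : (∏ i, a i) ^ ((Fintype.card ι : ℝ)⁻¹) ≤ ∑ i, a i := by
  have hsum : 0 ≤ ∑ i, a i := Finset.sum_nonneg fun i _ => ha i
  calc (∏ i, a i) ^ ((Fintype.card ι : ℝ)⁻¹)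
      ≤ (∏ _i : ι, ∑ i, a i) ^ ((Fintype.card ι : ℝ)⁻¹) := by
        refine Real.rpow_le_rpow (Finset.prod_nonneg fun i _ => ha i) ?_ (by positivity)
        exact Finset.prod_le_prod (fun i _ => ha i)
          fun i _ => Finset.single_le_sum (fun i _ => ha i) (Finset.mem_univ i)
    _ = ∑ i, a i := by
        rw [Finset.prod_const, Finset.card_univ,
          Real.pow_rpow_inv_natCast hsum Fintype.card_ne_zero]

/-- The sum over `i` of the products of `|t_j - t_i|^{-b}` over `j ≠ i`. Unlike a power of the
Vandermonde product, each summand couples the variables only through `t_i`. -/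
noncomputable def starSum (b : ℝ) (t : Fin (n + 1) → ℝ) : ℝ≥0∞ :=
  ∑ i, ∏ j : Fin n, ENNReal.ofReal (|t (i.succAbove j) - t i| ^ (-b))

theorem measurable_starSum (b : ℝ) : Measurable (starSum b : (Fin (n + 1) → ℝ) → ℝ≥0∞) := by
  unfold starSum
  fun_prop

theorem vandermondeProduct_rpow_neg_le_starSum {b : ℝ} {t : Fin (n + 1) → ℝ} (ht : StrictMono t) :
    ENNReal.ofReal (vandermondeProduct t ^ (-(2 * b / (n + 1)))) ≤ starSum b t := by
  set a : Fin (n + 1) → ℝ := fun i => ∏ j : Fin n, |t (i.succAbove j) - t i| ^ (-b) with ha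
  have ha0 (i) : 0 ≤ a i := by positivity
  have hv := vandermondeProduct_pos ht
  have hstar : starSum b t = ENNReal.ofReal (∑ i, a i) := by
    rw [ENNReal.ofReal_sum_of_nonneg fun i _ => ha0 i, starSum]
    exact Finset.sum_congr rfl fun i _ =>
      (ENNReal.ofReal_prod_of_nonneg fun j _ => by positivity).symm
  have hprod : ∏ i, a i = vandermondeProduct t ^ (-(2 * b)) := by
    simp_rw [ha, Real.finsetProd_rpow _ _ fun _ _ => abs_nonneg _]
    rw [Real.finsetProd_rpow _ _ fun i _ => by positivity, prod_prod_succAbove_abs_sub,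
      abs_of_pos hv, ← Real.rpow_natCast, ← Real.rpow_mul hv.le]
    congr 1
    push_cast
    ring
  rw [hstar]
  refine ENNReal.ofReal_le_ofReal ((le_of_eq ?_).trans (prod_rpow_inv_card_le_sum ha0))
  rw [hprod, ← Real.rpow_mul hv.le, Fintype.card_fin]
  congr 1
  push_cast
  field_simp

end StarSum

section BaseSet

variable {n : ℕ} {E : Set ℝ}

/-- The set of base points `s` for which all the points `s, s + κ₁, …, s + κₙ` lie in `E`. -/
def baseSet (E : Set ℝ) (κ : Fin n → ℝ) : Set ℝ := {s | ∀ j, baseTuple s κ j ∈ E}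

theorem mem_baseSet_iff {κ : Fin n → ℝ} {s : ℝ} :
    s ∈ baseSet E κ ↔ baseTuple s κ ∈ Set.univ.pi fun _ : Fin (n + 1) => E := by
  simp [baseSet]

theorem measurableSet_baseSet (hE : MeasurableSet E) (κ : Fin n → ℝ) :
    MeasurableSet (baseSet E κ) := by
  simp only [baseSet, baseTuple, Set.ofPred_forall]
  exact .iInter fun j => hE.preimage (measurable_id.add_const _)

theorem measurable_volume_baseSet (hE : MeasurableSet E) :
    Measurable fun κ : Fin n → ℝ => volume (baseSet E κ) := by
  have hpi : MeasurableSet (Set.univ.pi fun _ : Fin (n + 1) => E) := .univ_pi fun _ => hE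
  have hκ (κ : Fin n → ℝ) : baseSet E κ = Prod.mk κ ⁻¹'
      ((fun z : (Fin n → ℝ) × ℝ => baseTuple z.2 z.1) ⁻¹' Set.univ.pi fun _ => E) :=
    Set.ext fun _ => mem_baseSet_iff
  simp_rw [hκ]
  exact measurable_measure_prodMk_left ((measurePreserving_baseTuple n).measurable hpi)

theorem lintegral_volume_baseSet_mul (hE : MeasurableSet E) {f : (Fin (n + 1) → ℝ) → ℝ≥0∞}
    (hf : Measurable f) (hinv : ∀ s κ, f (baseTuple s κ) = f (baseTuple 0 κ)) :
    ∫⁻ κ : Fin n → ℝ, volume (baseSet E κ) * f (baseTuple 0 κ) =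
      ∫⁻ t in Set.univ.pi fun _ => E, f t := by
  have hpi : MeasurableSet (Set.univ.pi fun _ : Fin (n + 1) => E) := .univ_pi fun _ => hE
  rw [← lintegral_indicator hpi, ← lintegral_baseTuple (hf.indicator hpi)]
  refine lintegral_congr fun κ => ?_
  have hind : ∀ s, (Set.univ.pi fun _ => E).indicator f (baseTuple s κ) =
      (baseSet E κ).indicator (fun _ => f (baseTuple 0 κ)) s := by
    intro s
    by_cases h : s ∈ baseSet E κ
    · rw [Set.indicator_of_mem h, Set.indicator_of_mem (mem_baseSet_iff.1 h), hinv]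
    · rw [Set.indicator_of_notMem h, Set.indicator_of_notMem (mt mem_baseSet_iff.2 h)]
  simp_rw [hind]
  rw [lintegral_indicator (measurableSet_baseSet hE κ), setLIntegral_const, mul_comm]

end BaseSet

section StarIntegrals

variable {n : ℕ} {k : ℝ → ℝ≥0∞} {E : Set ℝ}

theorem setLIntegral_prod_succAbove_le (hk : Measurable k) {C : ℝ≥0∞}
    (hC : ∀ s, ∫⁻ y in E, k (y - s) ≤ C) (i : Fin (n + 1)) :
    ∫⁻ t in Set.univ.pi fun _ => E, ∏ j : Fin n, k (t (i.succAbove j) - t i) ≤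
      volume E * C ^ n := by
  have hstar := lintegral_mul_prod_succAbove (volume.restrict E) i (F := fun _ => 1)
    (G := fun s y => k (y - s)) measurable_const (by fun_prop)
  simp only [one_mul] at hstar
  rw [volume_pi, Measure.restrict_pi_pi, hstar]
  calc ∫⁻ s in E, (∫⁻ y in E, k (y - s)) ^ n ≤ ∫⁻ _ in E, C ^ n :=
        lintegral_mono fun s => pow_le_pow_left' (hC s) n
    _ = volume E * C ^ n := by rw [setLIntegral_const, mul_comm]

/-- A translation invariant function of tuples may be integrated over the offsets by fixing
any one of the points instead of the first: average its position over the unit interval. -/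
theorem lintegral_comp_baseTuple_zero {f : (Fin (n + 1) → ℝ) → ℝ≥0∞} (hf : Measurable f)
    (hinv : ∀ s κ, f (baseTuple s κ) = f (baseTuple 0 κ)) (i : Fin (n + 1)) :
    ∫⁻ κ : Fin n → ℝ, f (baseTuple 0 κ) = ∫⁻ t, (Set.Icc 0 1).indicator 1 (t i) * f t := by
  have hind : Measurable ((Set.Icc (0 : ℝ) 1).indicator (1 : ℝ → ℝ≥0∞)) :=
    measurable_one.indicator measurableSet_Icc
  rw [← lintegral_baseTuple (by fun_prop)]
  refine lintegral_congr fun κ => ?_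
  simp_rw [hinv _ κ, baseTuple]
  rw [lintegral_mul_const _ (by fun_prop), lintegral_add_right_eq_self,
    lintegral_indicator_one measurableSet_Icc]
  simp

theorem lintegral_prod_succAbove_baseTuple_zero (hk : Measurable k) (i : Fin (n + 1)) :
    ∫⁻ κ : Fin n → ℝ, ∏ j : Fin n, k (baseTuple 0 κ (i.succAbove j) - baseTuple 0 κ i) =
      (∫⁻ y, k y) ^ n := by
  have hind : Measurable ((Set.Icc (0 : ℝ) 1).indicator (1 : ℝ → ℝ≥0∞)) :=
    measurable_one.indicator measurableSet_Icc
  rw [lintegral_comp_baseTuple_zero (f := fun t => ∏ j : Fin n, k (t (i.succAbove j) - t i))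
    (by fun_prop) (fun s κ => by simp [baseTuple]) i, volume_pi,
    lintegral_mul_prod_succAbove volume i (G := fun s y => k (y - s)) hind (by fun_prop)]
  simp_rw [lintegral_sub_right_eq_self k]
  rw [lintegral_mul_const _ hind, lintegral_indicator_one measurableSet_Icc]
  simp

end StarIntegrals

section StarSum

variable {n : ℕ} {b e w α : ℝ} {E : Set ℝ}

theorem setLIntegral_prod_nearKernel_le (hα : 0 < α) (hb : b < 1)
    (hEα : volume E = ENNReal.ofReal α) (i : Fin (n + 1)) :
    ∫⁻ t in Set.univ.pi fun _ => E, ∏ j : Fin n, nearKernel b α (t (i.succAbove j) - t i) ≤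
      ENNReal.ofReal (α * ((2 / (1 - b) + 1) * α ^ (1 - b)) ^ n) := by
  have := sub_pos.2 hb
  rw [ENNReal.ofReal_mul hα.le, ENNReal.ofReal_pow (by positivity), ← hEα]
  exact setLIntegral_prod_succAbove_le (measurable_nearKernel b α)
    (setLIntegral_nearKernel_sub_le hα hb hEα.le) i

theorem setLIntegral_starSum_le (hα : 0 < α) (hb0 : 0 ≤ b) (hb1 : b < 1)
    (hEα : volume E = ENNReal.ofReal α) :
    ∫⁻ t in Set.univ.pi fun _ : Fin (n + 1) => E, starSum b t ≤
      ENNReal.ofReal ((n + 1) * (2 / (1 - b) + 1) ^ n * α ^ (1 + n * (1 - b))) := by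
  have := sub_pos.2 hb1
  have := measurable_nearKernel b α
  calc ∫⁻ t in Set.univ.pi fun _ => E, starSum b t
      ≤ ∫⁻ t in Set.univ.pi fun _ : Fin (n + 1) => E,
          ∑ i, ∏ j : Fin n, nearKernel b α (t (i.succAbove j) - t i) := by
        refine lintegral_mono fun t => Finset.sum_le_sum fun i _ =>
          Finset.prod_le_prod' fun j _ => ?_
        simpa using rpow_neg_le_nearKernel_mul_farKernel (e := 0) (w := 0) hα le_rfl zero_le_one
          (by simpa using hb0) (t (i.succAbove j) - t i)
    _ = ∑ i, ∫⁻ t in Set.univ.pi fun _ : Fin (n + 1) => E,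
          ∏ j : Fin n, nearKernel b α (t (i.succAbove j) - t i) :=
        lintegral_finsetSum _ fun i _ => by fun_prop
    _ ≤ ∑ _i : Fin (n + 1), ENNReal.ofReal (α * ((2 / (1 - b) + 1) * α ^ (1 - b)) ^ n) :=
        Finset.sum_le_sum fun i _ => setLIntegral_prod_nearKernel_le hα hb1 hEα i
    _ = ENNReal.ofReal ((n + 1) * (2 / (1 - b) + 1) ^ n * α ^ (1 + n * (1 - b))) := by
        rw [Finset.sum_const, Finset.card_univ, Fintype.card_fin, ← ENNReal.ofReal_nsmul,
          nsmul_eq_mul, Real.rpow_add hα, Real.rpow_one, mul_comm (n : ℝ) (1 - b),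
          Real.rpow_mul_natCast hα.le, mul_pow]
        push_cast
        ring_nf

theorem lintegral_volume_baseSet_mul_prod_nearKernel_le (hα : 0 < α) (hb : b < 1)
    (hE : MeasurableSet E) (hEα : volume E = ENNReal.ofReal α) (i : Fin (n + 1)) :
    ∫⁻ κ : Fin n → ℝ, volume (baseSet E κ) *
        ∏ j : Fin n, nearKernel b α (baseTuple 0 κ (i.succAbove j) - baseTuple 0 κ i) ≤
      ENNReal.ofReal (α * ((2 / (1 - b) + 1) * α ^ (1 - b)) ^ n) := by
  have := measurable_nearKernel b α
  rw [lintegral_volume_baseSet_mul hE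
    (f := fun t => ∏ j : Fin n, nearKernel b α (t (i.succAbove j) - t i)) (by fun_prop)
    (fun s κ => by simp [baseTuple])]
  exact setLIntegral_prod_nearKernel_le hα hb hEα i

theorem lintegral_volume_baseSet_rpow_mul_prod_le (hα : 0 < α) (hb : b < 1) (he : 1 < e)
    (hw0 : 0 ≤ w) (hw1 : w ≤ 1) (hew : e * w ≤ b) (hE : MeasurableSet E)
    (hEα : volume E = ENNReal.ofReal α) (i : Fin (n + 1)) :
    ∫⁻ κ : Fin n → ℝ, volume (baseSet E κ) ^ (1 - w) * ∏ j : Fin n,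
        ENNReal.ofReal (|baseTuple 0 κ (i.succAbove j) - baseTuple 0 κ i| ^ (-b)) ≤
      ENNReal.ofReal (α * ((2 / (1 - b) + 1) * α ^ (1 - b)) ^ n) ^ (1 - w) *
        (ENNReal.ofReal ((2 / (1 - b) + 2 / (e - 1)) * α ^ (1 - b)) ^ n) ^ w := by
  have hw1' : 0 ≤ 1 - w := sub_nonneg.2 hw1
  have := measurable_nearKernel b α
  have := measurable_farKernel b e α
  have := measurable_volume_baseSet (n := n) hE
  have hbase (j) : Measurable fun κ : Fin n → ℝ => baseTuple 0 κ j :=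
    (measurable_pi_apply j).comp
      ((measurePreserving_baseTuple n).measurable.comp measurable_prodMk_right)
  set Ψ : (ℝ → ℝ≥0∞) → (Fin n → ℝ) → ℝ≥0∞ := fun k κ =>
    ∏ j : Fin n, k (baseTuple 0 κ (i.succAbove j) - baseTuple 0 κ i)
  have hpt (κ : Fin n → ℝ) : volume (baseSet E κ) ^ (1 - w) *
      Ψ (fun y => ENNReal.ofReal (|y| ^ (-b))) κ ≤
        (volume (baseSet E κ) * Ψ (nearKernel b α) κ) ^ (1 - w) * Ψ (farKernel b e α) κ ^ w := by
    rw [ENNReal.mul_rpow_of_nonneg _ _ hw1', mul_assoc, ← ENNReal.prod_rpow_of_nonneg hw1',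
      ← ENNReal.prod_rpow_of_nonneg hw0, ← Finset.prod_mul_distrib]
    refine mul_le_mul_right (Finset.prod_le_prod' fun j _ => ?_) _
    exact rpow_neg_le_nearKernel_mul_farKernel hα hw0 hw1 hew _
  refine (lintegral_mono hpt).trans ((ENNReal.lintegral_mul_norm_pow_le
    (by fun_prop) (by fun_prop) hw1' hw0 (sub_add_cancel 1 w)).trans ?_)
  gcongr
  · exact lintegral_volume_baseSet_mul_prod_nearKernel_le hα hb hE hEα i
  · rw [lintegral_prod_succAbove_baseTuple_zero (by fun_prop), lintegral_farKernel hα hb he]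

theorem lintegral_volume_baseSet_rpow_mul_starSum_le (hα : 0 < α)
    (hb1 : b < 1) (he : 1 < e) (hw0 : 0 ≤ w) (hw1 : w ≤ 1) (hew : e * w ≤ b)
    (hE : MeasurableSet E) (hEα : volume E = ENNReal.ofReal α) :
    ∫⁻ κ : Fin n → ℝ, volume (baseSet E κ) ^ (1 - w) * starSum b (baseTuple 0 κ) ≤
      ENNReal.ofReal ((n + 1) * (((2 / (1 - b) + 1) ^ n) ^ (1 - w) *
        ((2 / (1 - b) + 2 / (e - 1)) ^ n) ^ w) * α ^ (1 - w + n * (1 - b))) := by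
  have := sub_pos.2 hb1
  have := sub_pos.2 he
  have hw1' : 0 ≤ 1 - w := sub_nonneg.2 hw1
  have hbase (j) : Measurable fun κ : Fin n → ℝ => baseTuple 0 κ j :=
    (measurable_pi_apply j).comp
      ((measurePreserving_baseTuple n).measurable.comp measurable_prodMk_right)
  have := measurable_volume_baseSet (n := n) hE
  have hpow : α ^ (1 - w + n * (1 - b)) =
      α ^ (1 - w) * (((α ^ (1 - b)) ^ n) ^ (1 - w) * ((α ^ (1 - b)) ^ n) ^ w) := by
    rw [← Real.rpow_add (by positivity), sub_add_cancel, Real.rpow_one, Real.rpow_add hα,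
      mul_comm (n : ℝ) (1 - b), Real.rpow_mul_natCast hα.le]
  simp_rw [starSum, Finset.mul_sum]
  rw [lintegral_finsetSum _ fun i _ => by fun_prop]
  refine (Finset.sum_le_sum fun i _ => lintegral_volume_baseSet_rpow_mul_prod_le hα hb1 he hw0 hw1
    hew hE hEα i).trans_eq ?_
  rw [Finset.sum_const, Finset.card_univ, Fintype.card_fin, ← ENNReal.ofReal_pow (by positivity),
    ENNReal.ofReal_rpow_of_nonneg (by positivity) hw1',
    ENNReal.ofReal_rpow_of_nonneg (by positivity) hw0, ← ENNReal.ofReal_mul (by positivity),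
    ← ENNReal.ofReal_nsmul, nsmul_eq_mul, hpow, mul_pow, mul_pow,
    Real.mul_rpow hα.le (by positivity), Real.mul_rpow (by positivity) (by positivity),
    Real.mul_rpow (by positivity) (by positivity)]
  push_cast
  ring_nf

end StarSum

section CurveSum

variable {d : ℕ} {ζ : ℝ → EuclideanSpace ℝ (Fin d)}

theorem measurable_curveSum (hζ : Measurable ζ) : Measurable (curveSum ζ) := by
  unfold curveSum
  fun_prop

theorem planeWave_curveSum_mul_prod (ζ : ℝ → EuclideanSpace ℝ (Fin d)) (g : ℝ → ℂ)
    (x : EuclideanSpace ℝ (Fin d)) (t : Fin d → ℝ) :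
    planeWave x (curveSum ζ t) * ∏ j, g (t j) = ∏ j, planeWave x (ζ (t j)) * g (t j) := by
  rw [curveSum, planeWave_sum, Finset.prod_mul_distrib]

theorem fourierExtension_pow_eq (hζ : Measurable ζ) {g : ℝ → ℂ} (hg : Integrable g)
    (x : EuclideanSpace ℝ (Fin d)) :
    fourierExtension volume ζ g x ^ d = (d.factorial : ℂ) *
      fourierExtension (volume.restrict {t | StrictMono t}) (curveSum ζ)
        (fun t => ∏ j, g (t j)) x := by
  have hintegrable : Integrable fun t : Fin d → ℝ => planeWave x (curveSum ζ t) * ∏ j, g (t j) :=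
    integrable_planeWave_mul (Integrable.fintype_prod fun _ => hg) measurable_const
      (measurable_curveSum hζ)
  simp only [planeWave_curveSum_mul_prod] at hintegrable
  simp only [fourierExtension, planeWave_curveSum_mul_prod]
  rw [← integral_eq_factorial_mul_setIntegral_strictMono hintegrable fun σ t =>
    Equiv.prod_comp σ fun j => planeWave x (ζ (t j)) * g (t j),
    integral_fintype_prod_volume_eq_pow fun t => planeWave x (ζ t) * g t, Fintype.card_fin]

end CurveSum

/-! ### Restricted estimates for the extension operator -/

section TranslateSum

variable {n : ℕ}

theorem strictMono_baseTuple_iff (s : ℝ) (κ : Fin n → ℝ) :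
    StrictMono (baseTuple s κ) ↔ StrictMono (baseTuple 0 κ) := by
  simp [StrictMono, baseTuple]

theorem vandermondeProduct_baseTuple (s : ℝ) (κ : Fin n → ℝ) :
    vandermondeProduct (baseTuple s κ) = vandermondeProduct (baseTuple 0 κ) := by
  simp [vandermondeProduct, baseTuple]

/-- The curve `s ↦ ζ(s) + ζ(s + κ₁) + ⋯ + ζ(s + κₙ)`, an offspring curve up to the factor
`n + 1`. -/
noncomputable def translateSum (ζ : ℝ → EuclideanSpace ℝ (Fin (n + 1))) (κ : Fin n → ℝ) (s : ℝ) :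
    EuclideanSpace ℝ (Fin (n + 1)) :=
  curveSum ζ (baseTuple s κ)

variable {ζ : ℝ → EuclideanSpace ℝ (Fin (n + 1))} {F : (Fin (n + 1) → ℝ) → ℂ}
  {Ω : Set (Fin (n + 1) → ℝ)}

theorem enorm_fourierExtension_curveSum_le (hζ : Measurable ζ) (hF : Integrable F)
    (hΩ : MeasurableSet Ω) (hinv : ∀ s κ, baseTuple s κ ∈ Ω ↔ baseTuple 0 κ ∈ Ω)
    (x : EuclideanSpace ℝ (Fin (n + 1))) :
    ‖fourierExtension (volume.restrict Ω) (curveSum ζ) F x‖ₑ ≤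
      ∫⁻ κ in {κ : Fin n → ℝ | baseTuple 0 κ ∈ Ω},
        ‖fourierExtension volume (translateSum ζ κ) (fun s => F (baseTuple s κ)) x‖ₑ := by
  have hΩ₀ : MeasurableSet {κ : Fin n → ℝ | baseTuple 0 κ ∈ Ω} :=
    ((measurePreserving_baseTuple n).measurable.comp measurable_prodMk_right) hΩ
  have hintegrable :=
    integrable_planeWave_mul hF (measurable_const (a := x)) (measurable_curveSum hζ)
  rw [fourierExtension, ← integral_indicator hΩ, ← integral_baseTuple (hintegrable.indicator hΩ),
    ← lintegral_indicator hΩ₀]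
  refine (enorm_integral_le_lintegral_enorm _).trans (lintegral_mono fun κ => ?_)
  by_cases hκ : baseTuple 0 κ ∈ Ω
  · rw [Set.indicator_of_mem (by exact hκ)]
    simp only [Set.indicator_of_mem ((hinv _ κ).2 hκ), fourierExtension, translateSum, le_refl]
  · simp only [Set.indicator_of_notMem (mt (hinv _ κ).1 hκ), integral_zero, enorm_zero, zero_le]

theorem setLIntegral_enorm_fourierExtension_curveSum_le (hζ : Measurable ζ) (hFm : Measurable F)
    (hF : Integrable F) (hΩ : MeasurableSet Ω)
    (hinv : ∀ s κ, baseTuple s κ ∈ Ω ↔ baseTuple 0 κ ∈ Ω)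
    (A : Set (EuclideanSpace ℝ (Fin (n + 1)))) :
    ∫⁻ x in A, ‖fourierExtension (volume.restrict Ω) (curveSum ζ) F x‖ₑ ≤
      ∫⁻ κ in {κ : Fin n → ℝ | baseTuple 0 κ ∈ Ω}, ∫⁻ x in A,
        ‖fourierExtension volume (translateSum ζ κ) (fun s => F (baseTuple s κ)) x‖ₑ := by
  have hbase : Measurable fun z : (EuclideanSpace ℝ (Fin (n + 1)) × (Fin n → ℝ)) × ℝ =>
      baseTuple z.2 z.1.2 :=
    (measurePreserving_baseTuple n).measurable.comp (by fun_prop : Measurable fun z :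
      (EuclideanSpace ℝ (Fin (n + 1)) × (Fin n → ℝ)) × ℝ => (z.1.2, z.2))
  have hmeas : Measurable fun z : (EuclideanSpace ℝ (Fin (n + 1)) × (Fin n → ℝ)) × ℝ =>
      planeWave z.1.1 (curveSum ζ (baseTuple z.2 z.1.2)) * F (baseTuple z.2 z.1.2) :=
    (measurable_planeWave (by fun_prop) ((measurable_curveSum hζ).comp hbase)).mul
      (hFm.comp hbase)
  refine (lintegral_mono (enorm_fourierExtension_curveSum_le hζ hF hΩ hinv)).trans_eq
    (lintegral_lintegral_swap ?_)
  exact hmeas.stronglyMeasurable.integral_prod_right'.measurable.enorm.aemeasurable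

end TranslateSum

section RestrictedBound

/-- The homogeneous dimension `1 + 2 + ⋯ + d = d (d + 1) / 2` of the moment curve in dimension
`d = n + 1`. -/
noncomputable def homogeneousDim (n : ℕ) : ℝ := (n + 1) * (n + 2) / 2

theorem one_le_homogeneousDim (n : ℕ) : 1 ≤ homogeneousDim n := by
  rw [homogeneousDim, le_div_iff₀ two_pos]
  nlinarith [(Nat.cast_nonneg n : (0 : ℝ) ≤ n)]

theorem le_one_of_homogeneousDim_mul_le_one {n : ℕ} {u : ℝ} (hu : homogeneousDim n * u ≤ 1) :
    u ≤ 1 := by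
  by_contra! h
  nlinarith [one_le_homogeneousDim n]

/-- A class of curves `ζ` in `ℝ^{n+1}`, each considered on a specified set of parameters. -/
abbrev CurveFamily (n : ℕ) : Type := (ℝ → EuclideanSpace ℝ (Fin (n + 1))) → Set ℝ → Prop

/-- A family of curves, closed under the formation of sums of translates, all of whose members
satisfy the injectivity hypothesis and the geometric inequality with constant `δ`. -/
structure IsAdmissibleFamily {n : ℕ} (δ : ℝ) (P : CurveFamily n) : Prop where
  measurable : ∀ {ζ J}, P ζ J → Measurable ζ
  measurableSet : ∀ {ζ J}, P ζ J → MeasurableSet J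
  volume_ne_top : ∀ {ζ J}, P ζ J → volume J ≠ ∞
  differentiableOn : ∀ {ζ J}, P ζ J → DifferentiableOn ℝ ζ J
  injOn : ∀ {ζ J}, P ζ J → Set.InjOn (curveSum ζ) {t | StrictMono t ∧ ∀ j, t j ∈ J}
  jacobian : ∀ {ζ J}, P ζ J → J.Nontrivial → ∀ t : Fin (n + 1) → ℝ, (∀ j, t j ∈ J) →
    δ * |vandermondeProduct t| ≤ |curveSumJacobian ζ J t|
  translateSum : ∀ {ζ J}, P ζ J → ∀ κ : Fin n → ℝ, StrictMono (baseTuple 0 κ) →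
    P (translateSum ζ κ) (baseSet J κ)

/-- The restricted weak type bound `∫_A |(g dt)^| ≤ K N^u |E|^{1 - Du} |A|^{1 - u}` for `|g| ≤ 1_E`,
where `D` is the homogeneous dimension, uniformly over the family `P`. By duality it bounds the
restriction operator from `L^{p,1}` to `L^{q,∞}`, where `1 - 1/p = u` and `1/q = Du`. -/
def RestrictedBound {n : ℕ} (P : CurveFamily n) (N u K : ℝ) : Prop :=
  ∀ ⦃ζ J⦄, P ζ J → ∀ ⦃E : Set ℝ⦄, E ⊆ J → MeasurableSet E → ∀ ⦃g : ℝ → ℂ⦄, Measurable g →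
    (∀ t, ‖g t‖ ≤ E.indicator 1 t) → ∀ ⦃A : Set (EuclideanSpace ℝ (Fin (n + 1)))⦄,
    MeasurableSet A →
    ∫⁻ x in A, ‖fourierExtension volume ζ g x‖ₑ ≤
      ENNReal.ofReal (K * N ^ u) * volume E ^ (1 - homogeneousDim n * u) * volume A ^ (1 - u)

/-- The restricted bound for every admissible family with geometric constant `δ`, the dependence on
`δ` being `δ^{-u}`. -/
def UniformRestrictedBound (n : ℕ) (u : ℝ) : Prop :=
  ∃ K : ℝ, 0 < K ∧ ∀ δ : ℝ, 0 < δ → ∀ P : CurveFamily n, IsAdmissibleFamily δ P →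
    RestrictedBound P ((2 * Real.pi) ^ (n + 1) / δ) u K

theorem integrable_of_norm_le_indicator {X : Type*} [MeasurableSpace X] {μ : Measure X} {E : Set X}
    (hE : MeasurableSet E) (hfin : μ E ≠ ∞) {g : X → ℂ} (hg : Measurable g)
    (hgE : ∀ t, ‖g t‖ ≤ E.indicator 1 t) : Integrable g μ :=
  ((integrable_indicator_iff hE).2 (integrableOn_const hfin)).mono' hg.aestronglyMeasurable
    (.of_forall hgE)

theorem enorm_fourierExtension_le_measure {X V : Type*} [MeasurableSpace X] {μ : Measure X}
    [NormedAddCommGroup V] [InnerProductSpace ℝ V] (Φ : X → V) {E : Set X} (hE : MeasurableSet E)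
    {g : X → ℂ} (hgE : ∀ t, ‖g t‖ ≤ E.indicator 1 t) (x : V) :
    ‖fourierExtension μ Φ g x‖ₑ ≤ μ E := by
  refine (enorm_fourierExtension_le Φ g x).trans ?_
  rw [← lintegral_indicator_one hE]
  refine lintegral_mono fun t => ?_
  rw [← ofReal_norm]
  refine (ENNReal.ofReal_le_ofReal (hgE t)).trans_eq ?_
  by_cases h : t ∈ E <;> simp [h]

theorem restrictedBound_zero {n : ℕ} (P : CurveFamily n) (N : ℝ) : RestrictedBound P N 0 1 := by
  intro ζ J _ E _ hE g _ hgE A _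
  calc ∫⁻ x in A, ‖fourierExtension volume ζ g x‖ₑ ≤ ∫⁻ _ in A, volume E :=
        lintegral_mono (enorm_fourierExtension_le_measure ζ hE hgE)
    _ = _ := by simp

theorem uniformRestrictedBound_zero (n : ℕ) : UniformRestrictedBound n 0 :=
  ⟨1, one_pos, fun _ _ P _ => restrictedBound_zero P _⟩

theorem rpow_mul_rpow_convexCombination {x : ℝ≥0∞} {s₀ s₁ θ : ℝ} (hs₀ : 0 ≤ s₀) (hs₁ : 0 ≤ s₁)
    (hθ0 : 0 ≤ θ) (hθ1 : θ ≤ 1) :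
    (x ^ s₀) ^ (1 - θ) * (x ^ s₁) ^ θ = x ^ ((1 - θ) * s₀ + θ * s₁) := by
  have := sub_nonneg.2 hθ1
  rw [← ENNReal.rpow_mul, ← ENNReal.rpow_mul, mul_comm s₀, mul_comm s₁,
    ENNReal.rpow_add_of_nonneg _ _ (by positivity) (by positivity)]

theorem RestrictedBound.interpolate {n : ℕ} {P : CurveFamily n} {N u₀ u₁ K₀ K₁ θ : ℝ}
    (hN : 0 < N) (hK₀ : 0 < K₀) (hK₁ : 0 < K₁) (h₀ : RestrictedBound P N u₀ K₀)
    (h₁ : RestrictedBound P N u₁ K₁) (hθ0 : 0 ≤ θ) (hθ1 : θ ≤ 1)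
    (hu₀ : homogeneousDim n * u₀ ≤ 1) (hu₁ : homogeneousDim n * u₁ ≤ 1) :
    RestrictedBound P N ((1 - θ) * u₀ + θ * u₁) (K₀ ^ (1 - θ) * K₁ ^ θ) := by
  intro ζ J hζ E hEJ hE g hg hgE A hA
  have hθ' : 0 ≤ 1 - θ := sub_nonneg.2 hθ1
  have hconst : ENNReal.ofReal (K₀ ^ (1 - θ) * K₁ ^ θ * N ^ ((1 - θ) * u₀ + θ * u₁)) =
      ENNReal.ofReal (K₀ * N ^ u₀) ^ (1 - θ) * ENNReal.ofReal (K₁ * N ^ u₁) ^ θ := by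
    rw [ENNReal.ofReal_rpow_of_nonneg (by positivity) hθ',
      ENNReal.ofReal_rpow_of_nonneg (by positivity) hθ0, ← ENNReal.ofReal_mul (by positivity),
      Real.mul_rpow hK₀.le (by positivity), Real.mul_rpow hK₁.le (by positivity),
      ← Real.rpow_mul hN.le, ← Real.rpow_mul hN.le, Real.rpow_add hN, mul_comm u₀, mul_comm u₁]
    ring_nf
  have hE' := rpow_mul_rpow_convexCombination (x := volume E) (sub_nonneg.2 hu₀) (sub_nonneg.2 hu₁)
    hθ0 hθ1
  have hA' := rpow_mul_rpow_convexCombination (x := volume A)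
    (sub_nonneg.2 (le_one_of_homogeneousDim_mul_le_one hu₀))
    (sub_nonneg.2 (le_one_of_homogeneousDim_mul_le_one hu₁)) hθ0 hθ1
  set I := ∫⁻ x in A, ‖fourierExtension volume ζ g x‖ₑ
  calc I = I ^ (1 - θ) * I ^ θ := by
        rw [← ENNReal.rpow_add_of_nonneg _ _ hθ' hθ0, sub_add_cancel, ENNReal.rpow_one]
    _ ≤ (ENNReal.ofReal (K₀ * N ^ u₀) * volume E ^ (1 - homogeneousDim n * u₀) *
            volume A ^ (1 - u₀)) ^ (1 - θ) *
          (ENNReal.ofReal (K₁ * N ^ u₁) * volume E ^ (1 - homogeneousDim n * u₁) *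
            volume A ^ (1 - u₁)) ^ θ := by
        gcongr
        exacts [h₀ hζ hEJ hE hg hgE hA, h₁ hζ hEJ hE hg hgE hA]
    _ = _ := by
        simp only [ENNReal.mul_rpow_of_nonneg _ _ hθ', ENNReal.mul_rpow_of_nonneg _ _ hθ0]
        rw [hconst, show 1 - homogeneousDim n * ((1 - θ) * u₀ + θ * u₁) =
            (1 - θ) * (1 - homogeneousDim n * u₀) + θ * (1 - homogeneousDim n * u₁) by ring, ← hE',
          show 1 - ((1 - θ) * u₀ + θ * u₁) = (1 - θ) * (1 - u₀) + θ * (1 - u₁) by ring, ← hA']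
        ring

theorem UniformRestrictedBound.of_le {n : ℕ} {u v : ℝ} (h : UniformRestrictedBound n v)
    (hu : 0 ≤ u) (huv : u ≤ v) (hv : homogeneousDim n * v ≤ 1) : UniformRestrictedBound n u := by
  rcases hu.eq_or_lt with rfl | hu
  · exact uniformRestrictedBound_zero n
  have hv0 : 0 < v := hu.trans_le huv
  obtain ⟨K, hK, hR⟩ := h
  refine ⟨1 ^ (1 - u / v) * K ^ (u / v), by positivity, fun δ hδ P hP => ?_⟩
  have hinterp := (restrictedBound_zero P _).interpolate (by positivity) one_pos hK (hR δ hδ P hP)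
    (by positivity) ((div_le_one hv0).2 huv) (by simp) hv
  rwa [mul_zero, zero_add, div_mul_cancel₀ _ hv0.ne'] at hinterp

end RestrictedBound

section NearAndFarTuples

variable {n : ℕ} {b ρ : ℝ} {E : Set ℝ} {g : ℝ → ℂ} {ζ : ℝ → EuclideanSpace ℝ (Fin (n + 1))}
  {J : Set ℝ} {A : Set (EuclideanSpace ℝ (Fin (n + 1)))}

theorem measurable_vandermondeProduct (d : ℕ) :
    Measurable (vandermondeProduct : (Fin d → ℝ) → ℝ) := by
  unfold vandermondeProduct
  fun_prop

theorem norm_prod_le_indicator {ι X : Type*} [Fintype ι] {E : Set X} {g : X → ℂ}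
    (hgE : ∀ t, ‖g t‖ ≤ E.indicator 1 t) (t : ι → X) :
    ‖∏ j, g (t j)‖ ≤ (Set.univ.pi fun _ => E).indicator 1 t := by
  rw [norm_prod, ← Finset.coe_univ, Set.indicator_pi_one_apply]
  exact Finset.prod_le_prod (fun _ _ => norm_nonneg _) fun j _ => hgE (t j)

/-- The increasing tuples whose Vandermonde product is at most `ρ`, which are treated by induction
on the exponent. -/
def nearTuples (n : ℕ) (ρ : ℝ) : Set (Fin (n + 1) → ℝ) :=
  {t | StrictMono t ∧ vandermondeProduct t ≤ ρ}

/-- The increasing tuples in `E` whose Vandermonde product exceeds `ρ`, which are treated by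
Plancherel's theorem. -/
def farTuples (n : ℕ) (E : Set ℝ) (ρ : ℝ) : Set (Fin (n + 1) → ℝ) :=
  {t | StrictMono t ∧ ρ < vandermondeProduct t} ∩ Set.univ.pi fun _ => E

theorem measurableSet_nearTuples (n : ℕ) (ρ : ℝ) : MeasurableSet (nearTuples n ρ) :=
  (measurableSet_strictMono _).inter
    (measurableSet_le (measurable_vandermondeProduct _) measurable_const)

theorem measurableSet_strictMono_lt_vandermondeProduct (n : ℕ) (ρ : ℝ) :
    MeasurableSet {t : Fin (n + 1) → ℝ | StrictMono t ∧ ρ < vandermondeProduct t} :=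
  (measurableSet_strictMono _).inter
    (measurableSet_lt measurable_const (measurable_vandermondeProduct _))

theorem measurableSet_farTuples (hE : MeasurableSet E) (ρ : ℝ) :
    MeasurableSet (farTuples n E ρ) :=
  (measurableSet_strictMono_lt_vandermondeProduct n ρ).inter (.univ_pi fun _ => hE)

theorem fourierExtension_strictMono_eq_add (hζ : Measurable ζ) (hg : Integrable g)
    (hgE : ∀ t, ‖g t‖ ≤ E.indicator 1 t) (ρ : ℝ) (x : EuclideanSpace ℝ (Fin (n + 1))) :
    fourierExtension (volume.restrict {t | StrictMono t}) (curveSum ζ) (fun t => ∏ j, g (t j)) x =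
      fourierExtension (volume.restrict (nearTuples n ρ)) (curveSum ζ) (fun t => ∏ j, g (t j)) x +
      fourierExtension (volume.restrict (farTuples n E ρ)) (curveSum ζ)
        (fun t => ∏ j, g (t j)) x := by
  have hintegrable : Integrable fun t : Fin (n + 1) → ℝ =>
      planeWave x (curveSum ζ t) * ∏ j, g (t j) :=
    integrable_planeWave_mul (Integrable.fintype_prod fun _ => hg) measurable_const
      (measurable_curveSum hζ)
  have hmeas := measurableSet_strictMono_lt_vandermondeProduct n ρ
  have hunion : {t : Fin (n + 1) → ℝ | StrictMono t} =
      nearTuples n ρ ∪ {t | StrictMono t ∧ ρ < vandermondeProduct t} := by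
    ext t
    simp only [nearTuples, Set.mem_ofPred_eq, Set.mem_union, ← and_or_left, le_or_gt, and_true]
  have hdisj : Disjoint (nearTuples n ρ) {t | StrictMono t ∧ ρ < vandermondeProduct t} :=
    Set.disjoint_left.2 fun t ht ht' => ht'.2.not_ge ht.2
  unfold fourierExtension
  rw [hunion, setIntegral_union hdisj hmeas hintegrable.integrableOn hintegrable.integrableOn]
  congr 1
  refine setIntegral_eq_of_subset_of_forall_sdiff_eq_zero hmeas Set.inter_subset_left ?_
  intro t ht
  have hzero := norm_prod_le_indicator hgE t
  rw [Set.indicator_of_notMem fun h => ht.2 ⟨ht.1, h⟩] at hzero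
  rw [norm_le_zero_iff.1 hzero, mul_zero]

theorem one_le_rpow_mul_starSum {t : Fin (n + 1) → ℝ} (hb : 0 ≤ b) (ht : t ∈ nearTuples n ρ) :
    1 ≤ ENNReal.ofReal (ρ ^ (2 * b / (n + 1))) * starSum b t := by
  have hv := vandermondeProduct_pos ht.1
  have hρ := hv.trans_le ht.2
  refine le_trans ?_ (mul_le_mul_right (vandermondeProduct_rpow_neg_le_starSum ht.1) _)
  rw [← ENNReal.ofReal_mul (by positivity), ← ENNReal.ofReal_one, Real.rpow_neg hv.le,
    ← div_eq_mul_inv]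
  refine ENNReal.ofReal_le_ofReal ((one_le_div (by positivity)).2 ?_)
  exact Real.rpow_le_rpow hv.le ht.2 (by positivity)

theorem inv_vandermondeProduct_le_rpow_mul_starSum {t : Fin (n + 1) → ℝ} (hb : 2 * b ≤ n + 1)
    (hρ : 0 < ρ) (ht : StrictMono t) (hρt : ρ < vandermondeProduct t) :
    ENNReal.ofReal ((vandermondeProduct t)⁻¹) ≤
      ENNReal.ofReal (ρ ^ (2 * b / (n + 1) - 1)) * starSum b t := by
  have hv := vandermondeProduct_pos ht
  have hτ : 2 * b / (n + 1) - 1 ≤ 0 := sub_nonpos.2 ((div_le_one (by positivity)).2 hb)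
  refine le_trans ?_ (mul_le_mul_right (vandermondeProduct_rpow_neg_le_starSum ht) _)
  rw [← ENNReal.ofReal_mul (by positivity)]
  refine ENNReal.ofReal_le_ofReal ?_
  calc (vandermondeProduct t)⁻¹
      = vandermondeProduct t ^ (2 * b / (n + 1) - 1) *
          vandermondeProduct t ^ (-(2 * b / (n + 1))) := by
        rw [← Real.rpow_add hv, ← Real.rpow_neg_one]
        congr 1
        ring
    _ ≤ _ := by
        gcongr ?_ * _
        exact Real.rpow_le_rpow_of_nonpos hρ hρt.le hτ

theorem RestrictedBound.setLIntegral_translateSum_le {δ N u K : ℝ} {P : CurveFamily n}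
    (hR : RestrictedBound P N u K) (hP : IsAdmissibleFamily δ P) (hζ : P ζ J) (hEJ : E ⊆ J)
    (hE : MeasurableSet E) (hg : Measurable g) (hgE : ∀ t, ‖g t‖ ≤ E.indicator 1 t)
    (hA : MeasurableSet A) {κ : Fin n → ℝ} (hκ : StrictMono (baseTuple 0 κ)) :
    ∫⁻ x in A, ‖fourierExtension volume (translateSum ζ κ)
        (fun s => ∏ j, g (baseTuple s κ j)) x‖ₑ ≤
      ENNReal.ofReal (K * N ^ u) * volume (baseSet E κ) ^ (1 - homogeneousDim n * u) *
        volume A ^ (1 - u) := by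
  refine hR (hP.translateSum hζ κ hκ) (E := baseSet E κ) (fun s hs j => hEJ (hs j))
    (measurableSet_baseSet hE κ) (g := fun s => ∏ j, g (baseTuple s κ j))
    (Finset.measurable_prod _ fun j _ => hg.comp (measurable_id.add_const _)) (fun s => ?_) hA
  exact (norm_prod_le_indicator hgE (baseTuple s κ)).trans_eq
    (Set.indicator_eq_indicator mem_baseSet_iff.symm rfl)

theorem RestrictedBound.setLIntegral_nearTuples_le {δ N u K : ℝ} {P : CurveFamily n}
    (hR : RestrictedBound P N u K) (hP : IsAdmissibleFamily δ P) (hb : 0 ≤ b) (hζ : P ζ J)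
    (hEJ : E ⊆ J) (hE : MeasurableSet E) (hg : Measurable g)
    (hgE : ∀ t, ‖g t‖ ≤ E.indicator 1 t) (hA : MeasurableSet A) :
    ∫⁻ x in A, ‖fourierExtension (volume.restrict (nearTuples n ρ)) (curveSum ζ)
        (fun t => ∏ j, g (t j)) x‖ₑ ≤
      ENNReal.ofReal (K * N ^ u) * volume A ^ (1 - u) * (ENNReal.ofReal (ρ ^ (2 * b / (n + 1))) *
        ∫⁻ κ : Fin n → ℝ, volume (baseSet E κ) ^ (1 - homogeneousDim n * u) *
          starSum b (baseTuple 0 κ)) := by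
  have hζm := hP.measurable hζ
  have hgi := integrable_of_norm_le_indicator hE
    (ne_top_of_le_ne_top (hP.volume_ne_top hζ) (measure_mono hEJ)) hg hgE
  have hΩm := measurableSet_nearTuples n ρ
  have hinv (s : ℝ) (κ : Fin n → ℝ) : baseTuple s κ ∈ nearTuples n ρ ↔
      baseTuple 0 κ ∈ nearTuples n ρ :=
    and_congr (strictMono_baseTuple_iff s κ) (by rw [vandermondeProduct_baseTuple])
  have hbase : Measurable fun κ : Fin n → ℝ => baseTuple 0 κ :=
    (measurePreserving_baseTuple n).measurable.comp measurable_prodMk_right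
  have hm : Measurable fun κ : Fin n → ℝ => volume (baseSet E κ) ^ (1 - homogeneousDim n * u) *
      starSum b (baseTuple 0 κ) :=
    ((measurable_volume_baseSet hE).pow_const _).mul ((measurable_starSum b).comp hbase)
  rw [← lintegral_const_mul _ hm, ← lintegral_const_mul _ (hm.const_mul _)]
  refine (setLIntegral_enorm_fourierExtension_curveSum_le hζm (by fun_prop)
    (Integrable.fintype_prod fun _ => hgi) hΩm hinv A).trans
    ((setLIntegral_mono' (hbase hΩm) fun κ hκ => ?_).trans (setLIntegral_le_lintegral _ _))
  calc _ ≤ ENNReal.ofReal (K * N ^ u) * volume (baseSet E κ) ^ (1 - homogeneousDim n * u) *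
          volume A ^ (1 - u) * 1 := by
        rw [mul_one]
        exact hR.setLIntegral_translateSum_le hP hζ hEJ hE hg hgE hA hκ.1
    _ ≤ ENNReal.ofReal (K * N ^ u) * volume (baseSet E κ) ^ (1 - homogeneousDim n * u) *
          volume A ^ (1 - u) *
          (ENNReal.ofReal (ρ ^ (2 * b / (n + 1))) * starSum b (baseTuple 0 κ)) := by
        gcongr
        exact one_le_rpow_mul_starSum hb hκ
    _ = _ := by ring

theorem setLIntegral_enorm_le_rpow {X : Type*} [MeasurableSpace X] {μ : Measure X} {f : X → ℂ}
    (hf : Measurable f) {d : ℕ} (hd : d ≠ 0) (A : Set X) :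
    ∫⁻ x in A, ‖f x‖ₑ ∂μ ≤
      (∫⁻ x in A, ‖f x‖ₑ ^ d ∂μ) ^ (1 / d : ℝ) * μ A ^ (1 - 1 / d : ℝ) := by
  have hd1 : (1 : ℝ) ≤ d := by exact_mod_cast Nat.one_le_iff_ne_zero.2 hd
  have hholder := ENNReal.lintegral_mul_norm_pow_le (μ := μ.restrict A)
    (f := fun x => ‖f x‖ₑ ^ d) (g := fun _ => 1) (hf.enorm.pow_const d).aemeasurable
    aemeasurable_const (p := 1 / d) (q := 1 - 1 / d) (by positivity)
    (sub_nonneg.2 ((div_le_one (by positivity)).2 hd1)) (add_sub_cancel _ _)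
  have hroot (x : ℝ≥0∞) : (x ^ d) ^ (1 / d : ℝ) * 1 ^ (1 - 1 / d : ℝ) = x := by
    rw [ENNReal.one_rpow, mul_one, ← ENNReal.rpow_natCast, ← ENNReal.rpow_mul,
      mul_one_div_cancel (by positivity), ENNReal.rpow_one]
  simpa only [hroot, setLIntegral_one] using hholder

theorem IsAdmissibleFamily.setLIntegral_farTuples_le {δ : ℝ} {P : CurveFamily n}
    (hP : IsAdmissibleFamily δ P) (hδ : 0 < δ) (hb : 2 * b ≤ n + 1) (hζ : P ζ J) (hEJ : E ⊆ J)
    (hE : MeasurableSet E) (hE0 : volume E ≠ 0) (hg : Measurable g)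
    (hgE : ∀ t, ‖g t‖ ≤ E.indicator 1 t) (hρ : 0 < ρ) :
    ∫⁻ x in A, ‖fourierExtension (volume.restrict (farTuples n E ρ)) (curveSum ζ)
        (fun t => ∏ j, g (t j)) x‖ₑ ≤
      (ENNReal.ofReal ((2 * Real.pi) ^ (n + 1) / δ) *
        (ENNReal.ofReal (ρ ^ (2 * b / (n + 1) - 1)) *
          ∫⁻ t in Set.univ.pi fun _ : Fin (n + 1) => E, starSum b t)) ^ (1 / 2 : ℝ) *
      volume A ^ (1 / 2 : ℝ) := by
  have hJ : J.Nontrivial := Set.not_subsingleton_iff.1 fun h =>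
    hE0 (measure_mono_null hEJ (h.measure_zero volume))
  have hgi := integrable_of_norm_le_indicator hE
    (ne_top_of_le_ne_top (hP.volume_ne_top hζ) (measure_mono hEJ)) hg hgE
  have hΩJ : farTuples n E ρ ⊆ {t | StrictMono t ∧ ∀ j, t j ∈ J} :=
    fun t ht => ⟨ht.1.1, fun j => hEJ (ht.2 j trivial)⟩
  have hplancherel := lintegral_enorm_fourierExtension_curveSum_sq_le (hP.differentiableOn hζ)
    (measurableSet_farTuples hE ρ) (fun t ht => (hΩJ ht).2) (fun t ht => (hΩJ ht).1)
    ((hP.injOn hζ).mono hΩJ) hδ (fun t ht => hP.jacobian hζ hJ t (hΩJ ht).2)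
    (F := fun t => ∏ j, g (t j)) (Integrable.fintype_prod fun _ => hgi).integrableOn
    (fun t => (norm_prod_le_indicator hgE t).trans (Set.indicator_le_self' (by simp) t))
  have hholder := setLIntegral_enorm_le_rpow (μ := volume)
    (measurable_fourierExtension (μ := volume.restrict (farTuples n E ρ))
      (measurable_curveSum (hP.measurable hζ)) (by fun_prop : Measurable fun t => ∏ j, g (t j)))
    two_ne_zero A
  have hkernel : ∫⁻ t in farTuples n E ρ, ENNReal.ofReal ((vandermondeProduct t)⁻¹) ≤
      ENNReal.ofReal (ρ ^ (2 * b / (n + 1) - 1)) *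
        ∫⁻ t in Set.univ.pi fun _ : Fin (n + 1) => E, starSum b t := by
    rw [← lintegral_const_mul _ (measurable_starSum b)]
    exact (setLIntegral_mono' (measurableSet_farTuples hE ρ) fun t ht =>
      inv_vandermondeProduct_le_rpow_mul_starSum hb hρ ht.1.1 ht.1.2).trans
      (lintegral_mono_set Set.inter_subset_right)
  norm_num only [Nat.cast_ofNat] at hholder
  refine hholder.trans ?_
  gcongr
  exact (setLIntegral_le_lintegral _ _).trans (hplancherel.trans (by gcongr))

theorem setLIntegral_enorm_fourierExtension_pow_le (hζ : Measurable ζ) (hg : Measurable g)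
    (hgi : Integrable g) (hgE : ∀ t, ‖g t‖ ≤ E.indicator 1 t) {Z : ℝ≥0∞}
    (hnear : ∫⁻ x in A, ‖fourierExtension (volume.restrict (nearTuples n ρ)) (curveSum ζ)
      (fun t => ∏ j, g (t j)) x‖ₑ ≤ Z)
    (hfar : ∫⁻ x in A, ‖fourierExtension (volume.restrict (farTuples n E ρ)) (curveSum ζ)
      (fun t => ∏ j, g (t j)) x‖ₑ ≤ Z) :
    ∫⁻ x in A, ‖fourierExtension volume ζ g x‖ₑ ^ (n + 1) ≤
      ((n + 1).factorial : ℝ≥0∞) * (Z + Z) := by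
  have hsplit (x) : ‖fourierExtension volume ζ g x‖ₑ ^ (n + 1) ≤ ((n + 1).factorial : ℝ≥0∞) *
      (‖fourierExtension (volume.restrict (nearTuples n ρ)) (curveSum ζ)
          (fun t => ∏ j, g (t j)) x‖ₑ +
        ‖fourierExtension (volume.restrict (farTuples n E ρ)) (curveSum ζ)
          (fun t => ∏ j, g (t j)) x‖ₑ) := by
    rw [← enorm_pow, fourierExtension_pow_eq hζ hgi,
      fourierExtension_strictMono_eq_add hζ hgi hgE ρ, enorm_mul,
      ← ofReal_norm (Nat.cast _), Complex.norm_natCast, ENNReal.ofReal_natCast]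
    gcongr
    exact enorm_add_le _ _
  refine (lintegral_mono hsplit).trans ?_
  rw [lintegral_const_mul' _ _ (ENNReal.natCast_ne_top _), lintegral_add_left
    (measurable_fourierExtension (measurable_curveSum hζ) (by fun_prop)).enorm]
  gcongr

end NearAndFarTuples

/-! ### The iteration of exponents -/

section Bootstrap

variable {n : ℕ} {b : ℝ}

theorem exists_lintegral_volume_baseSet_rpow_mul_starSum_le {w : ℝ} (hb1 : b < 1) (hw0 : 0 ≤ w)
    (hwb : w < b) :
    ∃ C : ℝ, 0 < C ∧ ∀ {E : Set ℝ} {α : ℝ}, MeasurableSet E → 0 < α →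
      volume E = ENNReal.ofReal α →
      ∫⁻ κ : Fin n → ℝ, volume (baseSet E κ) ^ (1 - w) * starSum b (baseTuple 0 κ) ≤
        ENNReal.ofReal (C * α ^ (1 - w + n * (1 - b))) := by
  have := sub_pos.2 hb1
  have := sub_pos.2 hwb
  have hew : (1 + (b - w)) * w ≤ b := by nlinarith
  refine ⟨(n + 1) * (((2 / (1 - b) + 1) ^ n) ^ (1 - w) *
    ((2 / (1 - b) + 2 / (b - w)) ^ n) ^ w), by positivity, fun {E α} hE hα hEα => ?_⟩
  simpa using lintegral_volume_baseSet_rpow_mul_starSum_le (n := n) hα hb1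
    (lt_add_of_pos_right 1 (sub_pos.2 hwb)) hw0 (hwb.trans hb1).le hew hE hEα

/-- The weight `θ` given to Plancherel's theorem when the estimates for the near and the far tuples
are balanced. With the power `τ = 2b / (n + 1)` of the Vandermonde product it is `2τ / (1 + τ)`. -/
noncomputable def balanceWeight (n : ℕ) (b : ℝ) : ℝ := 4 * b / (n + 1 + 2 * b)

/-- The exponent for which a restricted bound with exponent `u` yields a restricted bound by one
step of Drury's argument. -/
noncomputable def druryExponent (n : ℕ) (b u : ℝ) : ℝ :=
  ((1 - balanceWeight n b) * u + balanceWeight n b / 2) / (n + 1)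

theorem exists_rpow_balance {X Y : ℝ} (hX : 0 < X) (hY : 0 < Y) (n : ℕ) (hb : 0 ≤ b) :
    ∃ ρ : ℝ, 0 < ρ ∧
      X * ρ ^ (2 * b / (n + 1)) = X ^ (1 - balanceWeight n b) * Y ^ balanceWeight n b ∧
      Y * ρ ^ ((2 * b / (n + 1) - 1) / 2) =
        X ^ (1 - balanceWeight n b) * Y ^ balanceWeight n b := by
  have : 0 < n + 1 + 2 * b := by positivity
  obtain ⟨x, rfl⟩ : ∃ x, Real.exp x = X := ⟨_, Real.exp_log hX⟩
  obtain ⟨y, rfl⟩ : ∃ y, Real.exp y = Y := ⟨_, Real.exp_log hY⟩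
  refine ⟨Real.exp (2 * (n + 1) * (y - x) / (n + 1 + 2 * b)), Real.exp_pos _, ?_, ?_⟩ <;>
  · simp only [← Real.exp_mul, ← Real.exp_add, balanceWeight]
    congr 1
    field_simp
    ring

theorem drury_rpow_identity {M K C₁ C₂ N α β : ℝ} (u : ℝ) (hM : 0 < M) (hK : 0 < K) (hC₁ : 0 < C₁)
    (hC₂ : 0 < C₂) (hN : 0 < N) (hα : 0 < α) (hβ : 0 < β) (hb : 0 ≤ b) :
    (M * ((K * N ^ u * β ^ (1 - u) * (C₁ * α ^ (1 - homogeneousDim n * u + n * (1 - b)))) ^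
          (1 - balanceWeight n b) *
        ((N * (C₂ * α ^ (1 + n * (1 - b)))) ^ (1 / 2 : ℝ) * β ^ (1 / 2 : ℝ)) ^
          balanceWeight n b)) ^ (1 / (n + 1) : ℝ) * β ^ (1 - 1 / (n + 1) : ℝ) =
      (M * ((K * C₁) ^ (1 - balanceWeight n b) * (C₂ ^ (1 / 2 : ℝ)) ^ balanceWeight n b)) ^
          (1 / (n + 1) : ℝ) * N ^ druryExponent n b u *
        α ^ (1 - homogeneousDim n * druryExponent n b u) * β ^ (1 - druryExponent n b u) := by
  have : 0 < n + 1 + 2 * b := by positivity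
  obtain ⟨m, rfl⟩ : ∃ x, Real.exp x = M := ⟨_, Real.exp_log hM⟩
  obtain ⟨k, rfl⟩ : ∃ x, Real.exp x = K := ⟨_, Real.exp_log hK⟩
  obtain ⟨c₁, rfl⟩ : ∃ x, Real.exp x = C₁ := ⟨_, Real.exp_log hC₁⟩
  obtain ⟨c₂, rfl⟩ : ∃ x, Real.exp x = C₂ := ⟨_, Real.exp_log hC₂⟩
  obtain ⟨ν, rfl⟩ : ∃ x, Real.exp x = N := ⟨_, Real.exp_log hN⟩
  obtain ⟨x, rfl⟩ : ∃ x, Real.exp x = α := ⟨_, Real.exp_log hα⟩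
  obtain ⟨y, rfl⟩ : ∃ y, Real.exp y = β := ⟨_, Real.exp_log hβ⟩
  simp only [← Real.exp_mul, ← Real.exp_add, druryExponent, balanceWeight, homogeneousDim]
  congr 1
  field_simp
  ring

theorem volume_rpow_mul_eq_top {E : Set ℝ} (hE : volume E ≠ 0)
    {A : Set (EuclideanSpace ℝ (Fin (n + 1)))} (hA : volume A = ∞) {K r s : ℝ} (hK : 0 < K)
    (hr : 0 ≤ r) (hs : 0 < s) :
    ENNReal.ofReal K * volume E ^ r * volume A ^ s = ∞ := by
  rw [hA, ENNReal.top_rpow_of_pos hs]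
  refine ENNReal.mul_top (mul_ne_zero (ENNReal.ofReal_ne_zero_iff.2 hK) fun h => ?_)
  rcases ENNReal.rpow_eq_zero_iff.1 h with h | h
  exacts [hE h.1, hr.not_gt h.2]

theorem restrictedBound_of_pos {δ N u K : ℝ} {P : CurveFamily n} (hP : IsAdmissibleFamily δ P)
    (hN : 0 < N) (hK : 0 < K) (hu : u < 1) (hDu : homogeneousDim n * u ≤ 1)
    (h : ∀ ⦃ζ J⦄, P ζ J → ∀ ⦃E : Set ℝ⦄, E ⊆ J → MeasurableSet E → ∀ ⦃g : ℝ → ℂ⦄, Measurable g →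
      (∀ t, ‖g t‖ ≤ E.indicator 1 t) → ∀ ⦃A : Set (EuclideanSpace ℝ (Fin (n + 1)))⦄,
      MeasurableSet A → ∀ α β : ℝ, 0 < α → 0 < β → volume E = ENNReal.ofReal α →
      volume A = ENNReal.ofReal β →
      ∫⁻ x in A, ‖fourierExtension volume ζ g x‖ₑ ≤
        ENNReal.ofReal (K * N ^ u * α ^ (1 - homogeneousDim n * u) * β ^ (1 - u))) :
    RestrictedBound P N u K := by
  intro ζ J hζ E hEJ hE g hg hgE A hA
  have hEfin : volume E ≠ ∞ := ne_top_of_le_ne_top (hP.volume_ne_top hζ) (measure_mono hEJ)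
  by_cases hE0 : volume E = 0
  · have hzero (x) : ‖fourierExtension volume ζ g x‖ₑ = 0 :=
      nonpos_iff_eq_zero.1 (hE0 ▸ enorm_fourierExtension_le_measure ζ hE hgE x)
    simp only [hzero, lintegral_zero, zero_le]
  by_cases hA0 : volume A = 0
  · rw [Measure.restrict_eq_zero.2 hA0, lintegral_zero_measure]
    exact zero_le
  by_cases hAtop : volume A = ∞
  · rw [volume_rpow_mul_eq_top hE0 hAtop (by positivity) (sub_nonneg.2 hDu) (sub_pos.2 hu)]
    exact le_top
  have hα : 0 < (volume E).toReal := ENNReal.toReal_pos hE0 hEfin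
  have hβ : 0 < (volume A).toReal := ENNReal.toReal_pos hA0 hAtop
  refine (h hζ hEJ hE hg hgE hA _ _ hα hβ (ENNReal.ofReal_toReal hEfin).symm
    (ENNReal.ofReal_toReal hAtop).symm).trans_eq ?_
  rw [ENNReal.ofReal_mul (by positivity), ENNReal.ofReal_mul (by positivity),
    ← ENNReal.ofReal_rpow_of_pos hα, ← ENNReal.ofReal_rpow_of_pos hβ,
    ENNReal.ofReal_toReal hEfin, ENNReal.ofReal_toReal hAtop]

theorem RestrictedBound.setLIntegral_pow_le {δ u K C₁ C₂ α β : ℝ} {P : CurveFamily n}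
    (hR : RestrictedBound P ((2 * Real.pi) ^ (n + 1) / δ) u K) (hP : IsAdmissibleFamily δ P)
    (hδ : 0 < δ) (hK : 0 < K) (hC₁ : 0 < C₁) (hC₂ : 0 < C₂) (hα : 0 < α) (hβ : 0 < β) (hb0 : 0 ≤ b)
    (hb : 2 * b ≤ n + 1) {ζ : ℝ → EuclideanSpace ℝ (Fin (n + 1))} {J E : Set ℝ} {g : ℝ → ℂ}
    {A : Set (EuclideanSpace ℝ (Fin (n + 1)))} (hζ : P ζ J) (hEJ : E ⊆ J) (hE : MeasurableSet E)
    (hg : Measurable g) (hgE : ∀ t, ‖g t‖ ≤ E.indicator 1 t) (hA : MeasurableSet A)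
    (hEα : volume E = ENNReal.ofReal α) (hAβ : volume A = ENNReal.ofReal β)
    (hnear : ∫⁻ κ : Fin n → ℝ, volume (baseSet E κ) ^ (1 - homogeneousDim n * u) *
      starSum b (baseTuple 0 κ) ≤
        ENNReal.ofReal (C₁ * α ^ (1 - homogeneousDim n * u + n * (1 - b))))
    (hfar : ∫⁻ t in Set.univ.pi fun _ : Fin (n + 1) => E, starSum b t ≤
      ENNReal.ofReal (C₂ * α ^ (1 + n * (1 - b)))) :
    ∫⁻ x in A, ‖fourierExtension volume ζ g x‖ₑ ^ (n + 1) ≤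
      ENNReal.ofReal (2 * (n + 1).factorial *
        ((K * ((2 * Real.pi) ^ (n + 1) / δ) ^ u * β ^ (1 - u) *
            (C₁ * α ^ (1 - homogeneousDim n * u + n * (1 - b)))) ^ (1 - balanceWeight n b) *
          (((2 * Real.pi) ^ (n + 1) / δ * (C₂ * α ^ (1 + n * (1 - b)))) ^ (1 / 2 : ℝ) *
            β ^ (1 / 2 : ℝ)) ^ balanceWeight n b)) := by
  set N : ℝ := (2 * Real.pi) ^ (n + 1) / δ
  have : 0 < N := by positivity
  set X : ℝ := K * N ^ u * β ^ (1 - u) *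
    (C₁ * α ^ (1 - homogeneousDim n * u + n * (1 - b))) with hX
  set Y : ℝ := (N * (C₂ * α ^ (1 + n * (1 - b)))) ^ (1 / 2 : ℝ) * β ^ (1 / 2 : ℝ) with hY
  obtain ⟨ρ, hρ, hρX, hρY⟩ := exists_rpow_balance (X := X) (Y := Y) (by positivity) (by positivity)
    n hb0
  set Z : ℝ := X ^ (1 - balanceWeight n b) * Y ^ balanceWeight n b
  have hnearZ := (hR.setLIntegral_nearTuples_le (ρ := ρ) hP hb0 hζ hEJ hE hg hgE hA).trans
    (mul_le_mul_right (mul_le_mul_right hnear _) _)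
  have hfarZ := (hP.setLIntegral_farTuples_le (A := A) hδ hb hζ hEJ hE
    (by simpa [hEα] using hα) hg hgE hρ).trans (mul_le_mul_left (ENNReal.rpow_le_rpow
      (mul_le_mul_right (mul_le_mul_right hfar _) _) (by norm_num)) _)
  refine (setLIntegral_enorm_fourierExtension_pow_le (Z := ENNReal.ofReal Z) (hP.measurable hζ) hg
    (integrable_of_norm_le_indicator hE (hEα ▸ ENNReal.ofReal_ne_top) hg hgE) hgE
    (hnearZ.trans_eq ?_) (hfarZ.trans_eq ?_)).trans_eq ?_
  · rw [← hρX, hAβ, ENNReal.ofReal_rpow_of_pos hβ, ← ENNReal.ofReal_mul (by positivity),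
      ← ENNReal.ofReal_mul (by positivity), ← ENNReal.ofReal_mul (by positivity), hX]
    ring_nf
  · rw [← hρY, hAβ, ENNReal.ofReal_rpow_of_pos hβ, ← ENNReal.ofReal_mul (by positivity),
      ← ENNReal.ofReal_mul (by positivity), ENNReal.ofReal_rpow_of_pos (by positivity),
      ← ENNReal.ofReal_mul (by positivity), hY, mul_left_comm N,
      Real.mul_rpow (by positivity) (by positivity), ← Real.rpow_mul hρ.le]
    ring_nf
  · rw [ENNReal.ofReal_mul (q := Z) (by positivity), ENNReal.ofReal_mul zero_le_two,
      ENNReal.ofReal_natCast, ENNReal.ofReal_ofNat]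
    ring

theorem balanceWeight_pos (n : ℕ) (hb : 0 < b) : 0 < balanceWeight n b := by
  unfold balanceWeight
  positivity

theorem balanceWeight_le_one (hb0 : 0 ≤ b) (hb : 2 * b ≤ n + 1) : balanceWeight n b ≤ 1 := by
  rw [balanceWeight, div_le_one (by positivity)]
  linarith

theorem druryExponent_lt_one {u : ℝ} (hb0 : 0 < b) (hb : 2 * b ≤ n + 1) (hu : u ≤ 1) :
    druryExponent n b u < 1 := by
  rw [druryExponent, div_lt_one (by positivity)]
  linarith [balanceWeight_pos n hb0, Nat.cast_nonneg (α := ℝ) n,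
    mul_nonneg (sub_nonneg.2 (balanceWeight_le_one hb0.le hb)) (sub_nonneg.2 hu)]

theorem homogeneousDim_mul_druryExponent_le_one {u : ℝ} (hb0 : 0 ≤ b) (hb : 2 * b ≤ n + 1)
    (hb1 : b ≤ 1) (hDu : homogeneousDim n * u ≤ 1) :
    homogeneousDim n * druryExponent n b u ≤ 1 := by
  have hweight : balanceWeight n b * (n ^ 2 + 3 * n - 2) ≤ 4 * n := by
    rw [balanceWeight, div_mul_eq_mul_div, div_le_iff₀ (by positivity)]
    nlinarith [mul_le_mul_of_nonneg_right hb1 (by positivity : (0 : ℝ) ≤ n ^ 2 + n)]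
  have hscaled := mul_le_mul_of_nonneg_left hDu (sub_nonneg.2 (balanceWeight_le_one hb0 hb))
  rw [druryExponent, mul_div_assoc', div_le_one (by positivity)]
  rw [homogeneousDim] at hscaled ⊢
  linarith

theorem UniformRestrictedBound.bootstrap {u : ℝ} (h : UniformRestrictedBound n u)
    (hb : 2 * b ≤ n + 1) (hb1 : b < 1) (hu0 : 0 ≤ u) (hub : homogeneousDim n * u < b) :
    UniformRestrictedBound n (druryExponent n b u) := by
  have hDu0 : 0 ≤ homogeneousDim n * u := mul_nonneg (by linarith [one_le_homogeneousDim n]) hu0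
  have hb0 := hDu0.trans_lt hub
  have hu1 : u ≤ 1 := by nlinarith [one_le_homogeneousDim n]
  have := sub_pos.2 hb1
  obtain ⟨K, hK, hR⟩ := h
  obtain ⟨C₁, hC₁, hnear⟩ :=
    exists_lintegral_volume_baseSet_rpow_mul_starSum_le (n := n) hb1 hDu0 hub
  set C₂ : ℝ := (n + 1) * (2 / (1 - b) + 1) ^ n
  have hC₂ : 0 < C₂ := by positivity
  refine ⟨(2 * (n + 1).factorial * ((K * C₁) ^ (1 - balanceWeight n b) *
    (C₂ ^ (1 / 2 : ℝ)) ^ balanceWeight n b)) ^ (1 / (n + 1) : ℝ), by positivity,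
    fun δ hδ P hP => restrictedBound_of_pos hP (by positivity) (by positivity)
      (druryExponent_lt_one hb0 hb hu1)
      (homogeneousDim_mul_druryExponent_le_one hb0.le hb hb1.le (hub.trans hb1).le) ?_⟩
  intro ζ J hζ E hEJ hE g hg hgE A hA α β hα hβ hEα hAβ
  have hpow := (hR δ hδ P hP).setLIntegral_pow_le hP hδ hK hC₁ hC₂ hα hβ hb0.le hb hζ hEJ hE hg
    hgE hA hEα hAβ (hnear hE hα hEα) (setLIntegral_starSum_le hα hb0.le hb1 hEα)
  have hholder := setLIntegral_enorm_le_rpow (μ := volume)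
    (measurable_fourierExtension (μ := volume) (hP.measurable hζ) hg) n.succ_ne_zero A
  have hexp : (0 : ℝ) ≤ 1 - 1 / (n + 1) :=
    sub_nonneg.2 ((div_le_one (by positivity)).2 (by simp))
  push_cast at hholder
  refine (hholder.trans (mul_le_mul_left (ENNReal.rpow_le_rpow hpow (by positivity)) _)).trans_eq ?_
  rw [hAβ, ENNReal.ofReal_rpow_of_nonneg (by positivity) (by positivity),
    ENNReal.ofReal_rpow_of_nonneg hβ.le hexp, ← ENNReal.ofReal_mul (by positivity),
    drury_rpow_identity u (by positivity) hK hC₁ hC₂ (by positivity) hα hβ hb0.le]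

end Bootstrap

section FixedPoint

variable {n : ℕ} {b u : ℝ}

/-- The fixed point of the iteration `u ↦ druryExponent n b u`. As `b → 1` it tends to the endpoint
`1 / (homogeneousDim n + 1)` of the restriction range. -/
noncomputable def druryFixedPoint (n : ℕ) (b : ℝ) : ℝ :=
  2 * b / (n * (n + 1) + 2 * b * (n + 2))

theorem druryFixedPoint_pos (n : ℕ) (hb : 0 < b) : 0 < druryFixedPoint n b := by
  unfold druryFixedPoint
  positivity

theorem druryExponent_sub_druryFixedPoint (n : ℕ) (hb : 0 < b) (u : ℝ) :
    druryExponent n b u - druryFixedPoint n b =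
      (1 - balanceWeight n b) / (n + 1) * (u - druryFixedPoint n b) := by
  unfold druryExponent druryFixedPoint balanceWeight
  field_simp
  ring

theorem iterate_druryExponent_zero (n : ℕ) (hb : 0 < b) (m : ℕ) :
    (druryExponent n b)^[m] 0 =
      druryFixedPoint n b * (1 - ((1 - balanceWeight n b) / (n + 1)) ^ m) := by
  induction m with
  | zero => simp
  | succ m ih =>
    rw [Function.iterate_succ_apply', ih, ← sub_add_cancel (druryExponent n b _)
      (druryFixedPoint n b), druryExponent_sub_druryFixedPoint n hb]
    ring

theorem druryRatio_mem_Ico (hb0 : 0 < b) (hb : 2 * b ≤ n + 1) :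
    (1 - balanceWeight n b) / (n + 1) ∈ Set.Ico (0 : ℝ) 1 := by
  have := sub_nonneg.2 (balanceWeight_le_one hb0.le hb)
  refine ⟨by positivity, (div_lt_one (by positivity)).2 ?_⟩
  linarith [balanceWeight_pos n hb0, Nat.cast_nonneg (α := ℝ) n]

theorem tendsto_iterate_druryExponent_zero (hb0 : 0 < b) (hb : 2 * b ≤ n + 1) :
    Filter.Tendsto (fun m : ℕ => (druryExponent n b)^[m] 0) Filter.atTop
      (nhds (druryFixedPoint n b)) := by
  obtain ⟨hq0, hq1⟩ := druryRatio_mem_Ico hb0 hb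
  simpa [iterate_druryExponent_zero n hb0] using
    ((tendsto_pow_atTop_nhds_zero_of_lt_one hq0 hq1).const_sub 1).const_mul (druryFixedPoint n b)

theorem iterate_druryExponent_zero_mem_Icc (hb0 : 0 < b) (hb : 2 * b ≤ n + 1) (m : ℕ) :
    (druryExponent n b)^[m] 0 ∈ Set.Icc 0 (druryFixedPoint n b) := by
  obtain ⟨hq0, hq1⟩ := druryRatio_mem_Ico hb0 hb
  have hU := (druryFixedPoint_pos n hb0).le
  rw [iterate_druryExponent_zero n hb0]
  exact ⟨mul_nonneg hU (sub_nonneg.2 (pow_le_one₀ hq0 hq1.le)),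
    mul_le_of_le_one_right hU (sub_le_self _ (pow_nonneg hq0 m))⟩

theorem homogeneousDim_mul_druryFixedPoint_lt (hn : 1 ≤ n) (hb0 : 0 < b)
    (hb : (n + 1) / (n + 2) < b) : homogeneousDim n * druryFixedPoint n b < b := by
  have hn' : (1 : ℝ) ≤ n := by exact_mod_cast hn
  rw [div_lt_iff₀ (by positivity)] at hb
  rw [homogeneousDim, druryFixedPoint, mul_div_assoc', div_lt_iff₀ (by positivity)]
  nlinarith

theorem exists_lt_druryFixedPoint (hn : 1 ≤ n) (hu : (homogeneousDim n + 1) * u < 1) :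
    ∃ b : ℝ, (n + 1) / (n + 2) < b ∧ b < 1 ∧ u < druryFixedPoint n b := by
  have hn' : (1 : ℝ) ≤ n := by exact_mod_cast hn
  have hcont : ContinuousAt (druryFixedPoint n) 1 :=
    ContinuousAt.div (by fun_prop) (by fun_prop) (by positivity)
  have hend : u < druryFixedPoint n 1 := by
    rw [druryFixedPoint, lt_div_iff₀ (by positivity)]
    rw [homogeneousDim] at hu
    linarith
  have hlarge : ((n + 1) / (n + 2) : ℝ) < 1 := (div_lt_one (by positivity)).2 (by linarith)
  obtain ⟨b, ⟨hub, hbn⟩, hb1⟩ := ((((hcont.eventually_const_lt hend).and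
    (eventually_gt_nhds hlarge)).filter_mono nhdsWithin_le_nhds).and
      (self_mem_nhdsWithin (s := Set.Iio (1 : ℝ)))).exists
  exact ⟨b, hbn, hb1, hub⟩

theorem two_mul_le_natCast_add_one (hn : 1 ≤ n) (hb1 : b < 1) : 2 * b ≤ n + 1 := by
  have : (1 : ℝ) ≤ n := by exact_mod_cast hn
  linarith

theorem homogeneousDim_mul_iterate_lt (hn : 1 ≤ n) (hb : (n + 1) / (n + 2) < b) (hb1 : b < 1)
    (m : ℕ) : homogeneousDim n * (druryExponent n b)^[m] 0 < b := by
  have hb0 : 0 < b := lt_trans (by positivity) hb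
  refine lt_of_le_of_lt (mul_le_mul_of_nonneg_left ?_ ?_)
    (homogeneousDim_mul_druryFixedPoint_lt hn hb0 hb)
  · exact (iterate_druryExponent_zero_mem_Icc hb0 (two_mul_le_natCast_add_one hn hb1) m).2
  · exact zero_le_one.trans (one_le_homogeneousDim n)

theorem uniformRestrictedBound_iterate (hn : 1 ≤ n) (hb : (n + 1) / (n + 2) < b) (hb1 : b < 1)
    (m : ℕ) : UniformRestrictedBound n ((druryExponent n b)^[m] 0) := by
  have hb2 := two_mul_le_natCast_add_one hn hb1
  induction m with
  | zero => exact uniformRestrictedBound_zero n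
  | succ m ih =>
    rw [Function.iterate_succ_apply']
    exact ih.bootstrap hb2 hb1
      (iterate_druryExponent_zero_mem_Icc (lt_trans (by positivity) hb) hb2 m).1
      (homogeneousDim_mul_iterate_lt hn hb hb1 m)

theorem uniformRestrictedBound_half_zero : UniformRestrictedBound 0 (1 / 2) := by
  have hexp : druryExponent 0 (1 / 2) 0 = 1 / 2 := by norm_num [druryExponent, balanceWeight]
  rw [← hexp]
  exact (uniformRestrictedBound_zero 0).bootstrap (by norm_num) (by norm_num) le_rfl (by norm_num)

theorem uniformRestrictedBound (hu0 : 0 ≤ u) (hu : (homogeneousDim n + 1) * u < 1) :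
    UniformRestrictedBound n u := by
  rcases Nat.eq_zero_or_pos n with rfl | hn
  · refine uniformRestrictedBound_half_zero.of_le hu0 ?_ ?_ <;> norm_num [homogeneousDim] at hu ⊢
    linarith
  obtain ⟨b, hbn, hb1, hub⟩ := exists_lt_druryFixedPoint hn hu
  obtain ⟨m, hm⟩ := ((tendsto_iterate_druryExponent_zero (lt_trans (by positivity) hbn)
    (two_mul_le_natCast_add_one hn hb1)).eventually_const_lt hub).exists
  exact (uniformRestrictedBound_iterate hn hbn hb1 m).of_le hu0 hm.le
    ((homogeneousDim_mul_iterate_lt hn hbn hb1 m).trans hb1).le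

end FixedPoint

/-! ### Interpolation -/

section Interpolation

variable {X Y : Type*}

/-- The part of `f` of height at most `l`, for splitting a function in interpolation arguments. -/
noncomputable def lowPart (f : X → ℂ) (l : ℝ) : X → ℂ := {x | ‖f x‖ ≤ l}.indicator f

theorem lowPart_of_le {f : X → ℂ} {l : ℝ} {x : X} (hx : ‖f x‖ ≤ l) : lowPart f l x = f x :=
  Set.indicator_of_mem (s := {x | ‖f x‖ ≤ l}) hx f

theorem lowPart_of_lt {f : X → ℂ} {l : ℝ} {x : X} (hx : l < ‖f x‖) : lowPart f l x = 0 :=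
  Set.indicator_of_notMem (s := {x | ‖f x‖ ≤ l}) hx.not_ge f

theorem lintegral_rpow_mul_enorm_lowPart_rpow (f : X → ℂ) {a η p₁ : ℝ} (ha : 0 < a) (hη : 0 < η)
    (hp : η / a < p₁) (x : X) :
    ∫⁻ s in Set.Ioi (0 : ℝ), ENNReal.ofReal (s ^ (η - 1)) * ‖lowPart f (s ^ (-a)) x‖ₑ ^ p₁ =
      ENNReal.ofReal (1 / η) * ‖f x‖ₑ ^ (p₁ - η / a) := by
  have hp₁ : 0 < p₁ := lt_trans (by positivity) hp
  rcases (norm_nonneg (f x)).eq_or_lt with hzero | hpos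
  · have hfx : f x = 0 := norm_eq_zero.1 hzero.symm
    have hlow (l : ℝ) : lowPart f l x = 0 := Set.indicator_apply_eq_zero.2 fun _ => hfx
    simp [hlow, hfx, ENNReal.zero_rpow_of_pos hp₁, ENNReal.zero_rpow_of_pos (sub_pos.2 hp)]
  set S : ℝ := ‖f x‖ ^ (-a)⁻¹ with hS
  have hS0 : 0 < S := by positivity
  have hiff {s : ℝ} (hs : 0 < s) : ‖f x‖ ≤ s ^ (-a) ↔ s ≤ S :=
    (Real.le_rpow_inv_iff_of_neg hs hpos (neg_neg_of_pos ha)).symm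
  have htail (s : ℝ) (hs : s ∈ Set.Ioi S) :
      ENNReal.ofReal (s ^ (η - 1)) * ‖lowPart f (s ^ (-a)) x‖ₑ ^ p₁ = 0 := by
    rw [lowPart_of_lt (not_le.1 (mt (hiff (hS0.trans hs)).1 hs.not_ge)), enorm_zero,
      ENNReal.zero_rpow_of_pos hp₁, mul_zero]
  have hmain (s : ℝ) (hs : s ∈ Set.Ioc 0 S) :
      ENNReal.ofReal (s ^ (η - 1)) * ‖lowPart f (s ^ (-a)) x‖ₑ ^ p₁ =
        ENNReal.ofReal (s ^ (-(1 - η))) * ‖f x‖ₑ ^ p₁ := by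
    rw [lowPart_of_le ((hiff hs.1).2 hs.2), neg_sub]
  rw [← Set.Ioc_union_Ioi_eq_Ioi hS0.le,
    lintegral_union measurableSet_Ioi (Set.Ioc_disjoint_Ioi le_rfl),
    setLIntegral_congr_fun measurableSet_Ioi htail, lintegral_zero, add_zero,
    setLIntegral_congr_fun measurableSet_Ioc hmain, lintegral_mul_const _ (by fun_prop),
    lintegral_Ioc_rpow_neg hS0 (by linarith), sub_sub_cancel, ← ofReal_norm,
    ENNReal.ofReal_rpow_of_pos hpos, ENNReal.ofReal_rpow_of_pos hpos,
    ← ENNReal.ofReal_mul (by positivity), ← ENNReal.ofReal_mul (by positivity), hS,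
    ← Real.rpow_mul hpos.le, div_mul_eq_mul_div, ← Real.rpow_add hpos]
  ring_nf

variable [MeasurableSpace X] [MeasurableSpace Y] {μ : Measure X} {ν : Measure Y}

theorem lintegral_enorm_sub_lowPart_le {f : X → ℂ} (hf : Measurable f) {p l : ℝ} (hp : 1 ≤ p)
    (hl : 0 < l) :
    ∫⁻ x, ‖f x - lowPart f l x‖ₑ ∂μ ≤ ENNReal.ofReal (l ^ (1 - p)) * ∫⁻ x, ‖f x‖ₑ ^ p ∂μ := by
  rw [← lintegral_const_mul _ (hf.enorm.pow_const _)]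
  refine lintegral_mono fun x => ?_
  rcases le_or_gt ‖f x‖ l with hx | hx
  · simp only [lowPart_of_le hx, sub_self, enorm_zero, zero_le]
  have hx0 : 0 < ‖f x‖ := hl.trans hx
  rw [lowPart_of_lt hx, sub_zero, ← ofReal_norm, ENNReal.ofReal_rpow_of_pos hx0,
    ← ENNReal.ofReal_mul (by positivity)]
  refine ENNReal.ofReal_le_ofReal ?_
  calc ‖f x‖ = ‖f x‖ ^ (1 - p) * ‖f x‖ ^ p := by
        rw [← Real.rpow_add hx0, sub_add_cancel, Real.rpow_one]
    _ ≤ l ^ (1 - p) * ‖f x‖ ^ p := by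
        gcongr ?_ * _
        exact Real.rpow_le_rpow_of_nonpos hl hx.le (sub_nonpos.2 hp)

theorem lintegral_enorm_lowPart_rpow_le {f : X → ℂ} (hf : Measurable f) {p p₁ l : ℝ} (hp : 0 < p)
    (hpp : p ≤ p₁) (hl : 0 ≤ l) :
    ∫⁻ x, ‖lowPart f l x‖ₑ ^ p₁ ∂μ ≤
      ENNReal.ofReal (l ^ (p₁ - p)) * ∫⁻ x, ‖f x‖ₑ ^ p ∂μ := by
  have hp₁ : 0 < p₁ := hp.trans_le hpp
  rw [← lintegral_const_mul _ (hf.enorm.pow_const _)]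
  refine lintegral_mono fun x => ?_
  rcases le_or_gt ‖f x‖ l with hx | hx
  · rw [lowPart_of_le hx, ← ofReal_norm, ENNReal.ofReal_rpow_of_nonneg (norm_nonneg _) hp₁.le,
      ENNReal.ofReal_rpow_of_nonneg (norm_nonneg _) hp.le, ← ENNReal.ofReal_mul (by positivity)]
    refine ENNReal.ofReal_le_ofReal ?_
    calc ‖f x‖ ^ p₁ = ‖f x‖ ^ (p₁ - p) * ‖f x‖ ^ p := by
          rw [← Real.rpow_add_of_nonneg (norm_nonneg _) (sub_nonneg.2 hpp) hp.le, sub_add_cancel]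
      _ ≤ l ^ (p₁ - p) * ‖f x‖ ^ p := by gcongr
  · rw [lowPart_of_lt hx, enorm_zero, ENNReal.zero_rpow_of_pos hp₁]
    exact zero_le

theorem lintegral_rpow_mul_lintegral_lowPart [SFinite μ] {f : X → ℂ} (hf : Measurable f)
    {a η p₁ : ℝ} (ha : 0 < a) (hη : 0 < η) (hp : η / a < p₁) :
    ∫⁻ s in Set.Ioi (0 : ℝ), ENNReal.ofReal (s ^ (η - 1)) *
        ∫⁻ x, ‖lowPart f (s ^ (-a)) x‖ₑ ^ p₁ ∂μ =
      ENNReal.ofReal (1 / η) * ∫⁻ x, ‖f x‖ₑ ^ (p₁ - η / a) ∂μ := by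
  have hlow : Measurable fun z : ℝ × X => lowPart f (z.1 ^ (-a)) z.2 :=
    (hf.comp measurable_snd).indicator (s := {z : ℝ × X | ‖f z.2‖ ≤ z.1 ^ (-a)})
      (measurableSet_le (hf.norm.comp measurable_snd) (by fun_prop))
  have hmeas : Measurable fun z : ℝ × X =>
      ENNReal.ofReal (z.1 ^ (η - 1)) * ‖lowPart f (z.1 ^ (-a)) z.2‖ₑ ^ p₁ := by fun_prop
  simp_rw [← lintegral_const_mul' _ _ ENNReal.ofReal_ne_top]
  rw [lintegral_lintegral_swap hmeas.aemeasurable]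
  simp_rw [lintegral_rpow_mul_enorm_lowPart_rpow f ha hη hp]

theorem measure_lt_norm_le_of_setLIntegral_le [SigmaFinite μ] {f : X → ℂ} (hf : Measurable f)
    {c : ℝ≥0∞} {u : ℝ} (hu0 : 0 < u) (hu1 : u ≤ 1)
    (h : ∀ A, MeasurableSet A → ∫⁻ x in A, ‖f x‖ₑ ∂μ ≤ c * μ A ^ (1 - u)) {s : ℝ} (hs : 0 < s) :
    μ {x | s < ‖f x‖} ≤ (c / ENNReal.ofReal s) ^ (1 / u) := by
  by_contra! hlt
  obtain ⟨T, hT, hTs, hTlt, hTfin⟩ :=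
    Measure.exists_subset_measure_lt_top (measurableSet_lt measurable_const hf.norm) hlt
  have hT0 : μ T ≠ 0 := (zero_le.trans_lt hTlt).ne'
  have hchebyshev : ENNReal.ofReal s * μ T ≤ ∫⁻ x in T, ‖f x‖ₑ ∂μ := by
    rw [← setLIntegral_const]
    refine setLIntegral_mono' hT fun x hx => ?_
    rw [← ofReal_norm]
    exact ENNReal.ofReal_le_ofReal (hTs hx).le
  have hsplit : μ T = μ T ^ u * μ T ^ (1 - u) := by
    rw [← ENNReal.rpow_add _ _ hT0 hTfin.ne, add_sub_cancel, ENNReal.rpow_one]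
  have hpow : ENNReal.ofReal s * μ T ^ u ≤ c := by
    have hmul := hchebyshev.trans (h T hT)
    rw [hsplit, ← mul_assoc, ← hsplit] at hmul
    exact (ENNReal.mul_le_mul_iff_left (ENNReal.rpow_pos hT0.bot_lt hTfin.ne).ne'
      (ENNReal.rpow_ne_top_of_nonneg (sub_nonneg.2 hu1) hTfin.ne)).1 hmul
  refine hTlt.not_ge ?_
  rw [one_div, ENNReal.le_rpow_inv_iff hu0, ENNReal.le_div_iff_mul_le (by simp [hs]) (by simp)]
  rwa [mul_comm]

theorem lintegral_enorm_rpow_eq_lintegral_measure_lt_mul {f : X → ℂ} (hf : Measurable f) {r : ℝ}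
    (hr : 0 < r) :
    ∫⁻ x, ‖f x‖ₑ ^ r ∂μ =
      ENNReal.ofReal r * ∫⁻ s in Set.Ioi 0, μ {x | s < ‖f x‖} * ENNReal.ofReal (s ^ (r - 1)) := by
  rw [← lintegral_rpow_eq_lintegral_meas_lt_mul μ (.of_forall fun x => norm_nonneg (f x))
    hf.norm.aemeasurable hr]
  exact lintegral_congr fun x => by
    rw [← ofReal_norm, ENNReal.ofReal_rpow_of_nonneg (norm_nonneg _) hr.le]

theorem lintegral_enorm_rpow_eq_lintegral_measure_two_mul_lt {f : X → ℂ} (hf : Measurable f)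
    {r : ℝ} (hr : 0 < r) :
    ∫⁻ x, ‖f x‖ₑ ^ r ∂μ = ENNReal.ofReal (2 ^ r * r) *
      ∫⁻ s in Set.Ioi 0, μ {x | 2 * s < ‖f x‖} * ENNReal.ofReal (s ^ (r - 1)) := by
  have hset (s : ℝ) : {x | s < ‖f x / 2‖} = {x | 2 * s < ‖f x‖} := by
    ext x
    simp [lt_div_iff₀, mul_comm]
  calc ∫⁻ x, ‖f x‖ₑ ^ r ∂μ = ENNReal.ofReal (2 ^ r) * ∫⁻ x, ‖f x / 2‖ₑ ^ r ∂μ := by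
        rw [← lintegral_const_mul' _ _ ENNReal.ofReal_ne_top]
        refine lintegral_congr fun x => ?_
        rw [← ofReal_norm, ← ofReal_norm, ENNReal.ofReal_rpow_of_nonneg (norm_nonneg _) hr.le,
          ENNReal.ofReal_rpow_of_nonneg (norm_nonneg _) hr.le,
          ← ENNReal.ofReal_mul (by positivity), ← Real.mul_rpow (by positivity) (norm_nonneg _),
          norm_div, Complex.norm_ofNat, mul_div_cancel₀ _ two_ne_zero]
    _ = _ := by
        rw [lintegral_enorm_rpow_eq_lintegral_measure_lt_mul (hf.div_const 2) hr, ← mul_assoc,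
          ← ENNReal.ofReal_mul (by positivity)]
        simp only [hset]

theorem lintegral_enorm_rpow_le_of_measure_lt_le {f : X → ℂ} (hf : Measurable f) {c α r₁ r₂ : ℝ}
    (hc : 0 ≤ c) (hα : 0 < α) (hr₂ : 0 < r₂) (hr : r₂ < r₁) (hfα : ∀ x, ‖f x‖ ≤ α)
    (h : ∀ s : ℝ, 0 < s → μ {x | s < ‖f x‖} ≤ ENNReal.ofReal ((c / s) ^ r₂)) :
    ∫⁻ x, ‖f x‖ₑ ^ r₁ ∂μ ≤ ENNReal.ofReal (r₁ / (r₁ - r₂) * c ^ r₂ * α ^ (r₁ - r₂)) := by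
  have hr₁ : 0 < r₁ := hr₂.trans hr
  have : 0 < r₁ - r₂ := sub_pos.2 hr
  have htail (s : ℝ) (hs : s ∈ Set.Ioi α) :
      μ {x | s < ‖f x‖} * ENNReal.ofReal (s ^ (r₁ - 1)) = 0 := by
    have : {x | s < ‖f x‖} = ∅ :=
      Set.eq_empty_of_forall_notMem fun x hx => (hfα x).not_gt (hs.trans hx)
    rw [this, measure_empty, zero_mul]
  have hlevel (s : ℝ) (hs : s ∈ Set.Ioc 0 α) :
      μ {x | s < ‖f x‖} * ENNReal.ofReal (s ^ (r₁ - 1)) ≤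
        ENNReal.ofReal (c ^ r₂) * ENNReal.ofReal (s ^ (-(1 - (r₁ - r₂)))) := by
    have hs0 : 0 < s := hs.1
    refine (mul_le_mul_left (h s hs0) _).trans_eq ?_
    rw [← ENNReal.ofReal_mul (by positivity), ← ENNReal.ofReal_mul (by positivity),
      Real.div_rpow hc hs0.le, div_mul_eq_mul_div, mul_div_assoc, ← Real.rpow_sub hs0]
    ring_nf
  rw [lintegral_enorm_rpow_eq_lintegral_measure_lt_mul hf hr₁, ← Set.Ioc_union_Ioi_eq_Ioi hα.le,
    lintegral_union measurableSet_Ioi (Set.Ioc_disjoint_Ioi le_rfl),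
    setLIntegral_congr_fun measurableSet_Ioi htail, lintegral_zero, add_zero]
  refine (mul_le_mul_right (setLIntegral_mono' measurableSet_Ioc hlevel) _).trans_eq ?_
  rw [lintegral_const_mul _ (by fun_prop), lintegral_Ioc_rpow_neg hα (by linarith),
    ← ENNReal.ofReal_mul (by positivity), ← ENNReal.ofReal_mul (by positivity), sub_sub_cancel]
  ring_nf

theorem measure_lt_norm_le_lintegral_lowPart {T : (X → ℂ) → Y → ℂ}
    (hT : ∀ f g : X → ℂ, Integrable f μ → Integrable g μ → ∀ y,
      ‖T f y‖ₑ ≤ ‖T g y‖ₑ + ∫⁻ x, ‖f x - g x‖ₑ ∂μ)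
    {p p₁ q₁ c : ℝ} (hp : 1 < p) (hpp : p < p₁) (hq₁ : p₁ ≤ q₁)
    (hweak : ∀ f, Measurable f → Integrable f μ → ∀ s : ℝ, 0 < s →
      ν {y | s < ‖T f y‖} ≤
        ENNReal.ofReal ((c / s) ^ q₁) * (∫⁻ x, ‖f x‖ₑ ^ p₁ ∂μ) ^ (q₁ / p₁))
    {f : X → ℂ} (hfm : Measurable f) (hf : Integrable f μ) (hf1 : ∫⁻ x, ‖f x‖ₑ ^ p ∂μ ≤ 1)
    {s : ℝ} (hs : 0 < s) :
    ν {y | 2 * s < ‖T f y‖} ≤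
      ENNReal.ofReal ((c / s) ^ q₁ * (s ^ (-((p₁ - p) / (p - 1)))) ^ (q₁ / p₁ - 1)) *
        ∫⁻ x, ‖lowPart f (s ^ (-(1 / (p - 1)))) x‖ₑ ^ p₁ ∂μ := by
  have hp' : 0 < p - 1 := sub_pos.2 hp
  have hκ : 0 ≤ q₁ / p₁ - 1 := sub_nonneg.2 ((one_le_div (by linarith)).2 hq₁)
  set l : ℝ := s ^ (-(1 / (p - 1))) with hl
  have hlp : l ^ (1 - p) = s := by
    rw [hl, ← Real.rpow_mul hs.le, neg_mul, ← mul_neg, neg_sub, one_div_mul_cancel hp'.ne',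
      Real.rpow_one]
  have hlow : MeasurableSet {x | ‖f x‖ ≤ l} := measurableSet_le hfm.norm measurable_const
  set F : ℝ≥0∞ := ∫⁻ x, ‖lowPart f l x‖ₑ ^ p₁ ∂μ
  have hF : F ≤ ENNReal.ofReal (s ^ (-((p₁ - p) / (p - 1)))) := by
    refine ((lintegral_enorm_lowPart_rpow_le hfm (by linarith) hpp.le (by positivity)).trans
      (mul_le_of_le_one_right' hf1)).trans_eq ?_
    rw [hl, ← Real.rpow_mul hs.le]
    ring_nf
  have hhigh (y : Y) : ‖T f y‖ ≤ ‖T (lowPart f l) y‖ + s := by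
    rw [← ENNReal.ofReal_le_ofReal_iff (by positivity), ENNReal.ofReal_add (by positivity) hs.le,
      ofReal_norm, ofReal_norm]
    refine (hT f (lowPart f l) hf (hf.indicator hlow) y).trans (add_le_add_right ?_ _)
    refine (lintegral_enorm_sub_lowPart_le hfm hp.le (by positivity)).trans ?_
    exact hlp.symm ▸ mul_le_of_le_one_right' hf1
  calc ν {y | 2 * s < ‖T f y‖} ≤ ν {y | s < ‖T (lowPart f l) y‖} :=
        measure_mono fun y hy => by
          have : 2 * s < ‖T f y‖ := hy
          exact show s < ‖T (lowPart f l) y‖ by linarith [hhigh y]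
    _ ≤ ENNReal.ofReal ((c / s) ^ q₁) * F ^ (q₁ / p₁) :=
        hweak _ (hfm.indicator hlow) (hf.indicator hlow) s hs
    _ = ENNReal.ofReal ((c / s) ^ q₁) * (F ^ (q₁ / p₁ - 1) * F) := by
        congr 1
        conv_rhs => rw [← ENNReal.rpow_one F, ← ENNReal.rpow_mul, one_mul,
          ← ENNReal.rpow_add_of_nonneg _ _ hκ zero_le_one, sub_add_cancel]
    _ ≤ _ := by
        rw [ENNReal.ofReal_mul' (by positivity), mul_assoc,
          ← ENNReal.ofReal_rpow_of_nonneg (p := q₁ / p₁ - 1) (by positivity) hκ]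
        gcongr

/-- Marcinkiewicz interpolation between a weak type `(p₁, q₁)` bound and `L¹ → L^∞`. -/
theorem lintegral_enorm_rpow_le_of_weakType [SFinite μ] {T : (X → ℂ) → Y → ℂ}
    (hTm : ∀ f, Measurable f → Measurable (T f))
    (hT : ∀ f g : X → ℂ, Integrable f μ → Integrable g μ → ∀ y,
      ‖T f y‖ₑ ≤ ‖T g y‖ₑ + ∫⁻ x, ‖f x - g x‖ₑ ∂μ)
    {p p₁ q q₁ c : ℝ} (hp : 1 < p) (hpp : p < p₁) (hq₁ : p₁ ≤ q₁)
    (hq : q * (1 - 1 / p) = q₁ * (1 - 1 / p₁)) (hc : 0 ≤ c)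
    (hweak : ∀ f, Measurable f → Integrable f μ → ∀ s : ℝ, 0 < s →
      ν {y | s < ‖T f y‖} ≤
        ENNReal.ofReal ((c / s) ^ q₁) * (∫⁻ x, ‖f x‖ₑ ^ p₁ ∂μ) ^ (q₁ / p₁))
    {f : X → ℂ} (hfm : Measurable f) (hf : Integrable f μ) (hf1 : ∫⁻ x, ‖f x‖ₑ ^ p ∂μ ≤ 1) :
    ∫⁻ y, ‖T f y‖ₑ ^ q ∂ν ≤
      ENNReal.ofReal (2 ^ q * q * ((p - 1) / (p₁ - p)) * c ^ q₁) := by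
  have hp0 : 0 < p - 1 := sub_pos.2 hp
  have hp₁ : 0 < p₁ := by linarith
  have : 0 < p₁ - p := sub_pos.2 hpp
  set η : ℝ := (p₁ - p) / (p - 1) with hη
  have hqη : q = q₁ + η * (q₁ / p₁) := by
    have : 0 < p := by linarith
    rw [hη]
    field_simp at hq ⊢
    linarith
  have : 0 < q₁ := by linarith
  have hq0 : 0 < q := hqη ▸ by positivity
  have hlevel (s : ℝ) (hs : s ∈ Set.Ioi (0 : ℝ)) :
      ν {y | 2 * s < ‖T f y‖} * ENNReal.ofReal (s ^ (q - 1)) ≤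
        ENNReal.ofReal (c ^ q₁) * (ENNReal.ofReal (s ^ (η - 1)) *
          ∫⁻ x, ‖lowPart f (s ^ (-(1 / (p - 1)))) x‖ₑ ^ p₁ ∂μ) := by
    have hs0 : 0 < s := hs
    have hexponent : (s ^ (-η)) ^ (q₁ / p₁ - 1) * s ^ (q - 1) = s ^ (η - 1) * s ^ q₁ := by
      rw [← Real.rpow_mul hs0.le, ← Real.rpow_add hs0, ← Real.rpow_add hs0, hqη]
      ring_nf
    refine (mul_le_mul_left
      (measure_lt_norm_le_lintegral_lowPart hT hp hpp hq₁ hweak hfm hf hf1 hs0) _).trans_eq ?_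
    rw [mul_right_comm, ← ENNReal.ofReal_mul (by positivity), ← mul_assoc,
      ← ENNReal.ofReal_mul (by positivity), mul_assoc, hexponent, Real.div_rpow hc hs0.le]
    congr 2
    field_simp
  have hlow : ∫⁻ s in Set.Ioi (0 : ℝ), ENNReal.ofReal (s ^ (η - 1)) *
      ∫⁻ x, ‖lowPart f (s ^ (-(1 / (p - 1)))) x‖ₑ ^ p₁ ∂μ ≤ ENNReal.ofReal (1 / η) := by
    have hηa : η / (1 / (p - 1)) = p₁ - p := by
      rw [hη, div_div_div_cancel_right₀ hp0.ne', div_one]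
    rw [lintegral_rpow_mul_lintegral_lowPart hfm (by positivity) (by positivity) (by linarith),
      hηa, sub_sub_cancel]
    exact mul_le_of_le_one_right' hf1
  rw [lintegral_enorm_rpow_eq_lintegral_measure_two_mul_lt (hTm f hfm) hq0]
  calc _ ≤ ENNReal.ofReal (2 ^ q * q) * (ENNReal.ofReal (c ^ q₁) * ENNReal.ofReal (1 / η)) := by
        gcongr _ * ?_
        refine (setLIntegral_mono' measurableSet_Ioi hlevel).trans ?_
        rw [lintegral_const_mul' _ _ ENNReal.ofReal_ne_top]
        gcongr
    _ = _ := by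
        rw [hη, one_div_div, ← ENNReal.ofReal_mul (by positivity),
          ← ENNReal.ofReal_mul (by positivity)]
        ring_nf

end Interpolation

/-! ### Duality and the restriction operator -/

section RestrictionOperator

variable {d : ℕ} {f g : EuclideanSpace ℝ (Fin d) → ℂ} {ζ : ℝ → EuclideanSpace ℝ (Fin d)}
  {E : Set ℝ}

theorem fourierHat_eq_fourierExtension (f : EuclideanSpace ℝ (Fin d) → ℂ) :
    fourierHat f = fourierExtension volume id f := by
  funext ξ
  exact integral_congr_ae (.of_forall fun x => congrArg (· * f x) (planeWave_comm x ξ))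

theorem measurable_fourierHat (hf : Measurable f) : Measurable (fourierHat f) :=
  fourierHat_eq_fourierExtension f ▸ measurable_fourierExtension measurable_id hf

theorem enorm_fourierHat_le (f : EuclideanSpace ℝ (Fin d) → ℂ) (ξ : EuclideanSpace ℝ (Fin d)) :
    ‖fourierHat f ξ‖ₑ ≤ ∫⁻ x, ‖f x‖ₑ :=
  fourierHat_eq_fourierExtension f ▸ enorm_fourierExtension_le id f ξ

theorem fourierHat_add (hf : Integrable f) (hg : Integrable g) (ξ : EuclideanSpace ℝ (Fin d)) :
    fourierHat (f + g) ξ = fourierHat f ξ + fourierHat g ξ := by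
  simp only [fourierHat, Pi.add_apply, mul_add]
  exact integral_add (integrable_planeWave_mul hf measurable_id measurable_const)
    (integrable_planeWave_mul hg measurable_id measurable_const)

theorem fourierHat_const_smul (z : ℂ) (f : EuclideanSpace ℝ (Fin d) → ℂ) :
    fourierHat (z • f) = z • fourierHat f := by
  funext ξ
  simp only [fourierHat, Pi.smul_apply, mul_smul_comm, integral_smul]

theorem fourierHat_congr_ae (hfg : f =ᵐ[volume] g) : fourierHat f = fourierHat g := by
  funext ξ
  refine integral_congr_ae ?_
  filter_upwards [hfg] with x hx
  rw [hx]

theorem enorm_fourierHat_le_add (hf : Integrable f) (hg : Integrable g)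
    (ξ : EuclideanSpace ℝ (Fin d)) :
    ‖fourierHat f ξ‖ₑ ≤ ‖fourierHat g ξ‖ₑ + ∫⁻ x, ‖f x - g x‖ₑ := by
  calc ‖fourierHat f ξ‖ₑ = ‖fourierHat g ξ + fourierHat (f - g) ξ‖ₑ := by
        rw [← fourierHat_add hg (hf.sub hg), add_sub_cancel]
    _ ≤ ‖fourierHat g ξ‖ₑ + ‖fourierHat (f - g) ξ‖ₑ := enorm_add_le _ _
    _ ≤ ‖fourierHat g ξ‖ₑ + ∫⁻ x, ‖f x - g x‖ₑ := by gcongr; exact enorm_fourierHat_le _ ξ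

theorem integral_mul_fourierHat_eq (hζ : Measurable ζ) (hf : Integrable f) {w : ℝ → ℂ}
    (hw : Integrable w) :
    ∫ t, w t * fourierHat f (ζ t) = ∫ x, f x * fourierExtension volume ζ w x := by
  have hi : Integrable (fun z : ℝ × EuclideanSpace ℝ (Fin d) =>
      planeWave z.2 (ζ z.1) * (w z.1 * f z.2)) (volume.prod volume) :=
    integrable_planeWave_mul (hw.mul_prod hf) measurable_snd (hζ.comp measurable_fst)
  calc ∫ t, w t * fourierHat f (ζ t) = ∫ t, ∫ x, planeWave x (ζ t) * (w t * f x) := by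
        simp only [fourierHat, ← integral_const_mul, planeWave, mul_left_comm]
    _ = ∫ x, ∫ t, planeWave x (ζ t) * (w t * f x) := integral_integral_swap hi
    _ = ∫ x, f x * fourierExtension volume ζ w x := by
        simp only [fourierExtension, ← integral_const_mul, mul_comm (w _), mul_left_comm (f _)]

theorem exists_setLIntegral_enorm_eq_enorm_integral {X : Type*} [MeasurableSpace X] {μ : Measure X}
    {W : X → ℂ} (hW : Measurable W) {E : Set X} (hE : MeasurableSet E) (hWE : IntegrableOn W E μ) :
    ∃ w : X → ℂ, Measurable w ∧ (∀ t, ‖w t‖ ≤ E.indicator 1 t) ∧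
      ∫⁻ t in E, ‖W t‖ₑ ∂μ = ‖∫ t, w t * W t ∂μ‖ₑ := by
  refine ⟨E.indicator fun t => (starRingEnd ℂ) (W t) / (‖W t‖ : ℂ), ?_, fun t => ?_, ?_⟩
  · refine Measurable.indicator ?_ hE
    exact (Complex.continuous_conj.measurable.comp hW).div (Complex.measurable_ofReal.comp hW.norm)
  · rw [norm_indicator_eq_indicator_norm]
    refine Set.indicator_le_indicator ?_
    simpa only [norm_div, RCLike.norm_conj, Complex.norm_real, norm_norm, Pi.one_apply] using
      div_self_le_one ‖W t‖
  have hphase (t : X) : (starRingEnd ℂ) (W t) / (‖W t‖ : ℂ) * W t = (‖W t‖ : ℂ) := by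
    rcases eq_or_ne (W t) 0 with h0 | h0
    · simp [h0]
    · rw [div_mul_eq_mul_div, mul_comm, Complex.mul_conj', sq,
        mul_div_cancel_right₀ _ (by simpa using h0)]
  simp_rw [← Set.indicator_mul_left, hphase]
  rw [integral_indicator hE, integral_complex_ofReal, ← ofReal_norm, Complex.norm_real,
    Real.norm_of_nonneg (integral_nonneg fun t => norm_nonneg _),
    ofReal_integral_eq_lintegral_ofReal hWE.norm (.of_forall fun t => norm_nonneg _)]
  simp_rw [ofReal_norm]

theorem exists_setLIntegral_fourierHat_le (hζ : Measurable ζ) (hfm : Measurable f)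
    (hf : Integrable f) (hE : MeasurableSet E) (hEfin : volume E ≠ ∞) :
    ∃ w : ℝ → ℂ, Measurable w ∧ (∀ t, ‖w t‖ ≤ E.indicator 1 t) ∧
      ∫⁻ t in E, ‖fourierHat f (ζ t)‖ₑ ≤ ∫⁻ x, ‖f x‖ₑ * ‖fourierExtension volume ζ w x‖ₑ := by
  have hWm : Measurable fun t => fourierHat f (ζ t) := (measurable_fourierHat hfm).comp hζ
  have hWE : IntegrableOn (fun t => fourierHat f (ζ t)) E := by
    refine Measure.integrableOn_of_bounded (M := (∫⁻ x, ‖f x‖ₑ).toReal) hEfin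
      hWm.aestronglyMeasurable (.of_forall fun t => ?_)
    rw [← toReal_enorm]
    exact ENNReal.toReal_mono hf.2.ne (enorm_fourierHat_le f _)
  obtain ⟨w, hwm, hwE, hw⟩ := exists_setLIntegral_enorm_eq_enorm_integral hWm hE hWE
  refine ⟨w, hwm, hwE, ?_⟩
  rw [hw, integral_mul_fourierHat_eq hζ hf (integrable_of_norm_le_indicator hE hEfin hwm hwE)]
  simp_rw [← enorm_mul]
  exact enorm_integral_le_lintegral_enorm _

theorem eLpNorm_top_fourierHat_le (ζ : ℝ → EuclideanSpace ℝ (Fin d)) (ν : Measure ℝ)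
    (f : EuclideanSpace ℝ (Fin d) → ℂ) :
    eLpNorm (fun t => fourierHat f (ζ t)) ∞ ν ≤ eLpNorm f 1 volume := by
  rw [eLpNorm_exponent_top, eLpNorm_one_eq_lintegral_enorm]
  exact essSup_le_of_ae_le _ (.of_forall fun t => enorm_fourierHat_le f (ζ t))

end RestrictionOperator

section RestrictionEstimate

variable {n : ℕ} {δ K N u v : ℝ} {P : CurveFamily n} {J : Set ℝ}
  {ζ : ℝ → EuclideanSpace ℝ (Fin (n + 1))} {f : EuclideanSpace ℝ (Fin (n + 1)) → ℂ}

theorem rpow_levelConstant {D α : ℝ} (hu : 0 < u) (huv : u < v) (hK : 0 < K) (hN : 0 < N)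
    (hα : 0 < α) :
    (1 / u / (1 / u - 1 / v) * (K * N ^ v * α ^ (1 - D * v)) ^ (1 / v) * α ^ (1 / u - 1 / v)) ^ u =
      (v / (v - u) * K ^ (1 / v)) ^ u * N ^ u * α ^ (1 - D * u) := by
  have hv : 0 < v := hu.trans huv
  have : 0 < v - u := sub_pos.2 huv
  have hratio : 1 / u / (1 / u - 1 / v) = v / (v - u) := by field_simp
  have hN_pow : (N ^ v) ^ (1 / v) = N := by
    rw [← Real.rpow_mul hN.le, mul_one_div_cancel hv.ne', Real.rpow_one]
  have hα_pow : ((α ^ (1 - D * v)) ^ (1 / v) * α ^ (1 / u - 1 / v)) ^ u = α ^ (1 - D * u) := by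
    rw [← Real.rpow_mul hα.le, ← Real.rpow_add hα, ← Real.rpow_mul hα.le]
    congr 1
    field_simp
    ring
  rw [hratio, Real.mul_rpow (z := 1 / v) (by positivity) (by positivity),
    Real.mul_rpow hK.le (by positivity), hN_pow, ← hα_pow,
    ← Real.mul_rpow (by positivity) hN.le, ← Real.mul_rpow (by positivity) (by positivity)]
  congr 1
  ring

theorem RestrictedBound.lintegral_fourierExtension_rpow_le (hR : RestrictedBound P N v K)
    (hK : 0 < K) (hN : 0 < N) (hu : 0 < u) (huv : u < v) (hv : v ≤ 1) (hζm : Measurable ζ)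
    (hζ : P ζ J) {E : Set ℝ} (hEJ : E ⊆ J) (hE : MeasurableSet E) (hEfin : volume E ≠ ∞)
    {w : ℝ → ℂ} (hwm : Measurable w) (hwE : ∀ t, ‖w t‖ ≤ E.indicator 1 t) :
    (∫⁻ x, ‖fourierExtension volume ζ w x‖ₑ ^ (1 / u)) ^ u ≤
      ENNReal.ofReal ((v / (v - u) * K ^ (1 / v)) ^ u * N ^ u) *
        volume E ^ (1 - homogeneousDim n * u) := by
  have hv0 : 0 < v := hu.trans huv
  have : 0 < v - u := sub_pos.2 huv
  have : 0 < 1 / u - 1 / v := sub_pos.2 (one_div_lt_one_div_of_lt hu huv)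
  have hsup (x : EuclideanSpace ℝ (Fin (n + 1))) :
      ‖fourierExtension volume ζ w x‖ₑ ≤ volume E := enorm_fourierExtension_le_measure ζ hE hwE x
  rcases eq_or_ne (volume E) 0 with hE0 | hE0
  · have hzero (x : EuclideanSpace ℝ (Fin (n + 1))) : ‖fourierExtension volume ζ w x‖ₑ = 0 :=
      le_antisymm (hE0 ▸ hsup x) zero_le
    simp [hzero, hu]
  obtain ⟨α, hα, hEα⟩ : ∃ α : ℝ, 0 < α ∧ volume E = ENNReal.ofReal α :=
    ⟨_, ENNReal.toReal_pos hE0 hEfin, (ENNReal.ofReal_toReal hEfin).symm⟩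
  have hXm := measurable_fourierExtension (μ := volume) hζm hwm
  have hlevel (s : ℝ) (hs : 0 < s) : volume {x | s < ‖fourierExtension volume ζ w x‖} ≤
      ENNReal.ofReal ((K * N ^ v * α ^ (1 - homogeneousDim n * v) / s) ^ (1 / v)) := by
    refine (measure_lt_norm_le_of_setLIntegral_le hXm hv0 hv
      (fun A hA => hR hζ hEJ hE hwm hwE hA) hs).trans_eq ?_
    rw [hEα, ENNReal.ofReal_rpow_of_pos hα, ← ENNReal.ofReal_mul (by positivity),
      ← ENNReal.ofReal_div_of_pos hs, ENNReal.ofReal_rpow_of_pos (by positivity)]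
  have hstrong := lintegral_enorm_rpow_le_of_measure_lt_le hXm (by positivity) hα
    (one_div_pos.2 hv0) (one_div_lt_one_div_of_lt hu huv)
    (fun x => by
      rw [← ENNReal.ofReal_le_ofReal_iff hα.le, ofReal_norm, ← hEα]
      exact hsup x) hlevel
  refine (ENNReal.rpow_le_rpow hstrong hu.le).trans_eq ?_
  rw [hEα, ENNReal.ofReal_rpow_of_pos hα, ← ENNReal.ofReal_mul (by positivity)]
  rw [ENNReal.ofReal_rpow_of_nonneg (by positivity) hu.le, rpow_levelConstant hu huv hK hN hα]

theorem RestrictedBound.setLIntegral_fourierHat_le (hR : RestrictedBound P N v K)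
    (hP : IsAdmissibleFamily δ P) (hK : 0 < K) (hN : 0 < N) (hu : 0 < u) (huv : u < v)
    (hv : v ≤ 1) (hζ : P ζ J) {E : Set ℝ} (hEJ : E ⊆ J) (hE : MeasurableSet E)
    (hfm : Measurable f) (hf : Integrable f) :
    ∫⁻ t in E, ‖fourierHat f (ζ t)‖ₑ ≤
      (∫⁻ x, ‖f x‖ₑ ^ (1 / (1 - u))) ^ (1 - u) *
        (ENNReal.ofReal ((v / (v - u) * K ^ (1 / v)) ^ u * N ^ u) *
          volume E ^ (1 - homogeneousDim n * u)) := by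
  have hζm := hP.measurable hζ
  have hEfin : volume E ≠ ∞ := ne_top_of_le_ne_top (hP.volume_ne_top hζ) (measure_mono hEJ)
  obtain ⟨w, hwm, hwE, hle⟩ := exists_setLIntegral_fourierHat_le hζm hfm hf hE hEfin
  have hXm := measurable_fourierExtension (μ := volume) hζm hwm
  have hcancel {r : ℝ} (hr : r ≠ 0) (x : ℝ≥0∞) : (x ^ (1 / r)) ^ r = x := by
    rw [← ENNReal.rpow_mul, one_div_mul_cancel hr, ENNReal.rpow_one]
  calc ∫⁻ t in E, ‖fourierHat f (ζ t)‖ₑ ≤ ∫⁻ x, ‖f x‖ₑ * ‖fourierExtension volume ζ w x‖ₑ := hle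
    _ = ∫⁻ x, (‖f x‖ₑ ^ (1 / (1 - u))) ^ (1 - u) *
          (‖fourierExtension volume ζ w x‖ₑ ^ (1 / u)) ^ u := by
        simp only [hcancel hu.ne', hcancel (show 1 - u ≠ 0 by linarith)]
    _ ≤ (∫⁻ x, ‖f x‖ₑ ^ (1 / (1 - u))) ^ (1 - u) *
          (∫⁻ x, ‖fourierExtension volume ζ w x‖ₑ ^ (1 / u)) ^ u :=
        ENNReal.lintegral_mul_norm_pow_le (hfm.enorm.pow_const _).aemeasurable
          (hXm.enorm.pow_const _).aemeasurable (by linarith) hu.le (by ring)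
    _ ≤ _ := by
        gcongr
        exact hR.lintegral_fourierExtension_rpow_le hK hN hu huv hv hζm hζ hEJ hE hEfin hwm hwE

theorem exists_between_mul_lt_one {c : ℝ} (hc : 0 < c) (hu : c * u < 1) :
    ∃ v, u < v ∧ c * v < 1 := by
  obtain ⟨v, huv, hv⟩ := exists_between ((lt_div_iff₀' hc).2 hu)
  exact ⟨v, huv, (lt_div_iff₀' hc).1 hv⟩

theorem exists_measure_lt_norm_fourierHat_le (hu0 : 0 < u) (hu : (homogeneousDim n + 1) * u < 1) :
    ∃ C : ℝ, 0 < C ∧ ∀ δ : ℝ, 0 < δ → ∀ P : CurveFamily n, IsAdmissibleFamily δ P →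
      ∀ ζ J, P ζ J → ∀ f : EuclideanSpace ℝ (Fin (n + 1)) → ℂ, Measurable f → Integrable f →
      ∀ s : ℝ, 0 < s → volume.restrict J {t | s < ‖fourierHat f (ζ t)‖} ≤
        ENNReal.ofReal
            ((C * ((2 * Real.pi) ^ (n + 1) / δ) ^ u / s) ^ (1 / (homogeneousDim n * u))) *
          (∫⁻ x, ‖f x‖ₑ ^ (1 / (1 - u))) ^ (1 / (homogeneousDim n * u) / (1 / (1 - u))) := by
  have hD := one_le_homogeneousDim n
  obtain ⟨v, huv, hv⟩ := exists_between_mul_lt_one (by positivity) hu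
  have hv0 : 0 < v := hu0.trans huv
  obtain ⟨K, hK, hR⟩ := uniformRestrictedBound hv0.le hv
  have : 0 < v - u := sub_pos.2 huv
  refine ⟨(v / (v - u) * K ^ (1 / v)) ^ u, by positivity, fun δ hδ P hP ζ J hζ f hfm hf s hs => ?_⟩
  have : IsFiniteMeasure (volume.restrict J) := isFiniteMeasure_restrict.2 (hP.volume_ne_top hζ)
  refine (measure_lt_norm_le_of_setLIntegral_le (u := homogeneousDim n * u)
    (c := (∫⁻ x, ‖f x‖ₑ ^ (1 / (1 - u))) ^ (1 - u) *
      ENNReal.ofReal ((v / (v - u) * K ^ (1 / v)) ^ u * ((2 * Real.pi) ^ (n + 1) / δ) ^ u))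
    ((measurable_fourierHat hfm).comp (hP.measurable hζ)) (by positivity) (by linarith)
    (fun A hA => ?_) hs).trans_eq ?_
  · rw [Measure.restrict_restrict hA, Measure.restrict_apply hA, mul_assoc]
    exact (hR δ hδ P hP).setLIntegral_fourierHat_le hP hK (by positivity) hu0 huv (by nlinarith) hζ
      Set.inter_subset_right (hA.inter (hP.measurableSet hζ)) hfm hf
  · rw [mul_div_assoc, ← ENNReal.ofReal_div_of_pos hs,
      ENNReal.mul_rpow_of_nonneg _ _ (by positivity), ENNReal.ofReal_rpow_of_pos (by positivity),
      ← ENNReal.rpow_mul, mul_comm]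
    congr 2
    field_simp

theorem exists_lintegral_fourierHat_rpow_le (hu0 : 0 < u) (hu : (homogeneousDim n + 1) * u < 1) :
    ∃ C : ℝ, 0 < C ∧ ∀ δ : ℝ, 0 < δ → ∀ P : CurveFamily n, IsAdmissibleFamily δ P →
      ∀ ζ J, P ζ J → ∀ f : EuclideanSpace ℝ (Fin (n + 1)) → ℂ, Measurable f → Integrable f →
      ∫⁻ x, ‖f x‖ₑ ^ (1 / (1 - u)) ≤ 1 →
      ∫⁻ t in J, ‖fourierHat f (ζ t)‖ₑ ^ (1 / (homogeneousDim n * u)) ≤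
        ENNReal.ofReal
          ((C * ((2 * Real.pi) ^ (n + 1) / δ) ^ u) ^ (1 / (homogeneousDim n * u))) := by
  have hD := one_le_homogeneousDim n
  obtain ⟨v, huv, hv⟩ := exists_between_mul_lt_one (by positivity) hu
  have hv0 : 0 < v := hu0.trans huv
  have hv1 : v < 1 := by nlinarith
  obtain ⟨C, hC, hweak⟩ := exists_measure_lt_norm_fourierHat_le hv0 hv
  set q : ℝ := 1 / (homogeneousDim n * u) with hq
  set r : ℝ := (1 / (1 - u) - 1) / (1 / (1 - v) - 1 / (1 - u))
  have hp : 1 < 1 / (1 - u) := by rw [lt_div_iff₀] <;> linarith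
  have hpp : 1 / (1 - u) < 1 / (1 - v) := one_div_lt_one_div_of_lt (by linarith) (by linarith)
  have : 0 < r := div_pos (by linarith) (by linarith)
  refine ⟨(2 ^ q * q * r) ^ (1 / q) * C ^ (u / v), by positivity,
    fun δ hδ P hP ζ J hζ f hfm hf hf1 => ?_⟩
  refine (lintegral_enorm_rpow_le_of_weakType (T := fun f t => fourierHat f (ζ t))
    (fun f hfm => (measurable_fourierHat hfm).comp (hP.measurable hζ))
    (fun f g hf hg t => enorm_fourierHat_le_add hf hg (ζ t)) hp hpp
    (q₁ := 1 / (homogeneousDim n * v)) ?_ ?_ (by positivity)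
    (hweak δ hδ P hP ζ J hζ) hfm hf hf1).trans_eq ?_
  · exact one_div_le_one_div_of_le (by positivity) (by linarith)
  · rw [hq]
    field_simp
    ring
  · congr 1
    have hW : ((2 ^ q * q * r) ^ (1 / q)) ^ q = 2 ^ q * q * r := by
      rw [← Real.rpow_mul (by positivity), one_div_mul_cancel (by positivity), Real.rpow_one]
    have hvq : 1 / (homogeneousDim n * v) = u / v * q := by
      rw [hq]
      field_simp
    have hpow (N : ℝ) (hN : 0 < N) : (N ^ v) ^ (u / v * q) = (N ^ u) ^ q := by
      rw [← Real.rpow_mul hN.le, ← Real.rpow_mul hN.le]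
      congr 1
      field_simp
    rw [hvq, Real.mul_rpow hC.le (by positivity), hpow _ (by positivity), Real.rpow_mul hC.le,
      Real.mul_rpow (by positivity) (by positivity), Real.mul_rpow (by positivity) (by positivity),
      hW]
    ring

theorem eLpNorm_fourierHat_le_of_normalised {ν : Measure ℝ} {p q c : ℝ≥0∞} (hp : p ≠ 0)
    (h : ∀ g : EuclideanSpace ℝ (Fin (n + 1)) → ℂ, Measurable g → Integrable g →
      eLpNorm g p volume ≤ 1 → eLpNorm (fun t => fourierHat g (ζ t)) q ν ≤ c)
    (hfm : Measurable f) (hf : Integrable f) (hfp : eLpNorm f p volume ≠ ∞) :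
    eLpNorm (fun t => fourierHat f (ζ t)) q ν ≤ c * eLpNorm f p volume := by
  rcases eq_or_ne (eLpNorm f p volume) 0 with hf0 | hf0
  · have hzero : f =ᵐ[volume] 0 := (eLpNorm_eq_zero_iff hfm.aestronglyMeasurable hp).1 hf0
    rw [fourierHat_congr_ae hzero]
    simp [fourierHat]
  set M := eLpNorm f p volume
  have hM : 0 < M.toReal := ENNReal.toReal_pos hf0 hfp
  set z : ℂ := ↑M.toReal⁻¹ with hz_def
  have hz : ‖z‖ₑ = M⁻¹ := by
    rw [hz_def, ← ofReal_norm, Complex.norm_real, Real.norm_of_nonneg (by positivity),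
      ENNReal.ofReal_inv_of_pos hM, ENNReal.ofReal_toReal hfp]
  have hscaled := h (z • f) (hfm.const_smul z) (hf.smul z) <| by
    rw [eLpNorm_const_smul, hz, ENNReal.inv_mul_cancel hf0 hfp]
  have hsmul : (fun t => fourierHat (z • f) (ζ t)) = z • fun t => fourierHat f (ζ t) := by
    rw [fourierHat_const_smul]
    rfl
  rw [hsmul, eLpNorm_const_smul, hz, mul_comm, ← div_eq_mul_inv,
    ENNReal.div_le_iff hf0 hfp] at hscaled
  exact hscaled

theorem exists_eLpNorm_fourierHat_le {p q : ℝ≥0∞} (hu0 : 0 ≤ u)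
    (hu : (homogeneousDim n + 1) * u < 1) (hp : p⁻¹ = ENNReal.ofReal (1 - u))
    (hq : q⁻¹ = ENNReal.ofReal (homogeneousDim n * u)) :
    ∃ C : ℝ, 0 < C ∧ ∀ δ : ℝ, 0 < δ → ∀ P : CurveFamily n, IsAdmissibleFamily δ P →
      ∀ ζ J, P ζ J → ∀ f : EuclideanSpace ℝ (Fin (n + 1)) → ℂ, Measurable f → Integrable f →
      eLpNorm f p volume ≠ ∞ →
      eLpNorm (fun t => fourierHat f (ζ t)) q (volume.restrict J) ≤
        ENNReal.ofReal (C * ((2 * Real.pi) ^ (n + 1) / δ) ^ u) * eLpNorm f p volume := by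
  have hD := one_le_homogeneousDim n
  rcases hu0.eq_or_lt with rfl | hu0
  · obtain rfl : p = 1 := by simpa using hp
    obtain rfl : q = ∞ := by simpa using hq
    exact ⟨1, one_pos, fun _ _ _ _ ζ J _ f _ _ _ => by
      simpa using eLpNorm_top_fourierHat_le ζ (volume.restrict J) f⟩
  have hu1 : 0 < 1 - u := by nlinarith
  have hDu : 0 < homogeneousDim n * u := by positivity
  obtain rfl : p = ENNReal.ofReal (1 / (1 - u)) := by
    rw [← inv_inv p, hp, one_div, ENNReal.ofReal_inv_of_pos hu1]
  obtain rfl : q = ENNReal.ofReal (1 / (homogeneousDim n * u)) := by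
    rw [← inv_inv q, hq, one_div, ENNReal.ofReal_inv_of_pos hDu]
  have hp0 := one_div_pos.2 hu1
  have hq0 := one_div_pos.2 hDu
  obtain ⟨C, hC, hnormalised⟩ := exists_lintegral_fourierHat_rpow_le hu0 hu
  refine ⟨C, hC, fun δ hδ P hP ζ J hζ f hfm hf hfp => ?_⟩
  refine eLpNorm_fourierHat_le_of_normalised (ENNReal.ofReal_pos.2 hp0).ne'
    (fun g hgm hg hg1 => ?_) hfm hf hfp
  rw [eLpNorm_eq_lintegral_rpow_enorm_toReal (ENNReal.ofReal_pos.2 hp0).ne' ENNReal.ofReal_ne_top,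
    ENNReal.toReal_ofReal hp0.le, one_div (1 / (1 - u)), ENNReal.rpow_inv_le_iff hp0,
    ENNReal.one_rpow] at hg1
  rw [eLpNorm_eq_lintegral_rpow_enorm_toReal (ENNReal.ofReal_pos.2 hq0).ne' ENNReal.ofReal_ne_top,
    ENNReal.toReal_ofReal hq0.le, one_div (1 / (homogeneousDim n * u)),
    ENNReal.rpow_inv_le_iff hq0, ENNReal.ofReal_rpow_of_pos (by positivity)]
  exact hnormalised δ hδ P hP ζ J hζ g hgm hg hg1

end RestrictionEstimate

section DensityExtension

variable {d : ℕ} {p q : ℝ≥0∞} {ζ : ℝ → EuclideanSpace ℝ (Fin d)}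

/-- The subspace `L¹ ∩ L^p` of `L^p(ℝᵈ)`, on which the Fourier transform is given by its integral
formula. -/
noncomputable def integrableSubmodule (d : ℕ) (p : ℝ≥0∞) :
    Submodule ℂ (Lp ℂ p (volume : Measure (EuclideanSpace ℝ (Fin d)))) where
  carrier := {f | Integrable f volume}
  add_mem' {f g} hf hg := (Integrable.add hf hg).congr (Lp.coeFn_add f g).symm
  zero_mem' := (integrable_zero _ _ _).congr (Lp.coeFn_zero ℂ p volume).symm
  smul_mem' z f hf := (Integrable.smul z hf).congr (Lp.coeFn_smul z f).symm

theorem denseRange_integrableSubmodule_subtype [Fact (1 ≤ p)] (hp : p ≠ ∞) :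
    DenseRange (integrableSubmodule d p).subtype := by
  refine (SchwartzMap.denseRange_toLpCLM (F := ℂ) (E := EuclideanSpace ℝ (Fin d))
    (μ := volume) hp).mono ?_
  rintro _ ⟨φ, rfl⟩
  exact ⟨⟨φ.toLp p volume, φ.integrable.congr (φ.coeFn_toLp p volume).symm⟩, rfl⟩

/-- The restriction operator `f ↦ f̂ ∘ ζ` on `L¹ ∩ L^p`, with values in `L^q(ν)`. -/
noncomputable def fourierRestriction (ζ : ℝ → EuclideanSpace ℝ (Fin d)) {ν : Measure ℝ}
    (h : ∀ f : integrableSubmodule d p, MemLp (fun t => fourierHat f.1 (ζ t)) q ν) :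
    integrableSubmodule d p →ₗ[ℂ] Lp ℂ q ν where
  toFun f := (h f).toLp _
  map_add' f g := by
    rw [← MemLp.toLp_add]
    refine MemLp.toLp_congr _ _ (.of_forall fun t => ?_)
    rw [Pi.add_apply, ← fourierHat_add f.2 g.2,
      ← fourierHat_congr_ae (Lp.coeFn_add f.1 g.1)]
    rfl
  map_smul' z f := by
    rw [RingHom.id_apply, ← MemLp.toLp_const_smul]
    refine MemLp.toLp_congr _ _ (.of_forall fun t => ?_)
    rw [Pi.smul_apply, ← Pi.smul_apply z, ← fourierHat_const_smul,
      ← fourierHat_congr_ae (Lp.coeFn_smul z f.1)]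
    rfl

theorem fourierRestrictionBound_of_eLpNorm_le [Fact (1 ≤ p)] [Fact (1 ≤ q)] (hp : p ≠ ∞)
    (hζ : Measurable ζ) {J : Set ℝ} {B : ℝ} (hB : 0 ≤ B)
    (h : ∀ f : EuclideanSpace ℝ (Fin d) → ℂ, Measurable f → Integrable f →
      eLpNorm f p volume ≠ ∞ →
      eLpNorm (fun t => fourierHat f (ζ t)) q (volume.restrict J) ≤
        ENNReal.ofReal B * eLpNorm f p volume) :
    FourierRestrictionBound p q ζ J B := by
  have hmeas (f : Lp ℂ p (volume : Measure (EuclideanSpace ℝ (Fin d)))) : Measurable f :=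
    (Lp.stronglyMeasurable f).measurable
  have hbound (f : integrableSubmodule d p) :
      eLpNorm (fun t => fourierHat f.1 (ζ t)) q (volume.restrict J) ≤
        ENNReal.ofReal B * eLpNorm f.1 p volume :=
    h f.1 (hmeas f.1) f.2 (Lp.eLpNorm_ne_top f.1)
  have hmem (f : integrableSubmodule d p) :
      MemLp (fun t => fourierHat f.1 (ζ t)) q (volume.restrict J) :=
    ⟨((measurable_fourierHat (hmeas f.1)).comp hζ).aestronglyMeasurable,
      (hbound f).trans_lt (ENNReal.mul_lt_top ENNReal.ofReal_lt_top (Lp.eLpNorm_lt_top f.1))⟩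
  have hnorm (f : integrableSubmodule d p) : ‖fourierRestriction ζ hmem f‖ ≤ B * ‖f.1‖ := by
    change ‖(hmem f).toLp _‖ ≤ B * ‖f.1‖
    rw [Lp.norm_toLp, Lp.norm_def, ← ENNReal.toReal_ofReal hB, ← ENNReal.toReal_mul]
    exact ENNReal.toReal_mono
      (ENNReal.mul_ne_top ENNReal.ofReal_ne_top (Lp.eLpNorm_ne_top f.1)) (hbound f)
  have hdense := denseRange_integrableSubmodule_subtype (d := d) hp
  refine ⟨((fourierRestriction ζ hmem).extendOfNorm
    (integrableSubmodule d p).subtype).toLinearMap, fun f hf => ?_, fun f => ?_⟩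
  · have hext : (fourierRestriction ζ hmem).extendOfNorm (integrableSubmodule d p).subtype f =
        (hmem ⟨f, hf⟩).toLp _ :=
      LinearMap.extendOfNorm_eq hdense ⟨B, hnorm⟩ (⟨f, hf⟩ : integrableSubmodule d p)
    rw [ContinuousLinearMap.coe_coe, hext]
    exact MemLp.coeFn_toLp _
  · exact LinearMap.norm_extendOfNorm_apply_le hdense B hnorm f

theorem FourierRestrictionBound.congr {ζ' : ℝ → EuclideanSpace ℝ (Fin d)} {J : Set ℝ}
    (hJ : MeasurableSet J) (hζ : Set.EqOn ζ ζ' J) {B : ℝ} (h : FourierRestrictionBound p q ζ J B) :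
    FourierRestrictionBound p q ζ' J B := by
  obtain ⟨R, hR, hbound⟩ := h
  refine ⟨R, fun f hf => ?_, hbound⟩
  filter_upwards [hR f hf, ae_restrict_mem hJ] with t ht htJ
  rw [ht, hζ htJ]

end DensityExtension

/-! ### Offspring curves -/

section Offspring

variable {d m n : ℕ} {γ : ℝ → EuclideanSpace ℝ (Fin d)} {a b δ : ℝ} {h : Fin (m + 1) → ℝ}

theorem add_mem_Icc_of_mem_offspringInterval (hh : Monotone h) {t : ℝ}
    (ht : t ∈ offspringInterval a b h) (j : Fin (m + 1)) : t + h j ∈ Set.Icc a b := by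
  have hfirst := hh (Fin.zero_le j)
  have hlast := hh (Fin.le_last j)
  constructor <;> linarith [ht.1, ht.2]

theorem differentiableOn_offspringCurve (hγ : DifferentiableOn ℝ γ (Set.Icc a b))
    (hh : Monotone h) : DifferentiableOn ℝ (offspringCurve γ h) (offspringInterval a b h) := by
  have hterm (j) : DifferentiableOn ℝ (fun t => γ (t + h j)) (offspringInterval a b h) :=
    hγ.comp (differentiableOn_id.add_const (h j)) fun t ht =>
      add_mem_Icc_of_mem_offspringInterval hh ht j
  exact (DifferentiableOn.fun_sum fun j _ => hterm j).const_smul ((m : ℝ) + 1)⁻¹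

theorem baseTuple_apply (s : ℝ) (κ : Fin n → ℝ) (j : Fin (n + 1)) :
    baseTuple s κ j = s + baseTuple 0 κ j := by
  simp [baseTuple]

theorem baseTuple_zero_apply_zero (κ : Fin n → ℝ) : baseTuple 0 κ 0 = 0 := by
  simp [baseTuple]

theorem baseSet_Icc {κ : Fin n → ℝ} (hκ : Monotone (baseTuple 0 κ)) (x y : ℝ) :
    baseSet (Set.Icc x y) κ = Set.Icc x (y - baseTuple 0 κ (Fin.last n)) := by
  have hκ0 := baseTuple_zero_apply_zero κ
  ext s
  simp only [baseSet, Set.mem_ofPred_eq, baseTuple_apply s κ]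
  constructor
  · intro hs
    constructor <;> linarith [(hs 0).1, (hs (Fin.last n)).2]
  · intro hs j
    have hfirst := hκ (Fin.zero_le j)
    have hlast := hκ (Fin.le_last j)
    constructor <;> linarith [hs.1, hs.2]

theorem translateSum_offspringCurve {M : ℕ} (e : Fin (M + 1) ≃ Fin (n + 1) × Fin (m + 1))
    (γ : ℝ → EuclideanSpace ℝ (Fin (n + 1))) (κ : Fin n → ℝ) (t : ℝ) :
    translateSum (offspringCurve γ h) κ t =
      ((n : ℝ) + 1) • offspringCurve γ (fun i => baseTuple 0 κ (e i).1 + h (e i).2) t := by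
  have hcard : (M : ℝ) + 1 = ((n : ℝ) + 1) * (m + 1) := by
    have := Fintype.card_congr e
    simp only [Fintype.card_prod, Fintype.card_fin] at this
    exact_mod_cast this
  have hsum : ∑ i, γ (t + (baseTuple 0 κ (e i).1 + h (e i).2)) =
      ∑ i, ∑ j, γ (baseTuple t κ i + h j) := by
    rw [← Fintype.sum_prod_type', ← Equiv.sum_comp e]
    simp only [baseTuple_apply t κ, add_assoc]
  simp only [translateSum, curveSum, offspringCurve]
  rw [hsum, hcard, ← Finset.smul_sum, smul_smul, mul_inv, mul_inv_cancel_left₀ (by positivity)]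

theorem exists_monotone_comp_equiv {ι : Type*} [Finite ι] [Nonempty ι] (g : ι → ℝ) :
    ∃ (M : ℕ) (e : Fin (M + 1) ≃ ι), Monotone (g ∘ e) := by
  have := Fintype.ofFinite ι
  obtain ⟨M, hM⟩ : ∃ M, Fintype.card ι = M + 1 :=
    Nat.exists_eq_succ_of_ne_zero Fintype.card_ne_zero
  let e : Fin (M + 1) ≃ ι := (Fintype.equivFinOfCardEq hM).symm
  exact ⟨M, (Tuple.sort (g ∘ e)).trans e, Tuple.monotone_sort (g ∘ e)⟩

theorem exists_translateSum_offspringCurve_eq (hh : IsOffspringParameter h) {κ : Fin n → ℝ}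
    (hκ : Monotone (baseTuple 0 κ)) :
    ∃ (M : ℕ) (h' : Fin (M + 1) → ℝ), IsOffspringParameter h' ∧
      (∀ (γ : ℝ → EuclideanSpace ℝ (Fin (n + 1))) (t : ℝ),
        translateSum (offspringCurve γ h) κ t = ((n : ℝ) + 1) • offspringCurve γ h' t) ∧
      ∀ a b, baseSet (offspringInterval a b h) κ = offspringInterval a b h' := by
  obtain ⟨M, e, he⟩ := exists_monotone_comp_equiv
    fun i : Fin (n + 1) × Fin (m + 1) => baseTuple 0 κ i.1 + h i.2
  set h' : Fin (M + 1) → ℝ := fun i => baseTuple 0 κ (e i).1 + h (e i).2 with hh'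
  have hκ0 := baseTuple_zero_apply_zero κ
  have hfirst : h' 0 = h 0 := by
    refine le_antisymm ?_ ?_
    · simpa [hh', hκ0] using he (Fin.zero_le (e.symm (0, 0)))
    · linarith [hκ (Fin.zero_le (e 0).1), hh.2 (Fin.zero_le (e 0).2)]
  have hlast : h' (Fin.last M) = baseTuple 0 κ (Fin.last n) + h (Fin.last m) := by
    refine le_antisymm (add_le_add (hκ (Fin.le_last _)) (hh.2 (Fin.le_last _))) ?_
    simpa [hh'] using he (Fin.le_last (e.symm (Fin.last n, Fin.last m)))
  refine ⟨M, h', ⟨hfirst ▸ hh.1, he⟩, fun γ t => translateSum_offspringCurve e γ κ t,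
    fun a b => ?_⟩
  rw [offspringInterval, offspringInterval, baseSet_Icc hκ, hfirst, hlast, sub_sub,
    add_comm (h (Fin.last m))]

theorem curveSum_congr {ζ ζ' : ℝ → EuclideanSpace ℝ (Fin d)} {J : Set ℝ} (hζ : Set.EqOn ζ ζ' J)
    {t : Fin d → ℝ} (ht : ∀ j, t j ∈ J) : curveSum ζ t = curveSum ζ' t :=
  Finset.sum_congr rfl fun j _ => hζ (ht j)

theorem curveSum_const_smul (ζ : ℝ → EuclideanSpace ℝ (Fin d)) (r : ℝ) (t : Fin d → ℝ) :
    curveSum (r • ζ) t = r • curveSum ζ t := by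
  simp [curveSum, Finset.smul_sum]

theorem curveSumJacobian_congr {ζ ζ' : ℝ → EuclideanSpace ℝ (Fin d)} {J : Set ℝ}
    (hζ : Set.EqOn ζ ζ' J) {t : Fin d → ℝ} (ht : ∀ j, t j ∈ J) :
    curveSumJacobian ζ J t = curveSumJacobian ζ' J t := by
  simp only [curveSumJacobian, fun j => derivWithin_congr hζ (hζ (ht j))]

theorem curveSumJacobian_const_smul (ζ : ℝ → EuclideanSpace ℝ (Fin d)) (J : Set ℝ) (r : ℝ)
    (t : Fin d → ℝ) : curveSumJacobian (r • ζ) J t = r ^ d * curveSumJacobian ζ J t := by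
  have hsmul : (Matrix.of fun i j : Fin d => derivWithin (r • ζ) J (t j) i) =
      r • Matrix.of fun i j : Fin d => derivWithin ζ J (t j) i := by
    ext i j
    simp [derivWithin_const_smul_field]
  rw [curveSumJacobian, hsmul, Matrix.det_smul, Fintype.card_fin, curveSumJacobian]

/-- The measurable curves that on some interval `I_h` agree with a multiple `r γ_h`, `r ≥ 1`, of
the offspring curve. Measurability on all of `ℝ` is imposed because `γ` itself is only constrained
on `[a, b]`. -/
def offspringFamily (γ : ℝ → EuclideanSpace ℝ (Fin (n + 1))) (a b : ℝ) : CurveFamily n :=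
  fun ζ J => ∃ (r : ℝ) (m : ℕ) (h : Fin (m + 1) → ℝ), 1 ≤ r ∧ IsOffspringParameter h ∧
    J = offspringInterval a b h ∧ Measurable ζ ∧ Set.EqOn ζ (r • offspringCurve γ h) J

theorem offspringFamily_translateSum {γ ζ : ℝ → EuclideanSpace ℝ (Fin (n + 1))} {J : Set ℝ}
    (hζ : offspringFamily γ a b ζ J) {κ : Fin n → ℝ} (hκ : Monotone (baseTuple 0 κ)) :
    offspringFamily γ a b (translateSum ζ κ) (baseSet J κ) := by
  obtain ⟨r, m, h, hr, hh, rfl, hmeas, heq⟩ := hζ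
  obtain ⟨M, h', hh', hcurve, hinterval⟩ := exists_translateSum_offspringCurve_eq hh hκ
  refine ⟨r * (n + 1), M, h', ?_, hh', hinterval a b, ?_, fun t ht => ?_⟩
  · nlinarith [(Nat.cast_nonneg n : (0 : ℝ) ≤ n)]
  · exact (measurable_curveSum hmeas).comp
      ((measurePreserving_baseTuple n).measurable.comp measurable_prodMk_left)
  · rw [translateSum, curveSum_congr heq ht, curveSum_const_smul, ← translateSum, hcurve,
      smul_smul]
    rfl

theorem isAdmissibleFamily_offspringFamily {γ : ℝ → EuclideanSpace ℝ (Fin (n + 1))}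
    (hγ : DifferentiableOn ℝ γ (Set.Icc a b))
    (hinj : ∀ (m : ℕ) (h : Fin (m + 1) → ℝ), IsOffspringParameter h →
      Set.InjOn (curveSum (offspringCurve γ h))
        {t | StrictMono t ∧ ∀ j, t j ∈ offspringInterval a b h})
    (hjac : ∀ (m : ℕ) (h : Fin (m + 1) → ℝ), IsOffspringParameter h →
      (offspringInterval a b h).Nontrivial →
      ∀ t : Fin (n + 1) → ℝ, (∀ j, t j ∈ offspringInterval a b h) →
        δ * |vandermondeProduct t| ≤
          |curveSumJacobian (offspringCurve γ h) (offspringInterval a b h) t|) :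
    IsAdmissibleFamily δ (offspringFamily γ a b) where
  measurable := by
    rintro _ _ ⟨_, _, _, _, _, _, hmeas, _⟩
    exact hmeas
  measurableSet := by
    rintro _ _ ⟨_, _, _, _, _, rfl, _, _⟩
    exact measurableSet_Icc
  volume_ne_top := by
    rintro _ _ ⟨_, _, _, _, _, rfl, _, _⟩
    exact measure_Icc_lt_top.ne
  differentiableOn := by
    rintro _ _ ⟨r, _, _, _, hh, rfl, _, heq⟩
    exact ((differentiableOn_offspringCurve hγ hh.2).const_smul r).congr heq
  injOn := by
    rintro _ _ ⟨r, m, h, hr, hh, rfl, _, heq⟩ s hs t ht hst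
    rw [curveSum_congr heq hs.2, curveSum_congr heq ht.2, curveSum_const_smul,
      curveSum_const_smul] at hst
    exact hinj m h hh hs ht (smul_right_injective _ (zero_lt_one.trans_le hr).ne' hst)
  jacobian := by
    rintro _ _ ⟨r, m, h, hr, hh, rfl, _, heq⟩ hJ t ht
    rw [curveSumJacobian_congr heq ht, curveSumJacobian_const_smul, abs_mul]
    refine (hjac m h hh hJ t ht).trans (le_mul_of_one_le_left (abs_nonneg _) ?_)
    exact (one_le_pow₀ hr).trans (le_abs_self _)
  translateSum hζ _ hκ := offspringFamily_translateSum hζ hκ.monotone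

theorem exists_offspringFamily_eqOn {γ : ℝ → EuclideanSpace ℝ (Fin (n + 1))}
    (hγ : DifferentiableOn ℝ γ (Set.Icc a b)) (hh : IsOffspringParameter h) :
    ∃ ζ, offspringFamily γ a b ζ (offspringInterval a b h) ∧
      Set.EqOn ζ (offspringCurve γ h) (offspringInterval a b h) := by
  classical
  have heq := Set.piecewise_eqOn (offspringInterval a b h) (offspringCurve γ h) 0
  refine ⟨_, ⟨1, m, h, le_rfl, hh, rfl, ?_, by rwa [one_smul]⟩, heq⟩
  exact (differentiableOn_offspringCurve hγ hh.2).continuousOn.measurable_piecewise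
    continuousOn_const measurableSet_Icc

end Offspring

theorem natCast_succ_sq_add_natCast_succ (n : ℕ) :
    ((n + 1 : ℕ) : ℝ≥0∞) ^ 2 + (n + 1 : ℕ) = ENNReal.ofReal (2 * homogeneousDim n) := by
  have hreal : 2 * homogeneousDim n = (((n + 1) ^ 2 + (n + 1) : ℕ) : ℝ) := by
    rw [homogeneousDim]
    push_cast
    ring
  rw [hreal, ENNReal.ofReal_natCast]
  push_cast
  rfl

theorem restriction_exponents {n : ℕ} {p p' q : ℝ≥0∞}
    (hp : p < (((n + 1 : ℕ) : ℝ≥0∞) ^ 2 + (n + 1 : ℕ) + 2) /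
      (((n + 1 : ℕ) : ℝ≥0∞) ^ 2 + (n + 1 : ℕ)))
    (hpp' : p.HolderConjugate p')
    (hq : q = 2 * p' / (((n + 1 : ℕ) : ℝ≥0∞) ^ 2 + (n + 1 : ℕ))) :
    (homogeneousDim n + 1) * p'⁻¹.toReal < 1 ∧ p⁻¹ = ENNReal.ofReal (1 - p'⁻¹.toReal) ∧
      q⁻¹ = ENNReal.ofReal (homogeneousDim n * p'⁻¹.toReal) := by
  have hD := one_le_homogeneousDim n
  rw [natCast_succ_sq_add_natCast_succ] at hp hq
  set D := homogeneousDim n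
  have hD0 : ENNReal.ofReal (2 * D) ≠ 0 := (ENNReal.ofReal_pos.2 (by linarith)).ne'
  have hsum : p⁻¹ + p'⁻¹ = 1 := hpp'.inv_add_inv_eq_one
  have hp'_top : p'⁻¹ ≠ ∞ := ne_top_of_le_ne_top ENNReal.one_ne_top (hsum ▸ le_add_self)
  set u := p'⁻¹.toReal
  have hp'_inv : p'⁻¹ = ENNReal.ofReal u := (ENNReal.ofReal_toReal hp'_top).symm
  have hp_inv : p⁻¹ = ENNReal.ofReal (1 - u) := by
    rw [ENNReal.ofReal_sub _ ENNReal.toReal_nonneg, ← hp'_inv, ENNReal.ofReal_one, ← hsum,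
      ENNReal.add_sub_cancel_right hp'_top]
  refine ⟨?_, hp_inv, ?_⟩
  · rw [← ENNReal.inv_lt_inv, hp_inv, ENNReal.inv_div (.inl ENNReal.ofReal_ne_top) (.inl hD0),
      ← ENNReal.ofReal_ofNat 2, ← ENNReal.ofReal_add (by linarith) zero_le_two,
      ← ENNReal.ofReal_div_of_pos (by linarith),
      ENNReal.ofReal_lt_ofReal_iff_of_nonneg (by positivity), div_lt_iff₀ (by linarith)] at hp
    linarith
  · rw [hq, ENNReal.inv_div (.inl ENNReal.ofReal_ne_top) (.inl hD0),
      ENNReal.ofReal_mul zero_le_two, ENNReal.ofReal_ofNat,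
      ENNReal.mul_div_mul_left _ _ two_ne_zero ENNReal.ofNat_ne_top, div_eq_mul_inv, hp'_inv,
      ← ENNReal.ofReal_mul (by linarith)]

theorem proposition2p1_general (d : ℕ) (hd : 1 ≤ d) (p p' q : ℝ≥0∞)
    (hp : p < ((d : ℝ≥0∞) ^ 2 + d + 2) / ((d : ℝ≥0∞) ^ 2 + d))
    (hpp' : p.HolderConjugate p') (hq : q = 2 * p' / ((d : ℝ≥0∞) ^ 2 + d)) :
    ∃ C : ℝ, 0 < C ∧ ∀ (γ : ℝ → EuclideanSpace ℝ (Fin d)) (a b : ℝ),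
      DifferentiableOn ℝ γ (Set.Icc a b) → ∀ δ : ℝ, 0 < δ →
      (∀ (m : ℕ) (h : Fin (m + 1) → ℝ), IsOffspringParameter h →
        Set.InjOn (curveSum (offspringCurve γ h))
          {t | StrictMono t ∧ ∀ j, t j ∈ offspringInterval a b h}) →
      (∀ (m : ℕ) (h : Fin (m + 1) → ℝ), IsOffspringParameter h →
        (offspringInterval a b h).Nontrivial →
        ∀ t : Fin d → ℝ, (∀ j, t j ∈ offspringInterval a b h) →
          δ * |vandermondeProduct t| ≤
            |curveSumJacobian (offspringCurve γ h) (offspringInterval a b h) t|) →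
      ∀ (m : ℕ) (h : Fin (m + 1) → ℝ), IsOffspringParameter h →
        FourierRestrictionBound p q (offspringCurve γ h) (offspringInterval a b h)
          (C * δ ^ (-p'⁻¹.toReal)) := by
  obtain ⟨n, rfl⟩ := Nat.exists_eq_add_of_le' hd
  obtain ⟨hu, hp_inv, hq_inv⟩ := restriction_exponents hp hpp' hq
  have hq1 : 1 ≤ q := by
    rw [← ENNReal.inv_le_one, hq_inv, ENNReal.ofReal_le_one]
    linarith [ENNReal.toReal_nonneg (a := p'⁻¹)]
  have := Fact.mk hpp'.one_le
  have := Fact.mk hq1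
  obtain ⟨C, hC, hbound⟩ := exists_eLpNorm_fourierHat_le ENNReal.toReal_nonneg hu hp_inv hq_inv
  refine ⟨C * ((2 * Real.pi) ^ (n + 1)) ^ p'⁻¹.toReal, by positivity,
    fun γ a b hγ δ hδ hinj hjac m h hh => ?_⟩
  obtain ⟨ζ, hζ, hζeq⟩ := exists_offspringFamily_eqOn hγ hh
  have hfamily := isAdmissibleFamily_offspringFamily hγ hinj hjac
  rw [mul_assoc, Real.rpow_neg hδ.le, ← div_eq_mul_inv, ← Real.div_rpow (by positivity) hδ.le]
  exact (fourierRestrictionBound_of_eLpNorm_le hp.ne_top (hfamily.measurable hζ) (by positivity)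
    (hbound δ hδ _ hfamily ζ _ hζ)).congr measurableSet_Icc hζeq

theorem mul_two_zpow_neg_rpow_neg {c : ℝ} (hc : 0 < c) (k : ℤ) (u : ℝ) :
    (c * 2 ^ (-k)) ^ (-u) = 2 ^ ((k : ℝ) * u) * c ^ (-u) := by
  rw [Real.mul_rpow hc.le (by positivity), ← Real.rpow_intCast, ← Real.rpow_mul zero_le_two,
    mul_comm]
  push_cast
  rw [neg_mul_neg]

theorem proposition2p1 (d : ℕ) (hd : 1 ≤ d)
    -- the ambient interval `[A, B]`, the constant `c` of the geometric inequality
    (A B : ℝ) (c : ℝ) (hc : 0 < c)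
    -- the exponents
    (p p' q : ℝ≥0∞) (hp1 : 1 ≤ p)
    (hp : p < ((d : ℝ≥0∞) ^ 2 + d + 2) / ((d : ℝ≥0∞) ^ 2 + d))
    (hpp' : p.HolderConjugate p')
    (hq : q = 2 * p' / ((d : ℝ≥0∞) ^ 2 + d)) :
    ∃ Cp : ℝ, 0 < Cp ∧
      ∀ γ : ℝ → EuclideanSpace ℝ (Fin d), ContDiffOn ℝ d γ (Set.Icc A B) →
      ∀ a b : ℝ, A ≤ a → a ≤ b → b ≤ B →
      ∀ k : ℤ,
        -- injectivity on ordered tuples, for every offspring curve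
        (∀ (m : ℕ) (h : Fin (m + 1) → ℝ), IsOffspringParameter h →
          Set.InjOn (curveSum (offspringCurve γ h))
            {t | StrictMono t ∧ ∀ j, t j ∈ offspringInterval a b h}) →
        -- the geometric inequality, for every offspring curve
        -- (required only where `I_h` is not a single point, so that derivatives on it make sense)
        (∀ (m : ℕ) (h : Fin (m + 1) → ℝ), IsOffspringParameter h →
          (offspringInterval a b h).Nontrivial →
          ∀ t : Fin d → ℝ, (∀ j, t j ∈ offspringInterval a b h) →
            c * (2 : ℝ) ^ (-k) * |vandermondeProduct t| ≤
              |curveSumJacobian (offspringCurve γ h) (offspringInterval a b h) t|) →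
        -- the restriction inequality, uniformly over all offspring curves
        ∀ (m : ℕ) (h : Fin (m + 1) → ℝ), IsOffspringParameter h →
          FourierRestrictionBound p q (offspringCurve γ h) (offspringInterval a b h)
            ((2 : ℝ) ^ ((k : ℝ) * (p'⁻¹).toReal) * Cp) := by
  obtain ⟨C, hC, hbound⟩ := proposition2p1_general d hd p p' q hp hpp' hq
  refine ⟨C * c ^ (-p'⁻¹.toReal), by positivity, fun γ hγ a b hAa _ hbB k hinj hjac m h hh => ?_⟩
  have hdiff : DifferentiableOn ℝ γ (Set.Icc a b) :=
    (hγ.differentiableOn (by simpa using (zero_lt_one.trans_le hd).ne')).mono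
      (Set.Icc_subset_Icc hAa hbB)
  rw [mul_left_comm, ← mul_two_zpow_neg_rpow_neg hc]
  exact hbound γ a b hdiff _ (by positivity) hinj hjac m h hh
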